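/- Fix a positive integer $q$ and let $[q]=\{0,1,\dots,q-1\}$. Let $\mathcal F_q$ be the set of all functions $f:[q]^k\to\mathbb Q_{\ge 0}$, of all arities $k\in\mathbb N$ ($k=0$ included). For a finite $\mathcal F\subseteq\mathcal F_q$, an instance $I$ of $\#\mathrm{CSP}(\mathcal F)$ consists of a finite set $V$ of variables and a finite list $\mathcal C$ of constraints (repetitions allowed), where each $C\in\mathcal C$ consists of a function $f_C\in\mathcal F$, of arity $k_C$ say, and a scope $(v_{C,1},\dots,v_{C,k_C})\in V^{k_C}$, whose entries need not be distinct. The problem $\#\mathrm{CSP}(\mathcal F)$ is: given $I$, compute the partition function \[ Z(I)=\sum_{\sigma:V\to[q]}\ \prod_{C\in\mathcal C} f_C\bigl(\sigma(v_{C,1}),\dots,\sigma(v_{C,k_C})\bigr), \] a non-negative rational number, which is output in lowest terms with numerator and denominator in binary. For $c\in[q]$ let $\delta_c:[q]\to\mathbb Q_{\ge 0}$ be the unary function with $\delta_c(c)=1$ and $\delta_c(d)=0$ for $d\ne c$. Write $A\le_{\mathrm T}B$ if problem $A$ is polynomial-time Turing reducible to problem $B$, that is, if some deterministic oracle machine with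 an oracle for $B$ solves $A$ in time polynomial in the length of the input. Then, for every positive integer $q$ and every finite $\mathcal F\subseteq\mathcal F_q$, \[ \#\mathrm{CSP}\bigl(\mathcal F\cup\{\delta_c : c\in[q]\}\bigr)\ \le_{\mathrm T}\ \#\mathrm{CSP}(\mathcal F). \] -/

import Mathlib

open Computability

/-! ### Computational problems -/

/-- A computational problem: given an instance `x`, compute the answer `sol x`. Instances and
answers are presented as words over finite alphabets. -/
structure CompProblem where
  Inst : Type
  Ans : Type
  InAlph : Type
  OutAlph : Type
  [finIn : Fintype InAlph]
  [finOut : Fintype OutAlph]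
  encIn : Encoding Inst InAlph
  encOut : Encoding Ans OutAlph
  sol : Inst → Ans

open scoped Classical in
/-- The oracle for a problem, as a function on words: the word that encodes an instance is
answered by the encoding of the solution; a word that encodes no instance is answered by the
empty word. -/
noncomputable def CompProblem.oracle (B : CompProblem) (w : List B.InAlph) : List B.OutAlph :=
  if h : ∃ y, B.encIn.encode y = w then B.encOut.encode (B.sol h.choose) else []

theorem CompProblem.oracle_encode (B : CompProblem) (y : B.Inst) :
    B.oracle (B.encIn.encode y) = B.encOut.encode (B.sol y) := by
  have h : ∃ y', B.encIn.encode y' = B.encIn.encode y := ⟨y, rfl⟩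
  rw [CompProblem.oracle, dif_pos h, B.encIn.encode_injective h.choose_spec]

/-! ### Oracle machines -/

/-- A deterministic oracle machine: a multi-stack Turing machine (Mathlib's `TM2` model) with
finitely many stacks, finite stack alphabets, finitely many labels and a finite internal memory,
with designated input, output, query and answer stacks over the alphabets `I`, `O`, `Q`, `R`.
A label `l` with `query l = some l'` is a query label: there the machine, instead of running
`prog l`, consults the oracle and continues at label `l'`. -/
structure OracleTM (I O Q R : Type) where
  K : Type
  [decK : DecidableEq K]
  [finK : Fintype K]
  Γ : K → Type
  [finΓ : ∀ k, Fintype (Γ k)]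
  kIn : K
  kOut : K
  kQry : K
  kAns : K
  inEquiv : I ≃ Γ kIn
  outEquiv : O ≃ Γ kOut
  qryEquiv : Q ≃ Γ kQry
  ansEquiv : R ≃ Γ kAns
  Λ : Type
  [finΛ : Fintype Λ]
  main : Λ
  σ : Type
  [finσ : Fintype σ]
  initState : σ
  prog : Λ → Turing.TM2.Stmt Γ Λ σ
  query : Λ → Option Λ

namespace OracleTM

variable {I O Q R : Type}

instance (M : OracleTM I O Q R) : DecidableEq M.K := M.decK

/-- Configurations: the current label (`none` if the machine has halted), the internal memory and
the contents of the stacks (the head of a list is the top of the stack). -/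
abbrev Cfg (M : OracleTM I O Q R) : Type := Turing.TM2.Cfg M.Γ M.Λ M.σ

/-- The initial configuration: the input word is on the input stack, its first letter on top, and
all other stacks are empty. -/
def initCfg (M : OracleTM I O Q R) (w : List I) : M.Cfg where
  l := some M.main
  var := M.initState
  stk := Function.update (fun _ => []) M.kIn (w.map M.inEquiv)

/-- One step of the computation with oracle `g`. A query takes one step: it empties the query
stack, which held the word `w`, and replaces the content of the answer stack by `g w`. -/
def step (M : OracleTM I O Q R) (g : List Q → List R) : M.Cfg → Option M.Cfg
  | ⟨none, _, _⟩ => none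
  | ⟨some l, v, S⟩ =>
    match M.query l with
    | none => some (Turing.TM2.stepAux (M.prog l) v S)
    | some l' =>
      some ⟨some l', v, Function.update (Function.update S M.kQry []) M.kAns
        ((g ((S M.kQry).map M.qryEquiv.symm)).map M.ansEquiv)⟩

/-- With oracle `g`, on input `w`, the machine halts within `t` steps, and then the output stack
holds exactly the word `u`. -/
def OutputsInTime (M : OracleTM I O Q R) (g : List Q → List R) (w : List I) (u : List O)
    (t : ℕ) : Prop :=
  ∃ c : M.Cfg, Nonempty (StateTransition.EvalsToInTime (M.step g) (M.initCfg w) (some c) t) ∧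
    c.l = none ∧ c.stk M.kOut = u.map M.outEquiv

end OracleTM

/-- Polynomial-time Turing reducibility of `A` to `B`: some oracle machine with oracle `B` solves
`A` in a number of steps that is polynomial in the length of the input word. -/
def PolyTimeTuringReducible (A B : CompProblem) : Prop :=
  ∃ (M : OracleTM A.InAlph A.OutAlph B.InAlph B.OutAlph) (p : Polynomial ℕ), ∀ x : A.Inst,
    M.OutputsInTime B.oracle (A.encIn.encode x) (A.encOut.encode (A.sol x))
      (p.eval (A.encIn.encode x).length)

/-! ### Weighted counting CSPs -/

namespace WCSP

/-- Functions `[q]^k → ℚ≥0` of all arities `k ∈ ℕ`; the domain `[q] = {0, …, q - 1}` is `Fin q`. -/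
abbrev WFun (q : ℕ) : Type := Σ k : ℕ, (Fin k → Fin q) → ℚ≥0

/-- The unary function `δ_c`. -/
def pin {q : ℕ} (c : Fin q) : WFun q := ⟨1, fun x => if x 0 = c then 1 else 0⟩

/-- A constraint over the variables `Fin n`: a function of `F` and its scope. The variables in the
scope need not be distinct. -/
abbrev Constraint {q : ℕ} (F : Finset (WFun q)) (n : ℕ) : Type :=
  Σ f : {f // f ∈ F}, (Fin f.1.1 → Fin n)

/-- An instance: a number of variables and a list of constraints. -/
structure Instance {q : ℕ} (F : Finset (WFun q)) where
  numVars : ℕ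
  constraints : List (Constraint F numVars)

/-- The weight of a configuration. -/
def Instance.weight {q : ℕ} {F : Finset (WFun q)} (I : Instance F)
    (σ : Fin I.numVars → Fin q) : ℚ≥0 :=
  (I.constraints.map fun C => C.1.1.2 fun i => σ (C.2 i)).prod

/-- The partition function. -/
def Instance.Z {q : ℕ} {F : Finset (WFun q)} (I : Instance F) : ℚ≥0 :=
  ∑ σ : Fin I.numVars → Fin q, I.weight σ

/-! #### Words for instances

The alphabet consists of a tick `inl true`, a separator `inl false` and one letter `inr f` for each
of the finitely many `f ∈ F`. A number `i` is written as `i` ticks and a separator. (Since an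
instance lists its variables, writing their indices in unary changes the length of the input only
polynomially.) An instance is written as its number of variables, followed by its constraints,
each of which is the letter of the function followed by the variables in the scope. -/

def unaryWord (α : Type) (i : ℕ) : List (Bool ⊕ α) :=
  List.replicate i (Sum.inl true) ++ [Sum.inl false]

def scopeWord (α : Type) {k n : ℕ} (s : Fin k → Fin n) : List (Bool ⊕ α) :=
  (List.ofFn s).flatMap fun v : Fin n => unaryWord α (v : ℕ)

def constraintWord {q : ℕ} {F : Finset (WFun q)} {n : ℕ} (C : Constraint F n) :
    List (Bool ⊕ {f // f ∈ F}) :=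
  Sum.inr C.1 :: scopeWord _ C.2

def Instance.word {q : ℕ} {F : Finset (WFun q)} (I : Instance F) : List (Bool ⊕ {f // f ∈ F}) :=
  unaryWord _ I.numVars ++ I.constraints.flatMap constraintWord

theorem unaryWord_append_inj {α : Type} {i j : ℕ} {u v : List (Bool ⊕ α)}
    (h : unaryWord α i ++ u = unaryWord α j ++ v) : i = j ∧ u = v := by
  induction i generalizing j with
  | zero => cases j <;> simp_all [unaryWord, List.replicate_succ]
  | succ i ih =>
    cases j with
    | zero => simp [unaryWord, List.replicate_succ] at h
    | succ j =>
      have h' : unaryWord α i ++ u = unaryWord α j ++ v := by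
        simpa [unaryWord, List.replicate_succ] using h
      simpa using ih h'

theorem scopeWord_append_inj {α : Type} {k n : ℕ} {s t : Fin k → Fin n} {u v : List (Bool ⊕ α)}
    (h : scopeWord α s ++ u = scopeWord α t ++ v) : s = t ∧ u = v := by
  induction k with
  | zero => exact ⟨Subsingleton.elim _ _, by simpa [scopeWord] using h⟩
  | succ k ih =>
    simp only [scopeWord, List.ofFn_succ, List.flatMap_cons, List.append_assoc] at h
    obtain ⟨h0, h1⟩ := unaryWord_append_inj h
    obtain ⟨h2, h3⟩ := ih (s := fun i => s i.succ) (t := fun i => t i.succ) h1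
    refine ⟨funext fun i => ?_, h3⟩
    refine Fin.cases (Fin.ext h0) (fun i => congrFun h2 i) i

theorem flatMap_constraintWord_injective {q : ℕ} {F : Finset (WFun q)} {n : ℕ} :
    Function.Injective fun l : List (Constraint F n) => l.flatMap constraintWord := by
  intro l m h
  induction l generalizing m with
  | nil => cases m <;> simp_all [constraintWord]
  | cons C l ih =>
    cases m with
    | nil => simp [constraintWord] at h
    | cons D m =>
      obtain ⟨f, s⟩ := C
      obtain ⟨g, t⟩ := D
      simp only [List.flatMap_cons, constraintWord, List.cons_append, List.cons.injEq,
        Sum.inr.injEq] at h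
      obtain ⟨rfl, h⟩ := h
      obtain ⟨rfl, h2⟩ := scopeWord_append_inj h
      rw [ih h2]

theorem Instance.word_injective {q : ℕ} {F : Finset (WFun q)} :
    Function.Injective (Instance.word (F := F)) := by
  rintro ⟨n, l⟩ ⟨n', l'⟩ h
  obtain ⟨h0, h1⟩ := unaryWord_append_inj h
  change n = n' at h0
  subst h0
  rw [show l = l' from flatMap_constraintWord_injective h1]

noncomputable def encodingInstance {q : ℕ} (F : Finset (WFun q)) :
    Encoding (Instance F) (Bool ⊕ {f // f ∈ F}) where
  encode := Instance.word
  decode := Function.partialInv Instance.word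
  decode_encode x := Function.partialInv_left Instance.word_injective x

/-- A non-negative rational is written in lowest terms, numerator and denominator in binary, in
disjoint copies of the binary alphabet. -/
def encodingNNRat : Encoding ℚ≥0 (Bool ⊕ Bool) where
  encode r := (encodingProd encodingNatBool encodingNatBool).encode (r.num, r.den)
  decode w := ((encodingProd encodingNatBool encodingNatBool).decode w).map
    fun p => (p.1 : ℚ≥0) / (p.2 : ℚ≥0)
  decode_encode r := by
    rw [Encoding.decode_encode]
    simp [NNRat.num_div_den]

/-- The problem `#CSP(F)`: given an instance, compute its partition function. -/
noncomputable def sharpCSP {q : ℕ} (F : Finset (WFun q)) : CompProblem where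
  Inst := Instance F
  Ans := ℚ≥0
  InAlph := Bool ⊕ {f // f ∈ F}
  OutAlph := Bool ⊕ Bool
  encIn := encodingInstance F
  encOut := encodingNNRat
  sol := Instance.Z

end WCSP

/-! ### A structured language for multi-stack oracle machines -/

/-! Merge all variables pinned to `c` into one distinguished variable `c` and drop the pins. If no
variable is pinned to two values, the input becomes a gadget `cs` over `F` with distinguished
variables `Fin q`, and its partition function is `gz cs id`: the value when each variable `c` takes
the value `c` (`Z_eq_gz`, via `sum_agrees`). With contradictory pins the answer is `0`. The oracle
cannot fix the distinguished variables, but if a gadget `J` is attached to them it returns the sum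
of `gz J τ * gz cs τ` over all maps `τ : Fin q → Fin q` (`Z_queryInstance`).

The functions `τ ↦ gz J τ` include the constant `1` (the empty gadget) and are closed under products
(`gz_glue`), so their rational span is a subalgebra of the functions on a finite set. Such an
algebra contains the indicator of the class of all `τ` that no gadget distinguishes from `id`
(`exists_indicator_of_mul_closed`). The corresponding combination of oracle answers sums `gz cs`
over this class. Since `cs` is itself a gadget, `gz cs` is constant there, and the sum is `gz cs id`
times the size of the class (`exists_gadget_combination`). The gadgets and coefficients depend only
on `F`, so finitely many fixed contexts suffice and all constants can be built into the machine;
their mere existence is enough.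

It remains to realise this on an oracle machine in polynomial time. Programs with a big-step
semantics are compiled to machine code (`Exec.evals`). The input is scanned once for the table of
pins and once to write the part of the query word that all queries share; the word of each gadget is
a constant. For arithmetic, let `D` be a common denominator of the values of functions in `F`. On an
input of length `L`, every answer becomes an integer after multiplication by `D ^ L * G` for a fixed
`G`. So it suffices to multiply and divide reduced fractions by constants, where the gcd with a
constant needs only a residue, and to add fixed integer multiples of binary numbers. The sum is kept
in signed digits of bounded size, so carries are resolved only once, at the end. Bounds on the bit
length of partition functions (`Instance.sizeLE_Z`) keep the running time polynomial. -/

/-- Programs acting on stacks with alphabets `Γ k`. A program of type `Prog Γ α` returns a value of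
the finite type `α`, which the machine keeps in its finite control. -/
inductive Prog {K : Type} (Γ : K → Type) : Type → Type 1
  | pure {α : Type} (a : α) : Prog Γ α
  | bind {α β : Type} [Fintype α] (p : Prog Γ α) (f : α → Prog Γ β) : Prog Γ β
  | push (k : K) (a : Γ k) : Prog Γ Unit
  | pop (k : K) : Prog Γ (Option (Γ k))
  | fold {τ : Type} [Fintype τ] (k : K) (init : τ) (body : τ → Γ k → Prog Γ τ) : Prog Γ τ
  | query : Prog Γ Unit

namespace Prog

variable {K : Type} [DecidableEq K] {Γ : K → Type}

/-- Big-step semantics with an upper bound for the number of machine steps. `fold k` empties the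
stack `k`, running its body on each letter. -/
inductive Exec {kq ka : K} (g : List (Γ kq) → List (Γ ka)) : {α : Type} → Prog Γ α →
    (∀ k, List (Γ k)) → α → (∀ k, List (Γ k)) → ℕ → Prop
  | pure {α : Type} (a : α) (S) : Exec g (.pure a) S a S 0
  | bind {α β : Type} [Fintype α] {p : Prog Γ α} {f : α → Prog Γ β} {S a S' b S'' t t'} :
      Exec g p S a S' t → Exec g (f a) S' b S'' t' → Exec g (.bind p f) S b S'' (t + t')
  | push (k : K) (a : Γ k) (S) :
      Exec g (.push k a) S () (Function.update S k (a :: S k)) 1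
  | pop (k : K) (S) : Exec g (.pop k) S (S k).head? (Function.update S k (S k).tail) 1
  | fold_nil {τ : Type} [Fintype τ] {k : K} {t : τ} {body : τ → Γ k → Prog Γ τ} {S} :
      S k = [] → Exec g (.fold k t body) S t S 1
  | fold_cons {τ : Type} [Fintype τ] {k : K} {t t' t'' : τ} {body : τ → Γ k → Prog Γ τ}
      {S S' S'' a l n n'} : S k = a :: l →
      Exec g (body t a) (Function.update S k l) t' S' n →
      Exec g (.fold k t' body) S' t'' S'' n' → Exec g (.fold k t body) S t'' S'' (1 + n + n')
  | query (S) : Exec g .query S ()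
      (Function.update (Function.update S kq []) ka (g (S kq))) 1
  | mono {α : Type} {p : Prog Γ α} {S a S' t t'} :
      Exec g p S a S' t → t ≤ t' → Exec g p S a S' t'

theorem Exec.cast {kq ka : K} {g : List (Γ kq) → List (Γ ka)} {α : Type} {p : Prog Γ α}
    {S a b S' S'' t t'} (h : Exec g p S a S' t) (ha : a = b) (hS : S' = S'') (ht : t ≤ t') :
    Exec g p S b S'' t' := ha ▸ hS ▸ h.mono ht

/-! #### Compilation -/

/-- The labels of the machine code of a program. -/
def Lab : {α : Type} → Prog Γ α → Type
  | _, .pure _ => Empty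
  | _, @Prog.bind _ _ α _ _ p f => Lab p ⊕ Σ a : α, Lab (f a)
  | _, .push _ _ => Unit
  | _, .pop _ => Unit
  | _, @Prog.fold _ _ τ _ k _ body => τ ⊕ Σ x : τ × Γ k, Lab (body x.1 x.2)
  | _, .query => Unit

@[reducible]
noncomputable def fintypeLab [∀ k, Fintype (Γ k)] : {α : Type} → (p : Prog Γ α) → Fintype (Lab p)
  | _, .pure _ => inferInstanceAs (Fintype Empty)
  | _, @Prog.bind _ _ α _ _ p f =>
    letI := fintypeLab p
    letI := fun a => fintypeLab (f a)
    inferInstanceAs (Fintype (Lab p ⊕ Σ a : α, Lab (f a)))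
  | _, .push _ _ => inferInstanceAs (Fintype Unit)
  | _, .pop _ => inferInstanceAs (Fintype Unit)
  | _, @Prog.fold _ _ τ _ k _ body =>
    letI := fun x : τ × Γ k => fintypeLab (body x.1 x.2)
    inferInstanceAs (Fintype (τ ⊕ Σ x : τ × Γ k, Lab (body x.1 x.2)))
  | _, .query => inferInstanceAs (Fintype Unit)

/-- The entry label, for an embedding `e` of the labels and exit labels `x`. -/
def entry {L : Type} : {α : Type} → (p : Prog Γ α) → (Lab p → L) → (α → L) → L
  | _, .pure a, _, x => x a
  | _, @Prog.bind _ _ _ _ _ p f, e, x => entry p (fun l => e (.inl l))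
      fun a => entry (f a) (fun l => e (.inr ⟨a, l⟩)) x
  | _, .push _ _, e, _ => e ()
  | _, .pop _, e, _ => e ()
  | _, @Prog.fold _ _ _ _ _ t _, e, _ => e (.inl t)
  | _, .query, e, _ => e ()

/-- The internal memory of a compiled machine: for each stack, the letter popped last. -/
abbrev Reg (Γ : K → Type) : Type := ∀ k, Option (Γ k)

/-- The code at each label: a statement, or a query with the label at which to continue. -/
def code {L : Type} : {α : Type} → (p : Prog Γ α) → (Lab p → L) → (α → L) → Lab p →
    Turing.TM2.Stmt Γ L (Reg Γ) ⊕ L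
  | _, .pure _, _, _, l => nomatch l
  | _, @Prog.bind _ _ _ _ _ p f, e, x, l =>
    match l with
    | .inl l => code p (fun l => e (.inl l)) (fun a => entry (f a) (fun l => e (.inr ⟨a, l⟩)) x) l
    | .inr ⟨a, l⟩ => code (f a) (fun l => e (.inr ⟨a, l⟩)) x l
  | _, .push k a, _, x, _ => .inl (.push k (fun _ => a) (.goto fun _ => x ()))
  | _, .pop k, _, x, _ =>
    .inl (.pop k (fun v o => Function.update v k o) (.goto fun v => x (v k)))
  | _, @Prog.fold _ _ _ _ k _ body, e, x, l =>
    match l with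
    | .inl t => .inl (.pop k (fun v o => Function.update v k o) (.goto fun v =>
        match v k with
        | none => x t
        | some a => entry (body t a) (fun l => e (.inr ⟨(t, a), l⟩)) fun t' => e (.inl t')))
    | .inr ⟨ta, l⟩ => code (body ta.1 ta.2) (fun l => e (.inr ⟨ta, l⟩)) (fun t' => e (.inl t')) l
  | _, .query, _, x, _ => .inr (x ())

/-- One step of a machine with the code `C`. -/
def codeStep {L : Type} {kq ka : K} (g : List (Γ kq) → List (Γ ka))
    (C : L → Turing.TM2.Stmt Γ L (Reg Γ) ⊕ L) :
    Turing.TM2.Cfg Γ L (Reg Γ) → Option (Turing.TM2.Cfg Γ L (Reg Γ))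
  | ⟨none, _, _⟩ => none
  | ⟨some l, v, S⟩ =>
    match C l with
    | .inl s => some (Turing.TM2.stepAux s v S)
    | .inr l' => some ⟨some l', v,
        Function.update (Function.update S kq []) ka (g (S kq))⟩

/-- The hypothesis `hC` only asks that the code of `p` sit inside a larger code `C`, so the
induction applies to subprograms with their own embeddings and exits. The register contents `v` may
be arbitrary, because a register is read only in the statement that has just popped into it. -/
theorem Exec.evals {kq ka : K} {g : List (Γ kq) → List (Γ ka)} {α : Type} {p : Prog Γ α}
    {S a S' t} (h : Exec g p S a S' t) {L : Type} (C : L → Turing.TM2.Stmt Γ L (Reg Γ) ⊕ L)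
    (e : Lab p → L) (x : α → L) (hC : ∀ l, C (e l) = code p e x l) (v : Reg Γ) :
    ∃ v', Nonempty (StateTransition.EvalsToInTime (codeStep g C) ⟨some (entry p e x), v, S⟩
      (some ⟨some (x a), v', S'⟩) t) := by
  induction h generalizing v with
  | pure a S => exact ⟨v, ⟨.refl _ _⟩⟩
  | @bind α β _ p f S a S' b S'' t t' _ _ ih1 ih2 =>
    obtain ⟨v1, ⟨h1⟩⟩ := ih1 (fun l => e (.inl l))
      (fun a => entry (f a) (fun l => e (.inr ⟨a, l⟩)) x) (fun l => hC _) v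
    obtain ⟨v2, ⟨h2⟩⟩ := ih2 (fun l => e (.inr ⟨a, l⟩)) x (fun l => hC _) v1
    exact ⟨v2, ⟨add_comm t t' ▸ h1.trans _ _ _ _ _ _ h2⟩⟩
  | push k a S =>
    have hc : C (e ()) = _ := hC ()
    refine ⟨v, ⟨⟨⟨1, ?_⟩, le_rfl⟩⟩⟩
    simp [flip, codeStep, entry, hc, code, Turing.TM2.stepAux]
  | pop k S =>
    have hc : C (e ()) = _ := hC ()
    refine ⟨Function.update v k (S k).head?, ⟨⟨⟨1, ?_⟩, le_rfl⟩⟩⟩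
    simp [flip, codeStep, entry, hc, code, Turing.TM2.stepAux]
  | @fold_nil τ _ k t body S hk =>
    have hc : C (e (.inl t)) = _ := hC (.inl t)
    refine ⟨Function.update v k none, ⟨⟨⟨1, ?_⟩, le_rfl⟩⟩⟩
    have : Function.update S k [] = S := by rw [← hk, Function.update_eq_self]
    simp [flip, codeStep, entry, hc, code, Turing.TM2.stepAux, hk, this]
  | @fold_cons τ _ k t t' t'' body S S' S'' a l n n' hk _ _ ih1 ih2 =>
    have hc : C (e (.inl t)) = _ := hC (.inl t)
    obtain ⟨v1, ⟨h1⟩⟩ := ih1 (fun l => e (.inr ⟨(t, a), l⟩)) (fun t' => e (.inl t'))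
      (fun l => hC (.inr ⟨(t, a), l⟩)) (Function.update v k (some a))
    -- The labels and the code of a loop do not depend on its initial state, which determines only
    -- the entry label. Hence the rest of the loop, started at `t'`, runs on the same code.
    obtain ⟨v2, ⟨h2⟩⟩ := ih2 e x (fun l => (hC l).trans (by cases l <;> rfl)) v1
    refine ⟨v2, ⟨?_⟩⟩
    have h0 : StateTransition.EvalsToInTime (codeStep g C)
        ⟨some (entry (.fold k t body) e x), v, S⟩ (some ⟨some (entry (body t a)
          (fun l => e (.inr ⟨(t, a), l⟩)) (fun t' => e (.inl t'))),
          Function.update v k (some a), Function.update S k l⟩) 1 := by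
      refine ⟨⟨1, ?_⟩, le_rfl⟩
      simp [flip, codeStep, entry, hc, code, Turing.TM2.stepAux, hk]
    have := (h0.trans _ _ _ _ _ _ h1).trans _ _ _ _ _ _ h2
    rwa [show n' + (n + 1) = 1 + n + n' by ring] at this
  | query S =>
    have hc : C (e ()) = _ := hC ()
    refine ⟨v, ⟨⟨⟨1, ?_⟩, le_rfl⟩⟩⟩
    simp [flip, codeStep, entry, hc, code]
  | mono _ ht ih =>
    obtain ⟨v', ⟨h⟩⟩ := ih e x hC v
    exact ⟨v', ⟨⟨h.toEvalsTo, h.steps_le_m.trans ht⟩⟩⟩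

/-- The code of a program, with a halting instruction at its exit. -/
def haltCode {α : Type} (p : Prog Γ α) :
    Option (Lab p) → Turing.TM2.Stmt Γ (Option (Lab p)) (Reg Γ) ⊕ Option (Lab p)
  | none => .inl .halt
  | some l => code p some (fun _ => none) l

/-- The oracle machine that runs a program. -/
noncomputable def toMachine [Fintype K] [∀ k, Fintype (Γ k)] {I O Q R : Type} (kIn kOut kQry kAns : K)
    (eI : I ≃ Γ kIn) (eO : O ≃ Γ kOut) (eQ : Q ≃ Γ kQry) (eR : R ≃ Γ kAns) (p : Prog Γ Unit) :
    OracleTM I O Q R where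
  K := K
  Γ := Γ
  kIn := kIn
  kOut := kOut
  kQry := kQry
  kAns := kAns
  inEquiv := eI
  outEquiv := eO
  qryEquiv := eQ
  ansEquiv := eR
  Λ := Option (Lab p)
  finΛ := letI := fintypeLab p; inferInstance
  main := entry p some fun _ => none
  σ := Reg Γ
  finσ := inferInstance
  initState := fun _ => none
  prog l := match haltCode p l with
    | .inl s => s
    | .inr _ => .halt
  query l := match haltCode p l with
    | .inl _ => none
    | .inr l' => some l'

/-- The additional step is the halting instruction at the exit label. The dummy statement that
`prog` assigns to query labels never runs. -/
theorem Exec.outputsInTime [Fintype K] [∀ k, Fintype (Γ k)] {I O Q R : Type}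
    {kIn kOut kQry kAns : K} {eI : I ≃ Γ kIn} {eO : O ≃ Γ kOut} {eQ : Q ≃ Γ kQry}
    {eR : R ≃ Γ kAns} {p : Prog Γ Unit} {g : List Q → List R} {w : List I} {u : List O} {S t}
    (h : Exec (fun l : List (Γ kQry) => (g (l.map eQ.symm)).map eR) p
      (Function.update (fun _ => []) kIn (w.map eI)) () S t) (hS : S kOut = u.map eO) :
    (p.toMachine kIn kOut kQry kAns eI eO eQ eR).OutputsInTime g w u (t + 1) := by
  obtain ⟨v, ⟨hv⟩⟩ := h.evals (L := Option (Lab p))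
    p.haltCode some (fun _ => none) (fun l => rfl) (fun _ => none)
  refine ⟨⟨none, v, S⟩, ⟨?_⟩, rfl, hS⟩
  have hstep : (p.toMachine kIn kOut kQry kAns eI eO eQ eR).step g =
      codeStep (fun l : List (Γ kQry) => (g (l.map eQ.symm)).map eR) p.haltCode := by
    funext c
    rcases c with ⟨_ | l, v, S⟩
    · rfl
    · simp only [OracleTM.step, codeStep, toMachine]
      cases haltCode p l <;> rfl
  rw [hstep]
  have h1 : StateTransition.EvalsToInTime (codeStep (fun l : List (Γ kQry) =>
      (g (l.map eQ.symm)).map eR) p.haltCode) ⟨some none, v, S⟩ (some ⟨none, v, S⟩) 1 := by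
    refine ⟨⟨1, ?_⟩, le_rfl⟩
    simp [flip, codeStep, haltCode, Turing.TM2.stepAux]
  have hinit : (p.toMachine kIn kOut kQry kAns eI eO eQ eR).initCfg w =
      ⟨some (entry p some fun _ => none), fun _ => none,
        Function.update (fun _ => []) kIn (w.map eI)⟩ := rfl
  rw [add_comm]
  exact hinit ▸ hv.trans _ _ _ _ _ _ h1

end Prog

/-! ### Binary representations and reduced fractions -/

namespace Bin

/-- The value of a list of bits, the least significant bit first. -/
def val (l : List Bool) : ℕ := l.foldr (fun b A => 2 * A + b.toNat) 0

@[simp] theorem val_nil : val [] = 0 := rfl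
@[simp] theorem val_cons (b : Bool) (l : List Bool) : val (b :: l) = 2 * val l + b.toNat := rfl

/-- `Nat.bits` has no leading zeros, so a zero bit appended to zero leaves the empty word. This is
the case in which long division must suppress a quotient digit. -/
theorem bits_two_mul_add (Q : ℕ) (b : Bool) :
    Nat.bits (2 * Q + b.toNat) = if b = false ∧ Q = 0 then [] else b :: Nat.bits Q := by
  have h : 2 * Q + b.toNat = Nat.bit b Q := by cases b <;> simp [Nat.bit]
  rw [h]
  split_ifs with h'
  · obtain ⟨rfl, rfl⟩ := h'
    simp
  · rw [Nat.bits_append_bit]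
    rintro rfl
    cases b <;> simp_all

@[simp] theorem val_bits (n : ℕ) : val (Nat.bits n) = n := by
  induction n using Nat.binaryRec' with
  | zero => simp
  | bit b n h ih => rw [Nat.bits_append_bit _ _ h, val_cons, ih]; cases b <;> simp [Nat.bit]

theorem val_lt (l : List Bool) : val l < 2 ^ l.length := by
  induction l with
  | nil => simp
  | cons b l ih =>
    have : b.toNat ≤ 1 := Bool.toNat_le b
    rw [val_cons, List.length_cons, pow_succ]
    omega

theorem length_bits_le {n s : ℕ} (h : n < 2 ^ s) : (Nat.bits n).length ≤ s := by
  rw [Nat.size_eq_bits_len]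
  exact Nat.size_le.2 h

/-- Identifies the bits in the prescribed encoding of answers with `Nat.bits`, the form in which the
registers hold numbers. -/
theorem encodeNat_eq_bits (n : ℕ) : encodeNat n = Nat.bits n := by
  have key : ∀ p : PosNum, encodePosNum p = Nat.bits (p : ℕ) := by
    intro p
    induction p with
    | one => simp [encodePosNum]
    | bit0 p ih =>
      have h0 : (p : ℕ) ≠ 0 := (PosNum.cast_pos p).ne'
      rw [encodePosNum, ih, PosNum.cast_bit0, ← two_mul]
      simp [h0]
    | bit1 p ih =>
      rw [encodePosNum, ih, PosNum.cast_bit1, ← two_mul]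
      simp
  have h : encodeNum ((n : ℕ) : Num) = Nat.bits (((n : ℕ) : Num) : ℕ) := by
    cases hn : ((n : ℕ) : Num) with
    | zero => simp [encodeNum]
    | pos p => simpa [encodeNum] using key p
  rw [encodeNat, h, Num.to_of_nat]

end Bin

/-! ### Reduced fractions under multiplication and division by a natural number, and their bit
sizes. -/

namespace NNRat

theorem num_den_eq_of_coprime {a b : ℕ} (hb : 0 < b) (h : a.Coprime b) {x : ℚ≥0}
    (hx : x * b = a) : x.num = a ∧ x.den = b := by
  have hx' : (x : ℚ) = (a : ℤ) / (b : ℤ) := by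
    have : (x : ℚ) * b = a := by
      have := congrArg (fun y : ℚ≥0 => (y : ℚ)) hx
      simpa using this
    field_simp
    push_cast
    exact this
  have h1 := Rat.num_div_eq_of_coprime (a := a) (b := b) (by exact_mod_cast hb) (by simpa using h)
  have h2 := Rat.den_div_eq_of_coprime (a := a) (b := b) (by exact_mod_cast hb) (by simpa using h)
  rw [← hx'] at h1 h2
  rw [NNRat.num_coe] at h1
  rw [NNRat.den_coe] at h2
  exact ⟨by exact_mod_cast h1, by exact_mod_cast h2⟩

theorem mul_den_eq (x : ℚ≥0) : x * x.den = x.num := by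
  have := NNRat.num_div_den x
  have h0 : (x.den : ℚ≥0) ≠ 0 := by exact_mod_cast x.den_ne_zero
  nth_rw 1 [← this]
  field_simp

/-- As numerator and denominator are coprime, only common factors of the denominator and `D` cancel.
For a constant `D` this gcd is determined by the denominator modulo `D`, so no Euclidean algorithm
on long numbers is needed. -/
theorem num_den_mul_natCast (x : ℚ≥0) {D : ℕ} (hD : 0 < D) :
    (x * D).num = x.num * (D / x.den.gcd D) ∧ (x * D).den = x.den / x.den.gcd D := by
  have hg : 0 < x.den.gcd D := Nat.gcd_pos_of_pos_right _ hD
  obtain ⟨a, ha⟩ := Nat.gcd_dvd_left x.den D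
  obtain ⟨c, hc⟩ := Nat.gcd_dvd_right x.den D
  have h1 : x.den / x.den.gcd D = a := by
    nth_rw 1 [ha]; exact Nat.mul_div_cancel_left _ hg
  have h2 : D / x.den.gcd D = c := by
    nth_rw 1 [hc]; exact Nat.mul_div_cancel_left _ hg
  have hcop : a.Coprime c := by
    rw [← h1, ← h2]; exact Nat.coprime_div_gcd_div_gcd hg
  rw [h1, h2]
  refine num_den_eq_of_coprime ?_ ?_ ?_
  · rcases Nat.eq_zero_or_pos a with h | h
    · exact absurd (by rw [ha, h, mul_zero]) x.den_ne_zero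
    · exact h
  · refine Nat.Coprime.mul_left ?_ hcop.symm
    exact x.coprime_num_den.coprime_dvd_right ⟨_, by rw [mul_comm]; exact ha⟩
  · have h3 := mul_den_eq x
    rw [ha] at h3
    push_cast at h3 ⊢
    have h4 : (D : ℚ≥0) = (x.den.gcd D : ℕ) * c := by exact_mod_cast hc
    rw [← h3]
    nth_rw 1 [h4]
    ring

theorem num_den_div_natCast (x : ℚ≥0) {D : ℕ} (hD : 0 < D) :
    (x / D).num = x.num / x.num.gcd D ∧ (x / D).den = x.den * (D / x.num.gcd D) := by
  have hg : 0 < x.num.gcd D := Nat.gcd_pos_of_pos_right _ hD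
  obtain ⟨a, ha⟩ := Nat.gcd_dvd_left x.num D
  obtain ⟨c, hc⟩ := Nat.gcd_dvd_right x.num D
  have h1 : x.num / x.num.gcd D = a := by
    nth_rw 1 [ha]; exact Nat.mul_div_cancel_left _ hg
  have h2 : D / x.num.gcd D = c := by
    nth_rw 1 [hc]; exact Nat.mul_div_cancel_left _ hg
  have hcop : a.Coprime c := by
    rw [← h1, ← h2]; exact Nat.coprime_div_gcd_div_gcd hg
  have hc0 : 0 < c := by
    rcases Nat.eq_zero_or_pos c with h | h
    · rw [h, mul_zero] at hc; omega
    · exact h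
  rw [h1, h2]
  refine num_den_eq_of_coprime (Nat.mul_pos x.den_pos hc0) ?_ ?_
  · refine Nat.Coprime.mul_right ?_ hcop
    exact x.coprime_num_den.coprime_dvd_left ⟨_, by rw [mul_comm]; exact ha⟩
  · have h3 := mul_den_eq x
    have hD' : (D : ℚ≥0) ≠ 0 := by exact_mod_cast hD.ne'
    have h4 : (D : ℚ≥0) = (x.num.gcd D : ℕ) * c := by exact_mod_cast hc
    have h5 : (x.num : ℚ≥0) = (x.num.gcd D : ℕ) * a := by exact_mod_cast ha
    have hg' : ((x.num.gcd D : ℕ) : ℚ≥0) ≠ 0 := by exact_mod_cast hg.ne'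
    have hc' : (c : ℚ≥0) ≠ 0 := by exact_mod_cast hc0.ne'
    push_cast
    have : x * x.den = ((x.num.gcd D : ℕ) : ℚ≥0) * a := by rw [h3, ← h5]
    rw [h4]
    have h6 : x / ((x.num.gcd D : ℕ) * (c : ℚ≥0)) * (x.den * c) = x * x.den / (x.num.gcd D : ℕ) := by
      field_simp
    rw [h6, this]
    field_simp

/-- Numerator and denominator of `x` have at most `s` binary digits. -/
def SizeLE (x : ℚ≥0) (s : ℕ) : Prop := x.num < 2 ^ s ∧ x.den < 2 ^ s

theorem SizeLE.mono {x : ℚ≥0} {s t : ℕ} (h : x.SizeLE s) (hst : s ≤ t) : x.SizeLE t :=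
  ⟨h.1.trans_le (Nat.pow_le_pow_right two_pos hst), h.2.trans_le (Nat.pow_le_pow_right two_pos hst)⟩

/-- The crude estimate `D < 2 ^ D` is good enough, since `D` will be a constant of the reduction. -/
theorem lt_pow_add_of_le_mul {a n s D c : ℕ} (hn : n < 2 ^ s) (hc : c ≤ D) (ha : a ≤ n * c) :
    a < 2 ^ (s + D) := by
  have hD : D < 2 ^ D := Nat.lt_two_pow_self
  calc a ≤ n * c := ha
    _ ≤ n * 2 ^ D := Nat.mul_le_mul_left _ (by omega)
    _ < 2 ^ s * 2 ^ D := Nat.mul_lt_mul_of_pos_right hn (by positivity)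
    _ = 2 ^ (s + D) := by rw [pow_add]

theorem SizeLE.mul_natCast {x : ℚ≥0} {s D : ℕ} (h : x.SizeLE s) (hD : 0 < D) :
    (x * D).SizeLE (s + D) := by
  obtain ⟨h1, h2⟩ := num_den_mul_natCast x hD
  constructor
  · exact lt_pow_add_of_le_mul h.1 (Nat.div_le_self D (x.den.gcd D)) h1.le
  · rw [h2]
    exact (Nat.div_le_self _ _).trans_lt (h.2.trans_le (Nat.pow_le_pow_right two_pos (by omega)))

theorem SizeLE.div_natCast {x : ℚ≥0} {s D : ℕ} (h : x.SizeLE s) (hD : 0 < D) :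
    (x / D).SizeLE (s + D) := by
  obtain ⟨h1, h2⟩ := num_den_div_natCast x hD
  constructor
  · rw [h1]
    exact (Nat.div_le_self _ _).trans_lt (h.1.trans_le (Nat.pow_le_pow_right two_pos (by omega)))
  · exact lt_pow_add_of_le_mul h.2 (Nat.div_le_self D (x.num.gcd D)) h2.le

/-- Since `x * d` is an integer, the formula for its denominator forces `x.den` to divide `d`. -/
theorem num_le_of_mul_natCast_eq {x : ℚ≥0} {d a : ℕ} (hd : 0 < d) (h : x * d = a) :
    x.num ≤ a ∧ x.den ≤ d := by
  have hg := num_den_mul_natCast x hd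
  have h1 : (x * d).num = a := by rw [h]; simp
  have h2 : (x * d).den = 1 := by rw [h]; simp
  have h3 : x.den.gcd d = x.den := by
    rw [h2] at hg
    have := Nat.div_mul_cancel (Nat.gcd_dvd_left x.den d)
    rw [← hg.2] at this
    omega
  have h4 : x.den ∣ d := by rw [← h3]; exact Nat.gcd_dvd_right _ _
  refine ⟨?_, Nat.le_of_dvd hd h4⟩
  rw [← h1, hg.1, h3]
  exact Nat.le_mul_of_pos_right _ (Nat.div_pos (Nat.le_of_dvd hd h4) x.den_pos)

end NNRat

/-! ### Generic routines -/

namespace Prog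

variable {K : Type} [DecidableEq K] {Γ : K → Type} {kq ka : K} {g : List (Γ kq) → List (Γ ka)}

/-- Sequential composition. -/
abbrev seq {α : Type} (p : Prog Γ Unit) (r : Prog Γ α) : Prog Γ α := .bind p fun _ => r

theorem Exec.seq {α : Type} {p : Prog Γ Unit} {r : Prog Γ α} {S u S' a S'' t t'}
    (h : Exec g p S u S' t) (h' : Exec g r S' a S'' t') : Exec g (seq p r) S a S'' (t + t') :=
  .bind h h'

/-- Push a list, its first letter first. -/
def pushAll (k : K) : List (Γ k) → Prog Γ Unit
  | [] => .pure ()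
  | a :: l => seq (.push k a) (pushAll k l)

theorem exec_pushAll (k : K) (l : List (Γ k)) (S) :
    Exec g (pushAll k l) S () (Function.update S k (l.reverse ++ S k)) l.length := by
  induction l generalizing S with
  | nil => exact Exec.cast (.pure () S) rfl (by simp) le_rfl
  | cons a l ih =>
    refine Exec.cast (.bind (.push k a S) (ih _)) rfl ?_ (by simp; omega)
    simp

/-- The loop `fold k t body` may process the letters of `u` on top of the stack `k` in `n` steps,
leading from the local state `t` to `t'` and changing the other stacks from `S` to `S'`. -/
def Runs (g : List (Γ kq) → List (Γ ka)) {τ : Type} [Fintype τ] (k : K) (body : τ → Γ k → Prog Γ τ)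
    (t : τ) (u : List (Γ k)) (S : ∀ k, List (Γ k)) (t' : τ) (S' : ∀ k, List (Γ k)) (n : ℕ) : Prop :=
  ∀ r t'' S'' m, Exec g (.fold k t' body) (Function.update S' k r) t'' S'' m →
    Exec g (.fold k t body) (Function.update S k (u ++ r)) t'' S'' (n + m)

section Runs

variable {τ : Type} [Fintype τ] {k : K} {body : τ → Γ k → Prog Γ τ}

theorem Runs.nil (t : τ) (S) : Runs g k body t [] S t S 0 := by
  intro r t'' S'' m h
  simpa using h

theorem Runs.single {t t' : τ} {a : Γ k} {S S' n}
    (h : ∀ r, Exec g (body t a) (Function.update S k r) t' (Function.update S' k r) n) :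
    Runs g k body t [a] S t' S' (n + 1) := by
  intro r t'' S'' m h'
  refine Exec.cast (.fold_cons (a := a) (l := r) (by simp) (by simpa using h r) h') rfl rfl
    (by omega)

/-- Composition is immediate because `Runs` quantifies over the letters left on the stack and over
every continuation of the loop. -/
theorem Runs.trans {t t' t'' : τ} {u v : List (Γ k)} {S S' S'' n m}
    (h : Runs g k body t u S t' S' n) (h' : Runs g k body t' v S' t'' S'' m) :
    Runs g k body t (u ++ v) S t'' S'' (n + m) := by
  intro r x X l hx
  have := h _ _ _ _ (h' _ _ _ _ hx)
  rwa [← List.append_assoc, ← add_assoc] at this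

theorem Runs.cast {t t' t'' : τ} {u v : List (Γ k)} {S S' S'' n m}
    (h : Runs g k body t u S t' S' n) (hu : u = v) (ht : t' = t'') (hS : S' = S'') (hn : n ≤ m) :
    Runs g k body t v S t'' S'' m := by
  subst hu ht hS
  exact fun r x X l hx => (h _ _ _ _ hx).mono (by omega)

theorem Runs.exec {t t' : τ} {u : List (Γ k)} {S S' n} (h : Runs g k body t u S t' S' n)
    (hu : S k = u) : Exec g (.fold k t body) S t' (Function.update S' k []) (n + 1) := by
  have := h [] t' (Function.update S' k []) 1 (.fold_nil (by simp))
  rwa [List.append_nil, ← hu, Function.update_eq_self] at this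

end Runs

/-- Empty a stack. -/
def clear (k : K) : Prog Γ Unit := .fold k () fun _ _ => .pure ()

theorem exec_clear (k : K) (S) :
    Exec (Γ := Γ) g (clear k) S () (Function.update S k []) ((S k).length + 1) := by
  have : ∀ u : List (Γ k), Runs g k (fun _ _ => .pure ()) () u S () S u.length := by
    intro u
    induction u with
    | nil => exact Runs.nil _ _
    | cons a u ih =>
      exact ((Runs.single (n := 0) fun r => .pure () _).trans ih).cast rfl rfl rfl (by simp; omega)
  exact (this (S k)).exec rfl

/-- Move the content of a stack onto another one, thereby reversing it. -/
def move (k k' : K) (f : Γ k → Γ k') : Prog Γ Unit := .fold k () fun _ a => .push k' (f a)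

theorem exec_move {k k' : K} (hk : k ≠ k') (f : Γ k → Γ k') (S) :
    Exec g (move k k' f) S () (Function.update (Function.update S k []) k'
      (((S k).map f).reverse ++ S k')) (2 * (S k).length + 1) := by
  have : ∀ (u : List (Γ k)) (S), Runs g k (fun _ a => .push k' (f a)) () u S ()
      (Function.update S k' ((u.map f).reverse ++ S k')) (2 * u.length) := by
    intro u
    induction u with
    | nil => exact fun S => (Runs.nil _ _).cast rfl rfl (by simp) (by simp)
    | cons a u ih =>
      intro S
      refine ((Runs.single (n := 1) (S' := Function.update S k' (f a :: S k')) fun r => ?_).trans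
        (ih _)).cast rfl rfl (by simp) (by simp; omega)
      refine Exec.cast (.push _ _ _) rfl ?_ le_rfl
      rw [Function.update_comm hk, Function.update_of_ne hk.symm]
  refine Exec.cast ((this (S k) S).exec rfl) rfl ?_ le_rfl
  rw [Function.update_comm hk]

end Prog

/-! ### Arithmetic routines -/

namespace Bin

/-- The value of a list of signed binary digits, the least significant one first. -/
def digitVal (l : List ℤ) : ℤ := l.foldr (fun d A => 2 * A + d) 0

@[simp] theorem digitVal_nil : digitVal [] = 0 := rfl
@[simp] theorem digitVal_cons (d : ℤ) (l : List ℤ) : digitVal (d :: l) = 2 * digitVal l + d := rfl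

/-- The lowest `n` bits of an integer. -/
def lowBits : ℕ → ℤ → List Bool
  | 0, _ => []
  | n + 1, c => decide (c % 2 = 1) :: lowBits n (c / 2)

@[simp] theorem length_lowBits (n : ℕ) (c : ℤ) : (lowBits n c).length = n := by
  induction n generalizing c with
  | zero => rfl
  | succ n ih => simp [lowBits, ih]

theorem toNat_decide_emod_two (c : ℤ) : ((decide (c % 2 = 1)).toNat : ℤ) = c % 2 := by
  rcases Int.emod_two_eq_zero_or_one c with h | h <;> simp [h]

theorem val_lowBits {n : ℕ} {c : ℤ} (h0 : 0 ≤ c) (h1 : c < 2 ^ n) : (val (lowBits n c) : ℤ) = c := by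
  induction n generalizing c with
  | zero => simp [lowBits]; omega
  | succ n ih =>
    rw [lowBits, val_cons]
    push_cast
    rw [ih (by omega) (by rw [pow_succ] at h1; omega), toNat_decide_emod_two]
    omega

/-- The result of normalising signed digits, with the incoming carry `c`: the bits and the outgoing
carry. -/
def carryOut : ℤ → List ℤ → List Bool × ℤ
  | c, [] => ([], c)
  | c, d :: l => (decide ((d + c) % 2 = 1) :: (carryOut ((d + c) / 2) l).1,
      (carryOut ((d + c) / 2) l).2)

theorem length_carryOut (c : ℤ) (l : List ℤ) : (carryOut c l).1.length = l.length := by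
  induction l generalizing c with
  | nil => rfl
  | cons d l ih => simp [carryOut, ih]

theorem carryOut_spec (c : ℤ) (l : List ℤ) :
    digitVal l + c = val (carryOut c l).1 + 2 ^ l.length * (carryOut c l).2 := by
  induction l generalizing c with
  | nil => simp [carryOut]
  | cons d l ih =>
    have h := ih ((d + c) / 2)
    simp only [carryOut, val_cons, digitVal_cons, List.length_cons]
    push_cast
    rw [toNat_decide_emod_two, pow_succ]
    have h2 := Int.mul_ediv_add_emod (d + c) 2
    linear_combination 2 * h - h2

/-- The sum of a digit and a carry is at most `2 * C` in absolute value, so halving it returns to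
the same range. Hence the carry fits into the finite control as a `Digit C`. -/
theorem carryOut_bound {C : ℤ} {c : ℤ} {l : List ℤ} (hc : |c| ≤ C) (hl : ∀ d ∈ l, |d| ≤ C) :
    |(carryOut c l).2| ≤ C := by
  induction l generalizing c with
  | nil => exact hc
  | cons d l ih =>
    refine ih ?_ fun x hx => hl x (List.mem_cons_of_mem _ hx)
    have := hl d (by simp)
    rw [abs_le] at *
    omega

theorem val_append (u v : List Bool) : val (u ++ v) = val u + 2 ^ u.length * val v := by
  induction u with
  | nil => simp
  | cons b u ih => simp [ih, pow_succ]; ring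

/-- An integer digit of absolute value at most `C`. -/
abbrev Digit (C : ℕ) : Type := {z : ℤ // z ∈ Finset.Icc (-(C : ℤ)) C}

/-- The digit with value `z` (zero if `z` is out of range). -/
noncomputable def Digit.mk' (C : ℕ) (z : ℤ) : Digit C :=
  if h : z ∈ Finset.Icc (-(C : ℤ)) C then ⟨z, h⟩ else ⟨0, by simp⟩

theorem Digit.val_mk' {C : ℕ} {z : ℤ} (h : |z| ≤ C) : (Digit.mk' C z : ℤ) = z := by
  rw [abs_le] at h
  rw [Digit.mk', dif_pos (by simpa using h)]

theorem Digit.abs_le {C : ℕ} (d : Digit C) : |(d : ℤ)| ≤ C := by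
  have := d.2
  rw [Finset.mem_Icc] at this
  exact _root_.abs_le.2 this

end Bin

/-! ### Stacks and arithmetic by finite-state passes. -/

/-- The stacks of the machine. -/
inductive Stk : Type
  | inp | out | qry | ans | cpy | tab | tab2 | body | body2 | acc | acc2
  | reg (i : Fin 4)
  deriving DecidableEq, Fintype

/-- The stack alphabets. Input letters are `Bool ⊕ A'`, query letters are `Bool ⊕ A`. -/
abbrev Alph (A' A : Type) (q B : ℕ) : Stk → Type
  | .inp => Bool ⊕ A'
  | .out => Bool ⊕ Bool
  | .qry => Bool ⊕ A
  | .ans => Bool ⊕ Bool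
  | .cpy => Bool ⊕ A'
  | .tab => Option (Fin q)
  | .tab2 => Option (Fin q)
  | .body => Bool ⊕ A
  | .body2 => Bool ⊕ A
  | .acc => Bin.Digit B
  | .acc2 => Bin.Digit B
  | .reg _ => Bool

noncomputable instance fintypeAlph (A' A : Type) [Fintype A'] [Fintype A] (q B : ℕ) (k : Stk) :
    Fintype (Alph A' A q B k) := by
  cases k <;> simp only [Alph] <;> infer_instance

namespace Prog

open Bin

variable {A' A : Type} {q B : ℕ} {g : List (Bool ⊕ A) → List (Bool ⊕ Bool)}

local notation "P" => Prog (Alph A' A q B)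
local notation "E" => Exec (Γ := Alph A' A q B) (kq := Stk.qry) (ka := Stk.ans) g

/-- Normalise the signed digits `dv a` read from the stack `k`; the resulting bits are written onto
the register `j` in reverse order. -/
noncomputable def normalise (C : ℕ) (k : Stk) (dv : Alph A' A q B k → ℤ) (j : Fin 4) : P Unit :=
  .bind (.fold k (Digit.mk' C 0) fun c a =>
      seq (.push (.reg j) (decide ((dv a + c) % 2 = 1))) (.pure (Digit.mk' C ((dv a + c) / 2))))
    fun c => pushAll (.reg j) (lowBits C c)

/-- Carries are propagated from the least significant digit upwards. The final carry is nonnegative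
and at most `C < 2 ^ C`, so `C` further bits hold it. The word `w` may have leading zeros; a later
`divPass` removes them. -/
theorem exec_normalise {C : ℕ} {k : Stk} {dv : Alph A' A q B k → ℤ} {j : Fin 4} (hk : k ≠ .reg j)
    (hdv : ∀ a, |dv a| ≤ C) {S : ∀ k, List (Alph A' A q B k)} (h0 : 0 ≤ digitVal ((S k).map dv)) :
    ∃ w : List Bool, (val w : ℤ) = digitVal ((S k).map dv) ∧ w.length = (S k).length + C ∧
      E (normalise C k dv j) S () (Function.update (Function.update S k []) (.reg j)
        (w.reverse ++ S (.reg j))) (2 * (S k).length + C + 1) := by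
  have key : ∀ (u : List (Alph A' A q B k)) (c : Digit C) (S), Runs (kq := Stk.qry) (ka := Stk.ans) g k
      (fun (c : Digit C) a => seq (.push (.reg j) (decide ((dv a + c) % 2 = 1)))
        (.pure (Digit.mk' C ((dv a + c) / 2)))) c u S
      (Digit.mk' C (carryOut c (u.map dv)).2)
      (Function.update S (.reg j) ((carryOut c (u.map dv)).1.reverse ++ S (.reg j)))
      (2 * u.length) := by
    intro u
    induction u with
    | nil =>
      refine fun c S => (Runs.nil _ _).cast rfl (Subtype.ext ?_) (by simp [carryOut]) (by simp)
      exact (Digit.val_mk' c.abs_le).symm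
    | cons a u ih =>
      intro c S
      have hb : |(dv a + c) / 2| ≤ (C : ℤ) := by
        have h1 := hdv a
        have h2 := c.abs_le
        rw [_root_.abs_le] at *
        omega
      refine ((Runs.single (n := 1) (S' := Function.update S (.reg j)
        (decide ((dv a + c) % 2 = 1) :: S (.reg j))) fun r => ?_).trans
        (ih (Digit.mk' C ((dv a + c) / 2)) _)).cast rfl ?_ ?_ (by simp; omega)
      · refine Exec.cast (.seq (.push _ _ _) (.pure _ _)) rfl ?_ le_rfl
        rw [Function.update_comm hk, Function.update_of_ne hk.symm]
      · rw [Digit.val_mk' hb]; rfl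
      · simp [Digit.val_mk' hb, carryOut]
  have hmap : ∀ d ∈ (S k).map dv, |d| ≤ (C : ℤ) := by
    intro d hd
    obtain ⟨a, _, rfl⟩ := List.mem_map.1 hd
    exact hdv a
  have hb := carryOut_bound (c := 0) (by simp) hmap
  have hz : ((Digit.mk' C 0 : Digit C) : ℤ) = 0 := Digit.val_mk' (by simp)
  have hspec := carryOut_spec 0 ((S k).map dv)
  set o := carryOut 0 ((S k).map dv) with ho
  have hlen : o.1.length = (S k).length := by rw [ho, length_carryOut, List.length_map]
  -- The bits produced are worth less than `2 ^ (S k).length`, so a negative carry would make the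
  -- total negative.
  have ho2 : 0 ≤ o.2 := by
    by_contra hneg
    have h1 : (val o.1 : ℤ) < 2 ^ (S k).length := by
      have := val_lt o.1
      rw [hlen] at this
      exact_mod_cast this
    rw [List.length_map] at hspec
    have h2 : (2 : ℤ) ^ (S k).length * o.2 ≤ 2 ^ (S k).length * (-1) :=
      mul_le_mul_of_nonneg_left (by omega) (by positivity)
    linarith
  refine ⟨o.1 ++ lowBits C o.2, ?_, by simp [hlen], ?_⟩
  · rw [val_append]
    push_cast
    rw [val_lowBits ho2 ((_root_.abs_le.1 hb).2.trans_lt (by exact_mod_cast Nat.lt_two_pow_self)), hlen]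
    rw [List.length_map] at hspec
    linarith
  · have h1 := (key (S k) (Digit.mk' C 0) S).exec rfl
    rw [hz, ← ho] at h1
    refine Exec.cast (.bind h1 (exec_pushAll _ _ _)) rfl ?_ ?_
    · rw [Digit.val_mk' hb, Function.update_of_ne hk.symm, Function.update_comm hk.symm]
      simp
    · simp; omega

/-- Divide the number whose bits are read from the register `i`, the most significant one first,
by `d ≤ D`; the quotient is written without leading zeros onto the register `j`. -/
noncomputable def divPass (D d : ℕ) (i j : Fin 4) : P (Fin (D + 1) × Bool) :=
  .fold (.reg i) (0, false) fun x b =>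
    seq (if (2 * x.1.1 + b.toNat) / d = 0 ∧ x.2 = false then .pure ()
      else .push (.reg j) (decide ((2 * x.1.1 + b.toNat) / d ≠ 0)))
    (.pure (Fin.ofNat (D + 1) ((2 * x.1.1 + b.toNat) % d),
      decide (¬ ((2 * x.1.1 + b.toNat) / d = 0 ∧ x.2 = false))))

/-- One step of long division in base two: the remainder is less than `d`, so bringing down a bit
produces a quotient digit `0` or `1`. -/
theorem div_step {d : ℕ} (hd : 0 < d) (n : ℕ) (b : Bool) :
    (2 * n + b.toNat) / d = 2 * (n / d) + (2 * (n % d) + b.toNat) / d ∧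
    (2 * n + b.toNat) % d = (2 * (n % d) + b.toNat) % d ∧ (2 * (n % d) + b.toNat) / d < 2 := by
  have hn := Nat.div_add_mod n d
  have hr := Nat.mod_lt n hd
  have h : 2 * n + b.toNat = (2 * (n % d) + b.toNat) + d * (2 * (n / d)) := by
    nth_rw 1 [← hn]; ring
  refine ⟨?_, ?_, ?_⟩
  · rw [h, Nat.add_mul_div_left _ _ hd, add_comm]
  · rw [h, Nat.add_mul_mod_self_left]
  · have : b.toNat ≤ 1 := Bool.toNat_le b
    rw [Nat.div_lt_iff_lt_mul hd]
    omega

/-- The Boolean in the loop state records whether the quotient so far is nonzero; until then zeros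
are not written. The bound on `d` lets the remainder fit into `Fin (D + 1)`. With `d = 1` the pass
merely strips leading zeros. -/
theorem exec_divPass {D d : ℕ} (hd : 0 < d) (hD : d ≤ D + 1) {i j : Fin 4} (hij : i ≠ j)
    {S : ∀ k, List (Alph A' A q B k)} (hj : S (.reg j) = []) :
    ∃ x, E (divPass D d i j) S x (Function.update (Function.update S (.reg i) []) (.reg j)
      (Nat.bits (val (S (.reg i)).reverse / d))) (2 * (S (.reg i)).length + 1) := by
  have hk : Stk.reg i ≠ Stk.reg j := by simpa using hij
  -- Invariant: if the bits read so far have value `n`, the state holds `n % d` and whether `n / d ≠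
  -- 0`, and the target register holds the bits of `n / d`.
  have key : ∀ (u : List Bool) (n : ℕ) (S : ∀ k, List (Alph A' A q B k)),
      S (.reg j) = Nat.bits (n / d) → Runs (kq := Stk.qry) (ka := Stk.ans) g (.reg i)
      (fun (x : Fin (D + 1) × Bool) (b : Bool) =>
        seq (if (2 * x.1.1 + b.toNat) / d = 0 ∧ x.2 = false then .pure ()
          else .push (.reg j) (decide ((2 * x.1.1 + b.toNat) / d ≠ 0)))
        (.pure (Fin.ofNat (D + 1) ((2 * x.1.1 + b.toNat) % d),
          decide (¬ ((2 * x.1.1 + b.toNat) / d = 0 ∧ x.2 = false)))))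
      (Fin.ofNat (D + 1) (n % d), decide (n / d ≠ 0)) u S
      (Fin.ofNat (D + 1) (u.foldl (fun A b => 2 * A + b.toNat) n % d),
        decide (u.foldl (fun A b => 2 * A + b.toNat) n / d ≠ 0))
      (Function.update S (.reg j) (Nat.bits (u.foldl (fun A b => 2 * A + b.toNat) n / d)))
      (2 * u.length) := by
    intro u
    induction u with
    | nil => exact fun n S hS => (Runs.nil _ _).cast rfl rfl (by simp [← hS]) (by simp)
    | cons b u ih =>
      intro n S hS
      obtain ⟨h1, h2, h3⟩ := div_step hd n b
      refine ((Runs.single (n := 1) (S' := Function.update S (.reg j)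
        (Nat.bits ((2 * n + b.toNat) / d))) fun r => ?_).trans
        (ih (2 * n + b.toNat) _ (by simp))).cast rfl rfl (by simp) (by simp; omega)
      have hv : (Fin.ofNat (D + 1) (n % d)).1 = n % d :=
        Nat.mod_eq_of_lt ((Nat.mod_lt n hd).trans_le hD)
      simp only [hv]
      generalize (2 * (n % d) + b.toNat) / d = e at *
      have hbits := bits_two_mul_add (n / d) (decide (e ≠ 0))
      have he : (decide (e ≠ 0)).toNat = e := by interval_cases e <;> rfl
      rw [he, ← h1] at hbits
      by_cases hc : e = 0 ∧ n / d = 0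
      · refine Exec.cast (.seq (t := 1) (S' := Function.update S (.reg i) r)
          (by simpa [hc] using (Exec.pure () _).mono (by simp)) (.pure _ _)) ?_ ?_ (by simp)
        · rw [h2, h1]; simp [hc]
        · rw [h1]; simp [hc] at hS ⊢
          rw [← hS, Function.update_eq_self]
      · refine Exec.cast (.seq (t := 1) (by
          rw [if_neg (by simpa using hc)]; exact .push _ _ _) (.pure _ _)) ?_ ?_ (by simp)
        · rw [h2, h1]
          generalize n / d = Q at hc ⊢
          rw [Prod.mk.injEq, decide_eq_decide, decide_eq_false_iff_not]
          exact ⟨rfl, by omega⟩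
        · rw [hbits, if_neg (by simpa using hc), Function.update_comm hk,
            Function.update_of_ne hk.symm, hS]
  have h := (key (S (.reg i)) 0 S (by simp [hj])).exec rfl
  have e : (Fin.ofNat (D + 1) (0 % d), decide (0 / d ≠ 0)) = ((0 : Fin (D + 1)), false) := by simp
  rw [e] at h
  refine ⟨_, Exec.cast h rfl ?_ le_rfl⟩
  · rw [Function.update_comm hk]
    simp [val, List.foldr_reverse]

/-- Move the bits in the register `i`, the most significant one first, onto the register `j` and
compute the residue modulo `D`. -/
noncomputable def modPass (D : ℕ) (i j : Fin 4) : P (Fin (D + 1)) :=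
  .fold (.reg i) 0 fun x b => seq (.push (.reg j) b)
    (.pure (Fin.ofNat (D + 1) ((2 * x.1 + b.toNat) % D)))

theorem exec_modPass {D : ℕ} (hD : 0 < D) {i j : Fin 4} (hij : i ≠ j)
    {S : ∀ k, List (Alph A' A q B k)} :
    E (modPass D i j) S (Fin.ofNat (D + 1) (val (S (.reg i)).reverse % D))
      (Function.update (Function.update S (.reg i) []) (.reg j)
        ((S (.reg i)).reverse ++ S (.reg j))) (2 * (S (.reg i)).length + 1) := by
  have hk : Stk.reg i ≠ Stk.reg j := by simpa using hij
  have key : ∀ (u : List Bool) (n : ℕ) (S : ∀ k, List (Alph A' A q B k)),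
      Runs (kq := Stk.qry) (ka := Stk.ans) g (.reg i)
      (fun (x : Fin (D + 1)) (b : Bool) => seq (.push (.reg j) b)
        (.pure (Fin.ofNat (D + 1) ((2 * x.1 + b.toNat) % D))))
      (Fin.ofNat (D + 1) (n % D)) u S
      (Fin.ofNat (D + 1) (u.foldl (fun A b => 2 * A + b.toNat) n % D))
      (Function.update S (.reg j) (u.reverse ++ S (.reg j)))
      (2 * u.length) := by
    intro u
    induction u with
    | nil => exact fun n S => (Runs.nil _ _).cast rfl rfl (by simp) (by simp)
    | cons b u ih =>
      intro n S
      refine ((Runs.single (n := 1) (S' := Function.update S (.reg j) (b :: S (.reg j)))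
        fun r => ?_).trans (ih (2 * n + b.toNat) _)).cast rfl rfl (by simp) (by simp; omega)
      have hv : (Fin.ofNat (D + 1) (n % D)).1 = n % D :=
        Nat.mod_eq_of_lt ((Nat.mod_lt n hD).trans_le (Nat.le_succ D))
      refine Exec.cast (.seq (.push _ _ _) (.pure _ _)) ?_ ?_ le_rfl
      · rw [hv, ← (div_step hD n b).2.1]
      · rw [Function.update_comm hk, Function.update_of_ne hk.symm]
  have h := (key (S (.reg i)) 0 S).exec rfl
  have e : Fin.ofNat (D + 1) (0 % D) = 0 := by simp
  rw [e] at h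
  refine Exec.cast h ?_ ?_ le_rfl
  · simp [val, List.foldr_reverse]
  · rw [Function.update_comm hk]

end Prog

/-! ### Exact arithmetic on a rational held in lowest terms. -/

namespace Prog

open Bin

variable {A' A : Type} {q B : ℕ} {g : List (Bool ⊕ A) → List (Bool ⊕ Bool)}

local notation "P" => Prog (Alph A' A q B)
local notation "E" => Exec (Γ := Alph A' A q B) (kq := Stk.qry) (ka := Stk.ans) g

/-- Replace the number `a` in the register `i` by `a / G` and multiply the number in the register
`j` by `D / G`. -/
noncomputable def scale (D G : ℕ) (i j : Fin 4) : P Unit :=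
  seq (move (.reg i) (.reg 2) id) (.bind (divPass D G 2 i) fun _ =>
    seq (normalise D (.reg j) (fun b : Bool => ((D / G * b.toNat : ℕ) : ℤ)) 2)
      (.bind (divPass 0 1 2 j) fun _ => .pure ()))

/-- With `G = gcd(a, D)`, replace the number `a` in the register `i` by `a / G` and multiply the
number in the register `j` by `D / G`. -/
noncomputable def cancel (D : ℕ) (i j : Fin 4) : P Unit :=
  seq (move (.reg i) (.reg 2) id) (.bind (modPass D 2 i) fun r => scale D (r.1.gcd D) i j)

theorem digitVal_map_mul (m : ℕ) (l : List Bool) :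
    digitVal (l.map fun b => ((m * b.toNat : ℕ) : ℤ)) = ((val l * m : ℕ) : ℤ) := by
  induction l with
  | nil => simp
  | cons b l ih =>
    rw [List.map_cons, digitVal_cons, ih, val_cons]
    push_cast
    ring

/-- The first pass finds `a % D`, hence `a.gcd D`, and the control branches on this value. The
division and the multiplication then use constants. The product is formed from digits `D / G * b`,
all at most `D`, and then normalised. -/
theorem exec_cancel {D : ℕ} (hD : 0 < D) {i j : Fin 4} (hij : i ≠ j) (hi : i ≠ 2) (hj : j ≠ 2)
    {S : ∀ k, List (Alph A' A q B k)} (h2 : S (.reg 2) = []) {a b : ℕ}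
    (ha : S (.reg i) = Nat.bits a) (hb : S (.reg j) = Nat.bits b) :
    E (cancel D i j) S () (Function.update (Function.update S (.reg i) (Nat.bits (a / a.gcd D)))
      (.reg j) (Nat.bits (b * (D / a.gcd D))))
      (8 * (Nat.bits a).length + 4 * (Nat.bits b).length + 3 * D + 6) := by
  have hi' : Stk.reg i ≠ Stk.reg 2 := by simpa using hi
  have hj' : Stk.reg j ≠ Stk.reg 2 := by simpa using hj
  have hij' : Stk.reg i ≠ Stk.reg j := by simpa using hij
  have e1 := exec_move (kq := .qry) (ka := .ans) (g := g) hi' id S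
  set S1 := Function.update (Function.update S (.reg i) []) (.reg 2)
    (((S (.reg i)).map id).reverse ++ S (.reg 2)) with hS1
  have h12 : S1 (.reg 2) = (Nat.bits a).reverse := by simp [hS1, h2, ha]
  have h1i : S1 (.reg i) = [] := by simp [hS1, hi']
  have e2 := exec_modPass (g := g) hD hi.symm (S := S1)
  have hgcd : (Fin.ofNat (D + 1) (val (S1 (.reg 2)).reverse % D)).1.gcd D = a.gcd D := by
    have : (Fin.ofNat (D + 1) (a % D)).1 = a % D :=
      Nat.mod_eq_of_lt ((Nat.mod_lt a hD).trans_le (Nat.le_succ D))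
    rw [h12, List.reverse_reverse, val_bits, this, Nat.gcd_comm a D, Nat.gcd_rec D a]
  set S2 := Function.update (Function.update S1 (.reg 2) []) (.reg i)
    ((S1 (.reg 2)).reverse ++ S1 (.reg i)) with hS2
  -- Moving to the scratch register and back reverses the word twice, so the residue is obtained
  -- without changing any stack.
  have hS2' : S2 = S := by
    funext x
    by_cases hx : x = .reg i
    · subst hx; simp [hS2, h12, h1i, ha]
    by_cases hx2 : x = .reg 2
    · subst hx2; simp [hS2, hx, h2]
    · simp [hS2, hS1, hx, hx2]
  have hG : 0 < a.gcd D := Nat.gcd_pos_of_pos_right _ hD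
  have hGD : a.gcd D ≤ D := Nat.gcd_le_right _ hD
  obtain ⟨x, e4⟩ := exec_divPass (g := g) (D := D) (d := a.gcd D) hG (by omega) hi.symm (S := S1) h1i
  set S4 := Function.update (Function.update S1 (.reg 2) []) (.reg i)
    (Nat.bits (val (S1 (.reg 2)).reverse / a.gcd D)) with hS4
  have h4j : S4 (.reg j) = Nat.bits b := by simp [hS4, hS1, hij'.symm, hj', hb]
  have h42 : S4 (.reg 2) = [] := by simp [hS4, hi'.symm]
  have h4i : S4 (.reg i) = Nat.bits (a / a.gcd D) := by simp [hS4, h12]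
  have hval := digitVal_map_mul (D / a.gcd D) (Nat.bits b)
  rw [← h4j] at hval
  obtain ⟨w, hw, hwl, e5⟩ := exec_normalise (g := g) (C := D) (k := .reg j)
    (dv := fun b : Bool => ((D / a.gcd D * b.toNat : ℕ) : ℤ)) (j := 2) hj' (by
      intro b
      rw [Nat.abs_cast]
      have h1 : b.toNat ≤ 1 := Bool.toNat_le b
      have h2 := Nat.div_le_self D (a.gcd D)
      exact_mod_cast (Nat.mul_le_mul h2 h1).trans (by omega)) (S := S4) (by rw [hval]; positivity)
  rw [hval] at hw
  have hw' : val w = b * (D / a.gcd D) := by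
    rw [h4j, val_bits] at hw; exact_mod_cast hw
  set S5 := Function.update (Function.update S4 (.reg j) []) (.reg 2) (w.reverse ++ S4 (.reg 2))
    with hS5
  have h52 : S5 (.reg 2) = w.reverse := by simp [hS5, h42]
  obtain ⟨y, e6⟩ := exec_divPass (g := g) (D := 0) (d := 1) one_pos (by omega) hj.symm (S := S5)
    (by simp [hS5, hj'])
  have hlen : (S1 (.reg 2)).length = (Nat.bits a).length := by rw [h12, List.length_reverse]
  have e8 : E (scale D (a.gcd D) i j) S () (Function.update (Function.update S (.reg i)
      (Nat.bits (a / a.gcd D))) (.reg j) (Nat.bits (b * (D / a.gcd D))))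
      (4 * (Nat.bits a).length + 4 * (Nat.bits b).length + 3 * D + 4) := by
    refine Exec.cast (e1.seq (e4.bind (e5.seq (e6.bind (.pure _ _))))) rfl ?_ ?_
    · funext x
      by_cases hx : x = .reg j
      · subst hx; simp [h52, hw']
      by_cases hx2 : x = .reg i
      · subst hx2; simp [hx, hS5, hi', h4i]
      by_cases hx3 : x = .reg 2
      · subst hx3; simp [hx, hx2, h2]
      · simp [hx, hx2, hx3, hS5, hS4, hS1]
    · rw [hlen, h4j, h52, ha, List.length_reverse, hwl, h4j]
      omega
  rw [hS2'] at e2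
  refine Exec.cast (e1.seq (e2.bind (S'' := Function.update (Function.update S (.reg i)
      (Nat.bits (a / a.gcd D))) (.reg j) (Nat.bits (b * (D / a.gcd D))))
    (t' := 4 * (Nat.bits a).length + 4 * (Nat.bits b).length + 3 * D + 4) ?_)) rfl rfl ?_
  · rw [hgcd]
    exact e8
  · rw [hlen, ha]
    omega

/-- The stacks `S`, with `x` in lowest terms in the registers `0` and `1`. -/
noncomputable def setQ (S : ∀ k, List (Alph A' A q B k)) (x : ℚ≥0) : ∀ k, List (Alph A' A q B k) :=
  Function.update (Function.update S (.reg 0) (Nat.bits x.num)) (.reg 1) (Nat.bits x.den)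

@[simp] theorem setQ_num (S : ∀ k, List (Alph A' A q B k)) (x : ℚ≥0) :
    setQ S x (.reg 0) = Nat.bits x.num := by simp [setQ]

@[simp] theorem setQ_den (S : ∀ k, List (Alph A' A q B k)) (x : ℚ≥0) :
    setQ S x (.reg 1) = Nat.bits x.den := by simp [setQ]

theorem setQ_of_ne (S : ∀ k, List (Alph A' A q B k)) (x : ℚ≥0) {k : Stk} (h0 : k ≠ .reg 0)
    (h1 : k ≠ .reg 1) : setQ S x k = S k := by simp [setQ, h0, h1]

theorem update_setQ (S : ∀ k, List (Alph A' A q B k)) (x : ℚ≥0) {k : Stk} (h0 : k ≠ .reg 0)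
    (h1 : k ≠ .reg 1) (l) : Function.update (setQ S x) k l = setQ (Function.update S k l) x := by
  rw [setQ, setQ, Function.update_comm h1.symm, Function.update_comm h0.symm]

/-- Multiply the rational in the registers by `D`. -/
noncomputable def mulNat (D : ℕ) : P Unit := cancel D 1 0

/-- Divide the rational in the registers by `D`. -/
noncomputable def divNat (D : ℕ) : P Unit := cancel D 0 1

theorem exec_mulNat {D : ℕ} (hD : 0 < D) {S : ∀ k, List (Alph A' A q B k)} (h2 : S (.reg 2) = [])
    {x : ℚ≥0} {s : ℕ} (hs : x.SizeLE s) :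
    E (mulNat D) (setQ S x) () (setQ S (x * D)) (12 * s + 3 * D + 6) := by
  refine Exec.cast (exec_cancel hD (i := 1) (j := 0) (by decide) (by decide) (by decide) (a := x.den)
    (b := x.num) (by simpa [setQ] using h2) (by simp) (by simp)) rfl ?_ ?_
  · obtain ⟨h1, h2⟩ := NNRat.num_den_mul_natCast x hD
    rw [← h1, ← h2]
    funext k
    by_cases h0 : k = .reg 0
    · subst h0; simp
    by_cases h1 : k = .reg 1
    · subst h1; simp
    · simp [h0, h1, setQ_of_ne]
  · have := length_bits_le hs.1
    have := length_bits_le hs.2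
    omega

theorem exec_divNat {D : ℕ} (hD : 0 < D) {S : ∀ k, List (Alph A' A q B k)} (h2 : S (.reg 2) = [])
    {x : ℚ≥0} {s : ℕ} (hs : x.SizeLE s) :
    E (divNat D) (setQ S x) () (setQ S (x / D)) (12 * s + 3 * D + 6) := by
  refine Exec.cast (exec_cancel hD (i := 0) (j := 1) (by decide) (by decide) (by decide) (a := x.num)
    (b := x.den) (by simpa [setQ] using h2) (by simp) (by simp)) rfl ?_ ?_
  · obtain ⟨h1, h2⟩ := NNRat.num_den_div_natCast x hD
    rw [← h1, ← h2]
    funext k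
    by_cases h0 : k = .reg 0
    · subst h0; simp
    by_cases h1 : k = .reg 1
    · subst h1; simp
    · simp [h0, h1, setQ_of_ne]
  · have := length_bits_le hs.1
    have := length_bits_le hs.2
    omega

/-- Run a program once for each letter of the stack `cpy`. -/
noncomputable def forCpy (p : P Unit) : P Unit :=
  seq (.fold .cpy () fun _ a => seq (.push .inp a) p) (move .inp .cpy id)

/-- The stack `cpy` serves as a unary counter. Its letters are parked on `inp` and moved back
afterwards; the hypothesis on `p` covers arbitrary contents of these two stacks. -/
theorem exec_forCpy {p : P Unit} {f : ℕ → ℚ≥0} {L T : ℕ}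
    (hp : ∀ n < L, ∀ S : ∀ k, List (Alph A' A q B k), S (.reg 2) = [] →
      E p (setQ S (f n)) () (setQ S (f (n + 1))) T)
    {S : ∀ k, List (Alph A' A q B k)} (h2 : S (.reg 2) = []) (hin : S .inp = [])
    (hL : (S .cpy).length = L) :
    E (forCpy p) (setQ S (f 0)) () (setQ S (f L)) ((T + 4) * L + 2) := by
  have key : ∀ (u : List (Bool ⊕ A')) (n : ℕ) (S : ∀ k, List (Alph A' A q B k)), n + u.length = L →
      S (.reg 2) = [] → Runs (kq := Stk.qry) (ka := Stk.ans) g .cpy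
      (fun _ a => seq (.push .inp a) p) () u (setQ S (f n)) ()
      (setQ (Function.update S .inp (u.reverse ++ S .inp)) (f L)) ((T + 2) * u.length) := by
    intro u
    induction u with
    | nil =>
      intro n S hn _
      have : n = L := by simpa using hn
      subst this
      exact (Runs.nil _ _).cast rfl rfl (by simp) (by simp)
    | cons a u ih =>
      intro n S hn hS
      rw [List.length_cons] at hn
      refine ((Runs.single (n := 1 + T) (S' := setQ (Function.update S .inp (a :: S .inp)) (f (n + 1)))
        fun r => ?_).trans (ih (n + 1) _ (by omega) (by simpa using hS))).cast rfl rfl (by simp)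
        (by rw [List.length_cons]; ring_nf; omega)
      refine .seq (.push _ _ _) ?_
      rw [update_setQ _ _ (by simp) (by simp), update_setQ _ _ (by simp) (by simp),
        update_setQ _ _ (by simp) (by simp)]
      refine Exec.cast (hp n (by omega) _ (by simpa using hS)) rfl ?_ le_rfl
      congr 1
      rw [Function.update_comm (by simp)]
      congr 2
  have h := (key (S .cpy) 0 S (by omega) h2).exec (by simp [setQ])
  refine Exec.cast (h.seq (exec_move (by simp) _ _)) rfl ?_ ?_
  · rw [update_setQ _ _ (by simp) (by simp), update_setQ _ _ (by simp) (by simp),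
        update_setQ _ _ (by simp) (by simp)]
    congr 1
    funext x
    by_cases h1 : x = .cpy
    · subst h1; simp [setQ, hin]
    by_cases h3 : x = .inp
    · subst h3; simp [hin]
    · simp [h1, h3]
  · simp [setQ, hin, hL]
    ring_nf
    omega

/-- Read the answer of the oracle into the registers. -/
noncomputable def readAns : P Unit :=
  seq (.fold .ans () fun _ a => match a with
    | .inl b => .push (.reg 2) b
    | .inr b => .push (.reg 3) b) (seq (move (.reg 2) (.reg 0) id) (move (.reg 3) (.reg 1) id))

theorem exec_readAns {S : ∀ k, List (Alph A' A q B k)} (h0 : S (.reg 0) = []) (h1 : S (.reg 1) = [])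
    (h2 : S (.reg 2) = []) (h3 : S (.reg 3) = []) {x : ℚ≥0} {s : ℕ} (hs : x.SizeLE s) :
    E readAns (Function.update S .ans (WCSP.encodingNNRat.encode x)) ()
      (setQ (Function.update S .ans []) x) (8 * s + 3) := by
  have keyl : ∀ (u : List Bool) (S : ∀ k, List (Alph A' A q B k)),
      Runs (kq := Stk.qry) (ka := Stk.ans) g .ans (fun _ a => match a with
        | .inl b => .push (.reg 2) b
        | .inr b => .push (.reg 3) b) () (u.map .inl) S ()
        (Function.update S (.reg 2) (u.reverse ++ S (.reg 2))) (2 * u.length) := by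
    intro u
    induction u with
    | nil => exact fun S => (Runs.nil _ _).cast rfl rfl (by simp) (by simp)
    | cons a u ih =>
      intro S
      refine ((Runs.single (n := 1) (S' := Function.update S (.reg 2) (a :: S (.reg 2)))
        fun r => ?_).trans (ih _)).cast rfl rfl (by simp) (by simp; omega)
      refine Exec.cast (.push _ _ _) rfl ?_ le_rfl
      rw [Function.update_comm (by simp), Function.update_of_ne (by simp)]
  have keyr : ∀ (u : List Bool) (S : ∀ k, List (Alph A' A q B k)),
      Runs (kq := Stk.qry) (ka := Stk.ans) g .ans (fun _ a => match a with
        | .inl b => .push (.reg 2) b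
        | .inr b => .push (.reg 3) b) () (u.map .inr) S ()
        (Function.update S (.reg 3) (u.reverse ++ S (.reg 3))) (2 * u.length) := by
    intro u
    induction u with
    | nil => exact fun S => (Runs.nil _ _).cast rfl rfl (by simp) (by simp)
    | cons a u ih =>
      intro S
      refine ((Runs.single (n := 1) (S' := Function.update S (.reg 3) (a :: S (.reg 3)))
        fun r => ?_).trans (ih _)).cast rfl rfl (by simp) (by simp; omega)
      refine Exec.cast (.push _ _ _) rfl ?_ le_rfl
      rw [Function.update_comm (by simp), Function.update_of_ne (by simp)]
  have henc : WCSP.encodingNNRat.encode x =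
      (Nat.bits x.num).map .inl ++ (Nat.bits x.den).map .inr := by
    simp [WCSP.encodingNNRat, encodingProd, encodingNatBool, encodeNat_eq_bits]
  rw [henc]
  have h := ((keyl (Nat.bits x.num) S).trans (keyr (Nat.bits x.den) _)) [] _ _ _
    (.fold_nil (by simp))
  rw [List.append_nil] at h
  refine Exec.cast (h.seq ((exec_move (by simp) _ _).seq (exec_move (by simp) _ _))) rfl ?_ ?_
  · funext k
    rcases k with _ | _ | _ | _ | _ | _ | _ | _ | _ | _ | _ | i
    iterate 11 simp [setQ]
    fin_cases i <;> simp [setQ, h0, h1, h2, h3]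
  · have := length_bits_le hs.1
    have := length_bits_le hs.2
    simp [h2, h3]
    omega

/-! ### The signed-digit accumulator. -/

/-- The lowest digits of the sum of a number in signed digits and `e` times a number in binary. -/
noncomputable def addMul (B : ℕ) (e : ℤ) : List Bool → List (Digit B) → List (Digit B)
  | [], _ => []
  | b :: u, ds => Digit.mk' B ((ds.head?.elim 0 fun d => (d : ℤ)) + e * b.toNat) ::
      addMul B e u ds.tail

theorem length_addMul (e : ℤ) (u : List Bool) (ds : List (Digit B)) :
    (addMul B e u ds).length = u.length := by
  induction u generalizing ds with
  | nil => rfl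
  | cons b u ih => simp [addMul, ih]

theorem abs_head_le {c : ℕ} {ds : List (Digit B)} (h : ∀ d ∈ ds, |(d : ℤ)| ≤ c) :
    |(ds.head?.elim 0 fun d => (d : ℤ))| ≤ (c : ℤ) := by
  cases ds with
  | nil => simp
  | cons d ds => exact h d (by simp)

theorem abs_add_mul_le {c : ℕ} {e z : ℤ} (h : |z| ≤ (c : ℤ)) (b : Bool) :
    |z + e * b.toNat| ≤ ((c + e.natAbs : ℕ) : ℤ) := by
  cases b
  · have := abs_nonneg e
    simp; omega
  · simp only [Bool.toNat_true, Nat.cast_one, mul_one]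
    have := abs_add_le z e
    push_cast
    omega

/-- Adding digit by digit without carries is exact as long as no digit leaves `[-B, B]`, where
`Digit.mk'` would replace it by zero. Each addition raises the digit bound from `c` to at most `c +
e.natAbs`, as `addMul_abs_le` records. -/
theorem digitVal_addMul {e : ℤ} {c : ℕ} (hc : c + e.natAbs ≤ B) (u : List Bool)
    {ds : List (Digit B)} (h : ∀ d ∈ ds, |(d : ℤ)| ≤ c) :
    digitVal ((addMul B e u ds ++ ds.drop u.length).map (↑)) = digitVal (ds.map (↑)) + e * val u := by
  induction u generalizing ds with
  | nil => simp [addMul]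
  | cons b u ih =>
    have h1 := ih (ds := ds.tail) fun d hd => h d (List.mem_of_mem_tail hd)
    have h2 := abs_add_mul_le (e := e) (abs_head_le h) b
    simp only [addMul, List.cons_append, List.map_cons, digitVal_cons, List.length_cons, val_cons]
    rw [Digit.val_mk' (h2.trans (by exact_mod_cast hc)), ← List.drop_tail, h1]
    cases ds with
    | nil => simp; ring
    | cons d ds => simp; ring

theorem addMul_abs_le {e : ℤ} {c : ℕ} (hc : c + e.natAbs ≤ B) (u : List Bool)
    {ds : List (Digit B)} (h : ∀ d ∈ ds, |(d : ℤ)| ≤ c) :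
    ∀ d ∈ addMul B e u ds ++ ds.drop u.length, |(d : ℤ)| ≤ ((c + e.natAbs : ℕ) : ℤ) := by
  induction u generalizing ds with
  | nil =>
    intro d hd
    have := h d (by simpa [addMul] using hd)
    have := abs_nonneg e
    push_cast; omega
  | cons b u ih =>
    intro d hd
    simp only [addMul, List.cons_append, List.mem_cons, List.length_cons, ← List.drop_tail] at hd
    rcases hd with rfl | hd
    · have h2 := abs_add_mul_le (e := e) (abs_head_le h) b
      rw [Digit.val_mk' (h2.trans (by exact_mod_cast hc))]
      exact h2
    · exact ih (fun d hd => h d (List.mem_of_mem_tail hd)) d hd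

/-- Add `e` times the number in the register `0` to the accumulator, and clear the registers. -/
noncomputable def accumulate (e : ℤ) : P Unit :=
  seq (.fold (.reg 0) () fun _ b => .bind (.pop .acc) fun o : Option (Digit B) =>
      .push .acc2 (Digit.mk' B ((o.elim 0 fun d => (d : ℤ)) + e * Bool.toNat b)))
    (seq (move .acc .acc2 id) (seq (move .acc2 .acc id) (clear (.reg 1))))

/-- The new low digits lie reversed on `acc2`. Moving the untouched high digits on top of them and
everything back restores the order. When `acc` runs out of digits, the failed pop counts as the
digit zero. -/
theorem exec_accumulate (e : ℤ) {S : ∀ k, List (Alph A' A q B k)} (h2 : S .acc2 = []) :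
    E (accumulate e) S () (Function.update (Function.update (Function.update S (.reg 0) [])
      (.reg 1) []) .acc (addMul B e (S (.reg 0)) (S .acc) ++ (S .acc).drop (S (.reg 0)).length))
      (5 * (S (.reg 0)).length + 4 * (S .acc).length + (S (.reg 1)).length + 4) := by
  have key : ∀ (u : List Bool) (S : ∀ k, List (Alph A' A q B k)),
      Runs (kq := Stk.qry) (ka := Stk.ans) g (.reg 0)
      (fun _ b => .bind (.pop .acc) fun o : Option (Digit B) =>
        .push .acc2 (Digit.mk' B ((o.elim 0 fun d => (d : ℤ)) + e * Bool.toNat b))) () u S ()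
      (Function.update (Function.update S .acc ((S .acc).drop u.length)) .acc2
        ((addMul B e u (S .acc)).reverse ++ S .acc2)) (3 * u.length) := by
    intro u
    induction u with
    | nil => exact fun S => (Runs.nil _ _).cast rfl rfl (by simp [addMul]) (by simp)
    | cons b u ih =>
      intro S
      refine ((Runs.single (n := 2) (S' := Function.update (Function.update S .acc (S .acc).tail) .acc2
        (Digit.mk' B (((S .acc).head?.elim 0 fun d => (d : ℤ)) + e * b.toNat) :: S .acc2))
        fun r => ?_).trans (ih _)).cast rfl rfl ?_ (by simp; omega)
      · refine Exec.cast (.bind (.pop _ _) (.push _ _ _)) rfl ?_ le_rfl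
        funext k
        by_cases hk : k = .acc
        · subst hk; simp
        by_cases hk : k = .acc2
        · subst hk; simp
        by_cases hk : k = .reg 0
        · subst hk; simp
        · simp [*]
      · funext k
        by_cases hk : k = .acc
        · subst hk; simp
        by_cases hk : k = .acc2
        · subst hk; simp [addMul]
        · simp [*]
  refine Exec.cast (((key _ S).exec rfl).seq ((exec_move (by simp) _ _).seq
    ((exec_move (by simp) _ _).seq (exec_clear _ _)))) rfl ?_ ?_
  · funext k
    rcases k with _ | _ | _ | _ | _ | _ | _ | _ | _ | _ | _ | i
    iterate 11 simp [h2]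
    fin_cases i <;> simp
  · simp [h2, length_addMul]
    omega

/-- Turn the content of the accumulator into a rational in the registers. -/
noncomputable def readAcc : P Unit :=
  seq (normalise B .acc (fun d : Digit B => (d : ℤ)) 2)
    (.bind (divPass 0 1 2 0) fun _ => .push (.reg 1) true)

theorem exec_readAcc {S : ∀ k, List (Alph A' A q B k)} (h0 : S (.reg 0) = []) (h1 : S (.reg 1) = [])
    (h2 : S (.reg 2) = []) {n : ℕ} (hn : digitVal ((S .acc).map fun d : Digit B => (d : ℤ)) = n) :
    E readAcc S () (setQ (Function.update S .acc []) n) (4 * (S .acc).length + 3 * B + 3) ∧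
      (n : ℚ≥0).SizeLE ((S .acc).length + B + 1) := by
  obtain ⟨w, hw, hwl, e1⟩ := exec_normalise (g := g) (C := B) (k := .acc)
    (dv := fun d : Digit B => (d : ℤ)) (j := 2) (by simp) (fun a => a.abs_le) (S := S)
    (by rw [hn]; positivity)
  rw [hn] at hw
  have hw' : val w = n := by exact_mod_cast hw
  obtain ⟨x, e2⟩ := exec_divPass (g := g) (D := 0) (d := 1) one_pos (by omega) (i := 2) (j := 0)
    (by decide) (S := Function.update (Function.update S .acc []) (.reg 2)
        (w.reverse ++ S (.reg 2))) (by simpa using h0)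
  refine ⟨Exec.cast (e1.seq (e2.bind (.push _ _ _))) rfl ?_ ?_, ?_⟩
  · funext k
    rcases k with _ | _ | _ | _ | _ | _ | _ | _ | _ | _ | _ | i
    iterate 11 simp [setQ]
    fin_cases i <;> simp [setQ, h1, h2, hw']
  · simp [h2, hwl]
    omega
  · have := val_lt w
    rw [hw', hwl] at this
    constructor
    · rw [NNRat.num_natCast]
      exact this.trans_le (Nat.pow_le_pow_right two_pos (by omega))
    · rw [NNRat.den_natCast]
      exact Nat.one_lt_two_pow (by omega)

/-- Write the rational in the registers onto the output stack. -/
noncomputable def output : P Unit :=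
  seq (move (.reg 1) (.reg 2) id) (seq (move (.reg 2) .out .inr)
    (seq (move (.reg 0) (.reg 2) id) (move (.reg 2) .out .inl)))

theorem exec_output {S : ∀ k, List (Alph A' A q B k)} (h2 : S (.reg 2) = []) (ho : S .out = [])
    {x : ℚ≥0} {s : ℕ} (hs : x.SizeLE s) :
    ∃ S', E output (setQ S x) () S' (8 * s + 4) ∧ S' .out = WCSP.encodingNNRat.encode x := by
  have henc : WCSP.encodingNNRat.encode x =
      (Nat.bits x.num).map .inl ++ (Nat.bits x.den).map .inr := by
    simp [WCSP.encodingNNRat, encodingProd, encodingNatBool, encodeNat_eq_bits]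
  refine ⟨_, ((exec_move (by simp) _ _).seq ((exec_move (by simp) _ _).seq
    ((exec_move (by simp) _ _).seq (exec_move (by simp) _ _)))).mono ?_, ?_⟩
  · have := length_bits_le hs.1
    have := length_bits_le hs.2
    simp [setQ, h2]
    omega
  · simp [setQ, h2, ho, henc]

end Prog

/-! ### Gadgets -/

/-- The span of the `v i` is a unital subalgebra. For each point that some `v i` separates from
`t₀`, an affine function of that `v i` vanishes at the point and is `1` on the class of `t₀`. The
product over the finitely many points is the indicator of that class. -/
theorem exists_indicator_of_mul_closed {T ι : Type} [Fintype T] (v : ι → T → ℚ)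
    (hone : ∃ i, v i = 1) (hmul : ∀ i j, ∃ k, v k = v i * v j) (t₀ : T) :
    ∃ c : ι →₀ ℚ, ∀ t, (c.sum fun i a => a * v i t) =
      open scoped Classical in if ∀ i, v i t = v i t₀ then 1 else 0 := by
  classical
  let W : Submodule ℚ (T → ℚ) := Submodule.span ℚ (Set.range v)
  have h1 : (1 : T → ℚ) ∈ W := by
    obtain ⟨i, hi⟩ := hone
    exact hi ▸ Submodule.subset_span ⟨i, rfl⟩
  have hm : ∀ x y, x ∈ W → y ∈ W → x * y ∈ W := by
    intro x y hx hy
    have : x * y ∈ W * W := Submodule.mul_mem_mul hx hy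
    rw [Submodule.span_mul_span] at this
    refine Submodule.span_mono ?_ this
    rintro _ ⟨_, ⟨i, rfl⟩, _, ⟨j, rfl⟩, rfl⟩
    obtain ⟨k, hk⟩ := hmul i j
    exact ⟨k, hk⟩
  let U : Subalgebra ℚ (T → ℚ) := W.toSubalgebra h1 hm
  have hv : ∀ i, v i ∈ U := fun i => Submodule.subset_span (⟨i, rfl⟩ : v i ∈ Set.range v)
  -- Each factor must be `1` on the whole class of `t₀`, not only at `t₀`, so that the product is
  -- also `1` there.
  have hsep : ∀ t, ∃ f ∈ U, (∀ s, (∀ i, v i s = v i t₀) → f s = 1) ∧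
      ((¬ ∀ i, v i t = v i t₀) → f t = 0) := by
    intro t
    by_cases ht : ∀ i, v i t = v i t₀
    · exact ⟨1, U.one_mem, fun _ _ => rfl, fun h => absurd ht h⟩
    · push Not at ht
      obtain ⟨i, hi⟩ := ht
      refine ⟨(v i t₀ - v i t)⁻¹ • (v i - algebraMap ℚ _ (v i t)),
        U.smul_mem (U.sub_mem (hv i) (U.algebraMap_mem _)) _, fun s hs => ?_, fun _ => ?_⟩
      · have : v i t₀ - v i t ≠ 0 := sub_ne_zero.2 (Ne.symm hi)
        simp [hs i, this]
      · simp
  choose f hfU hf1 hf0 using hsep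
  have hprod : ∏ t, f t ∈ U := Subalgebra.prod_mem _ fun t _ => hfU t
  obtain ⟨c, hc⟩ := Finsupp.mem_span_range_iff_exists_finsupp.1
    (show ∏ t, f t ∈ Submodule.span ℚ (Set.range v) from hprod)
  refine ⟨c, fun t => ?_⟩
  have h := congrFun hc t
  rw [Finset.prod_apply] at h
  have h' : (c.sum fun i a => a * v i t) = (c.sum fun i a => a • v i) t := by
    rw [Finsupp.sum, Finsupp.sum, Finset.sum_apply]
    rfl
  rw [h', h]
  split_ifs with ht
  · exact Finset.prod_eq_one fun s _ => hf1 s t ht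
  · exact Finset.prod_eq_zero (Finset.mem_univ t) (hf0 t ht)

namespace WCSP

variable {q : ℕ} {F : Finset (WFun q)}

/-- A constraint over an arbitrary type of variables. -/
abbrev Con (F : Finset (WFun q)) (V : Type) : Type := Σ f : {f // f ∈ F}, (Fin f.1.1 → V)

/-- Renaming of variables. -/
def Con.map {V W : Type} (h : V → W) (C : Con F V) : Con F W := ⟨C.1, fun i => h (C.2 i)⟩

/-- The weight of a configuration under a list of constraints. -/
def wt {V : Type} (cs : List (Con F V)) (σ : V → Fin q) : ℚ≥0 :=
  (cs.map fun C => C.1.1.2 fun i => σ (C.2 i)).prod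

theorem wt_map {V W : Type} (h : V → W) (cs : List (Con F V)) (σ : W → Fin q) :
    wt (cs.map (Con.map h)) σ = wt cs fun v => σ (h v) := by
  simp [wt, Con.map, Function.comp_def]

theorem wt_append {V : Type} (cs ds : List (Con F V)) (σ : V → Fin q) :
    wt (cs ++ ds) σ = wt cs σ * wt ds σ := by
  simp [wt]

/-- The partition function of a gadget with distinguished variables `Fin q`, whose values are
prescribed by `τ`, and further variables `Fin r`. -/
def gz {r : ℕ} (cs : List (Con F (Fin q ⊕ Fin r))) (τ : Fin q → Fin q) : ℚ≥0 :=
  ∑ φ : Fin r → Fin q, wt cs (Sum.elim τ φ)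

/-- The union of two gadgets along the distinguished variables. -/
def glue {r s : ℕ} (cs : List (Con F (Fin q ⊕ Fin r))) (ds : List (Con F (Fin q ⊕ Fin s))) :
    List (Con F (Fin q ⊕ Fin (r + s))) :=
  cs.map (Con.map (Sum.map id (Fin.castAdd s))) ++ ds.map (Con.map (Sum.map id (Fin.natAdd r)))

theorem sum_append {r s : ℕ} {X M : Type} [Fintype X] [DecidableEq X] [AddCommMonoid M]
    (f : (Fin (r + s) → X) → M) : ∑ φ, f φ = ∑ a : Fin r → X, ∑ b : Fin s → X, f (Fin.append a b) := by
  rw [← Fintype.sum_prod_type', ← (Fin.appendEquiv r s).sum_comp]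
  rfl

/-- For fixed `τ` the two gadgets share no summed variable, so the double sum factorises. -/
theorem gz_glue {r s : ℕ} (cs : List (Con F (Fin q ⊕ Fin r))) (ds : List (Con F (Fin q ⊕ Fin s)))
    (τ : Fin q → Fin q) : gz (glue cs ds) τ = gz cs τ * gz ds τ := by
  rw [gz, sum_append, gz, gz, Finset.sum_mul_sum]
  refine Finset.sum_congr rfl fun a _ => Finset.sum_congr rfl fun b _ => ?_
  rw [glue, wt_append, wt_map, wt_map]
  congr 2
  · funext v; cases v <;> simp
  · funext v; cases v <;> simp

theorem gz_nil (r : ℕ) (τ : Fin q → Fin q) :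
    gz (F := F) ([] : List (Con F (Fin q ⊕ Fin r))) τ = q ^ r := by
  simp [gz, wt]

/-- The point is that one `c` serves all gadgets `cs`: it depends only on `F`, whereas `cs` will
come from the input. -/
theorem exists_gadget_combination (F : Finset (WFun q)) :
    ∃ c : (Σ r, List (Con F (Fin q ⊕ Fin r))) →₀ ℚ, ∀ (r : ℕ) (cs : List (Con F (Fin q ⊕ Fin r))),
      (gz cs id : ℚ) = c.sum fun J a => a * ∑ τ, (gz J.2 τ * gz cs τ : ℚ) := by
  classical
  obtain ⟨c, hc⟩ := exists_indicator_of_mul_closed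
    (fun (J : Σ r, List (Con F (Fin q ⊕ Fin r))) τ => (gz J.2 τ : ℚ))
    ⟨⟨0, []⟩, by funext τ; simp [gz_nil]⟩
    (fun J J' => ⟨⟨_, glue J.2 J'.2⟩, by funext τ; simp [gz_glue]⟩) id
  -- The number of maps that no gadget distinguishes from `id`; it is positive because `id` is one
  -- of them.
  set N : ℚ := ∑ τ : Fin q → Fin q,
    if ∀ J : Σ r, List (Con F (Fin q ⊕ Fin r)), (gz J.2 τ : ℚ) = gz J.2 id then 1 else 0 with hN
  have hN0 : N ≠ 0 := by
    refine (Finset.sum_pos' (fun τ _ => by split_ifs <;> simp) ⟨id, Finset.mem_univ _, ?_⟩).ne'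
    simp
  refine ⟨N⁻¹ • c, fun r cs => ?_⟩
  rw [Finsupp.sum_smul_index (by simp)]
  have : (c.sum fun J a => N⁻¹ * a * ∑ τ, (gz J.2 τ * gz cs τ : ℚ)) =
      N⁻¹ * ∑ τ, (c.sum fun J a => a * (gz J.2 τ : ℚ)) * gz cs τ := by
    simp only [Finsupp.sum, Finset.sum_mul, Finset.mul_sum]
    rw [Finset.sum_comm]
    refine Finset.sum_congr rfl fun _ _ => Finset.sum_congr rfl fun _ _ => by ring
  rw [this]
  have h2 : ∑ τ, (c.sum fun J a => a * (gz J.2 τ : ℚ)) * gz cs τ = N * gz cs id := by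
    rw [hN, Finset.sum_mul]
    refine Finset.sum_congr rfl fun τ _ => ?_
    rw [hc]
    split_ifs with h
    -- Here `cs` is used as one of the gadgets in the definition of the class, so `gz cs` is
    -- constant on it.
    · rw [h ⟨r, cs⟩]
    · simp
  rw [h2]
  field_simp

/-- Isolated variables bring all gadgets to the same number `R` of inner variables; each one
multiplies `gz` by `q`, which the coefficient compensates. With a common `R`, the part of the query
word that describes the input is the same in all queries. -/
theorem exists_gadget_list (hq : 0 < q) (F : Finset (WFun q)) :
    ∃ (R : ℕ) (L : List (List (Con F (Fin q ⊕ Fin R)) × ℚ)),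
      ∀ (r : ℕ) (cs : List (Con F (Fin q ⊕ Fin r))),
      (gz cs id : ℚ) = (L.map fun p => p.2 * ((∑ τ, gz p.1 τ * gz cs τ : ℚ≥0) : ℚ)).sum := by
  obtain ⟨c, hc⟩ := exists_gadget_combination F
  have hR : ∀ J ∈ c.support, J.1 ≤ c.support.sup (fun J => J.1) := fun J hJ =>
    Finset.le_sup (f := fun J : Σ r, List (Con F (Fin q ⊕ Fin r)) => J.1) hJ
  set R := c.support.sup (fun J => J.1)
  have hpad : ∀ J ∈ c.support, ∃ p : List (Con F (Fin q ⊕ Fin R)) × ℚ,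
      ∀ x : (Fin q → Fin q) → ℚ≥0, p.2 * ((∑ τ, gz p.1 τ * x τ : ℚ≥0) : ℚ) =
        c J * ∑ τ, (gz J.2 τ * x τ : ℚ) := by
    intro J hJ
    obtain ⟨s, hs⟩ := Nat.exists_eq_add_of_le (hR J hJ)
    rw [hs]
    refine ⟨⟨glue J.2 ([] : List (Con F (Fin q ⊕ Fin s))), c J / q ^ s⟩, fun x => ?_⟩
    have : (q : ℚ) ≠ 0 := by exact_mod_cast hq.ne'
    push_cast
    simp only [gz_glue, gz_nil]
    push_cast
    rw [Finset.mul_sum, Finset.mul_sum]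
    refine Finset.sum_congr rfl fun τ _ => ?_
    field_simp
  choose! p hp using hpad
  refine ⟨R, c.support.toList.map p, fun r cs => ?_⟩
  rw [hc, List.map_map, Finsupp.sum, ← Finset.sum_map_toList]
  refine congrArg List.sum (List.map_congr_left fun J hJ => ?_)
  exact (hp J (Finset.mem_toList.1 hJ) (gz cs)).symm

/-! ### Queries assembled from an input gadget and a fixed gadget. -/

/-- The variable of a query that represents a variable of the input gadget. -/
def inputVar (q R u : ℕ) : Fin q ⊕ Fin u → Fin (q + R + u) :=
  Sum.elim (fun c => Fin.castAdd u (Fin.castAdd R c)) (Fin.natAdd (q + R))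

/-- The variable of a query that represents a variable of the fixed gadget. -/
def gadgetVar (q R u : ℕ) (v : Fin q ⊕ Fin R) : Fin (q + R + u) :=
  Fin.castAdd u (Sum.elim (Fin.castAdd R) (Fin.natAdd q) v)

/-- The instance that consists of an input gadget and a fixed gadget. -/
def queryInstance {R u : ℕ} (cs : List (Con F (Fin q ⊕ Fin u))) (J : List (Con F (Fin q ⊕ Fin R))) :
    Instance F where
  numVars := q + R + u
  constraints := cs.map (Con.map (inputVar q R u)) ++ J.map (Con.map (gadgetVar q R u))

/-- In a query the distinguished variables are ordinary ones. Summing over their values `τ` last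
leaves independent sums over the inner variables of the two gadgets. -/
theorem Z_queryInstance {R u : ℕ} (cs : List (Con F (Fin q ⊕ Fin u)))
    (J : List (Con F (Fin q ⊕ Fin R))) :
    (queryInstance cs J).Z = ∑ τ, gz J τ * gz cs τ := by
  change ∑ σ : Fin (q + R + u) → Fin q,
    wt (cs.map (Con.map (inputVar q R u)) ++ J.map (Con.map (gadgetVar q R u))) σ = _
  rw [sum_append, sum_append]
  refine Finset.sum_congr rfl fun τ _ => ?_
  rw [gz, gz, Finset.sum_mul_sum]
  refine Finset.sum_congr rfl fun a _ => Finset.sum_congr rfl fun b _ => ?_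
  rw [wt_append, wt_map, wt_map, mul_comm]
  congr 2
  · funext v; cases v <;> simp [gadgetVar]
  · funext v; cases v <;> simp [inputVar]

/-! ### Tables of pinned variables -/

/-- The configuration `σ` respects the pins listed in the table `T`. -/
def Agrees {n : ℕ} (T : List (Option (Fin q))) (σ : Fin n → Fin q) : Prop :=
  ∀ (v : Fin n) (c : Fin q), T[v.1]? = some (some c) → σ v = c

/-- Number of free variables before the variable `v`. -/
def freeIdx (T : List (Option (Fin q))) (v : ℕ) : ℕ := (T.take v).countP Option.isNone

theorem freeIdx_lt {T : List (Option (Fin q))} {v : ℕ} (h : T[v]? = some none) :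
    freeIdx T v < T.countP Option.isNone := by
  induction T generalizing v with
  | nil => simp at h
  | cons t T ih =>
    cases v with
    | zero =>
      have : t = none := by simpa using h
      subst this
      simp [freeIdx]
    | succ v =>
      have := ih (v := v) (by simpa using h)
      simp only [freeIdx, List.take_succ_cons, List.countP_cons] at this ⊢
      omega

/-- With `freeIdx_lt` and `freeIdx_injective`, this makes `freeIdx` a bijection from the free
variables to an initial segment, which gives consecutive numbers to the inner variables of the input
gadget. -/
theorem exists_freeIdx_eq {T : List (Option (Fin q))} {k : ℕ} (hk : k < T.countP Option.isNone) :
    ∃ v, T[v]? = some none ∧ freeIdx T v = k := by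
  induction T generalizing k with
  | nil => simp at hk
  | cons t T ih =>
    cases t with
    | some c =>
      obtain ⟨v, hv, hv'⟩ := ih (k := k) (by simpa using hk)
      exact ⟨v + 1, by simpa using hv, by simpa [freeIdx] using hv'⟩
    | none =>
      cases k with
      | zero => exact ⟨0, by simp, by simp [freeIdx]⟩
      | succ k =>
        obtain ⟨v, hv, hv'⟩ := ih (k := k) (by simpa using hk)
        exact ⟨v + 1, by simpa using hv, by simpa [freeIdx] using hv'⟩

theorem freeIdx_injective {T : List (Option (Fin q))} {v w : ℕ} (hv : T[v]? = some none)
    (hw : T[w]? = some none) (h : freeIdx T v = freeIdx T w) : v = w := by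
  have key : ∀ {v w : ℕ}, v < w → T[v]? = some none → freeIdx T v < freeIdx T w := by
    intro v w hvw hv
    have := freeIdx_lt (T := T.take w) (v := v) (by rw [List.getElem?_take, if_pos hvw, hv])
    rwa [freeIdx, List.take_take, min_eq_left hvw.le] at this
  rcases lt_trichotomy v w with h' | h' | h'
  · exact absurd h (key h' hv).ne
  · exact h'
  · exact absurd h (key h' hw).ne'

end WCSP

namespace WCSP

variable {q : ℕ} {F : Finset (WFun q)}

/-- The variable of the input gadget that replaces the variable `v`. -/
def place {n : ℕ} (T : List (Option (Fin q))) (hT : T.length = n) (v : Fin n) :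
    Fin q ⊕ Fin (T.countP Option.isNone) :=
  match h : T[v.1]'(hT ▸ v.2) with
  | some c => .inl c
  | none => .inr ⟨freeIdx T v, freeIdx_lt (by rw [List.getElem?_eq_getElem (hT ▸ v.2), h])⟩

theorem place_of_some {n : ℕ} {T : List (Option (Fin q))} (hT : T.length = n) {v : Fin n} {c : Fin q}
    (h : T[v.1]? = some (some c)) : place T hT v = .inl c := by
  have h' : T[v.1]'(hT ▸ v.2) = some c := by
    rwa [List.getElem?_eq_getElem (hT ▸ v.2), Option.some.injEq] at h
  unfold place
  split <;> simp_all

theorem place_of_none {n : ℕ} {T : List (Option (Fin q))} (hT : T.length = n) {v : Fin n}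
    (h : T[v.1]? = some none) : place T hT v = .inr ⟨freeIdx T v, freeIdx_lt h⟩ := by
  have h' : T[v.1]'(hT ▸ v.2) = none := by
    rwa [List.getElem?_eq_getElem (hT ▸ v.2), Option.some.injEq] at h
  unfold place
  split <;> simp_all

theorem getElem?_cases {n : ℕ} {T : List (Option (Fin q))} (hT : T.length = n) (v : Fin n) :
    T[v.1]? = some none ∨ ∃ c, T[v.1]? = some (some c) := by
  rw [List.getElem?_eq_getElem (hT ▸ v.2)]
  cases T[v.1]'(hT ▸ v.2) <;> simp

open scoped Classical in
-- A configuration that respects the pins is determined by its values on the free variables, which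
-- are arbitrary. Pinned variables read the distinguished ones, evaluated at `id`.
theorem sum_agrees {n : ℕ} {T : List (Option (Fin q))} (hT : T.length = n)
    (w : (Fin n → Fin q) → ℚ≥0) :
    ∑ σ : Fin n → Fin q, (if Agrees T σ then w σ else 0) =
      ∑ φ : Fin (T.countP Option.isNone) → Fin q, w fun v => Sum.elim id φ (place T hT v) := by
  rw [← Finset.sum_filter]
  symm
  refine Finset.sum_bij (fun φ _ v => Sum.elim id φ (place T hT v)) ?_ ?_ ?_ (fun _ _ => rfl)
  · intro φ _
    simp only [Finset.mem_filter, Finset.mem_univ, true_and]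
    intro v c h
    change Sum.elim id φ (place T hT v) = c
    rw [place_of_some hT h]
    rfl
  · intro φ _ ψ _ h
    funext k
    obtain ⟨v, hv, hk⟩ := exists_freeIdx_eq k.2
    have hvn : v < n := hT ▸ (List.getElem?_eq_some_iff.1 hv).1
    have := congrFun h ⟨v, hvn⟩
    rw [place_of_none (v := ⟨v, hvn⟩) hT hv] at this
    have e : (⟨freeIdx T v, freeIdx_lt hv⟩ : Fin (T.countP Option.isNone)) = k := Fin.ext hk
    simpa [e] using this
  · intro σ hσ
    have hσ' : Agrees T σ := by simpa using hσ
    have hex : ∀ k : Fin (T.countP Option.isNone), ∃ v : Fin n, T[v.1]? = some none ∧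
        freeIdx T v = k := by
      intro k
      obtain ⟨v, hv, hk⟩ := exists_freeIdx_eq k.2
      exact ⟨⟨v, hT ▸ (List.getElem?_eq_some_iff.1 hv).1⟩, hv, hk⟩
    choose f hf hf' using hex
    refine ⟨fun k => σ (f k), Finset.mem_univ _, ?_⟩
    funext v
    rcases getElem?_cases hT v with h | ⟨c, h⟩
    · rw [place_of_none hT h]
      have : f ⟨freeIdx T v, freeIdx_lt h⟩ = v :=
        Fin.ext (freeIdx_injective (hf _) h (hf' _))
      simp [this]
    · rw [place_of_some hT h, hσ' v c h]
      rfl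

/-! ### Collecting the pins and eliminating them from an instance. -/

/-- Record in the table (and a flag that signals a conflict) that the variable `v` is pinned to
`c`. -/
def pinUpd (c : Fin q) (s : List (Option (Fin q)) × Bool) (v : ℕ) : List (Option (Fin q)) × Bool :=
  match s.1[v]? with
  | some e => (s.1.set v (some (e.getD c)), s.2 || decide (e.getD c ≠ c))
  | none => s

theorem length_pinUpd (c : Fin q) (s : List (Option (Fin q)) × Bool) (v : ℕ) :
    (pinUpd c s v).1.length = s.1.length := by
  unfold pinUpd
  split <;> simp

/-- The first pin of a variable is kept and a different later one raises the flag. Hence "no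
conflict, and the table is respected" expresses the conjunction of all pins read, even when they
contradict one another. -/
theorem pinUpd_spec {n : ℕ} (c : Fin q) {s : List (Option (Fin q)) × Bool} (hs : s.1.length = n)
    (v : Fin n) (σ : Fin n → Fin q) :
    ((pinUpd c s v).2 = false ∧ Agrees (pinUpd c s v).1 σ) ↔
      (s.2 = false ∧ Agrees s.1 σ) ∧ σ v = c := by
  have hv : v.1 < s.1.length := hs ▸ v.2
  rcases getElem?_cases hs v with h | ⟨d, h⟩
  · simp only [pinUpd, h, Option.getD_none, ne_eq, not_true_eq_false, decide_false, Bool.or_false]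
    rw [and_assoc]
    refine and_congr_right fun _ => ⟨fun H => ⟨fun w e hw => ?_, ?_⟩, fun H w e hw => ?_⟩
    · refine H w e ?_
      rw [List.getElem?_set_ne, hw]
      intro hvw
      rw [← hvw, h] at hw
      simp at hw
    · exact H v c (by simp [hv])
    · by_cases hvw : v.1 = w.1
      · rw [← hvw, List.getElem?_set_self hv] at hw
        rw [← Fin.ext hvw, H.2]
        simpa using hw
      · rw [List.getElem?_set_ne hvw] at hw
        exact H.1 w e hw
  · have hset : s.1.set v.1 (some d) = s.1 := by
      refine List.ext_getElem? fun i => ?_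
      by_cases hi : v.1 = i
      · rw [← hi, List.getElem?_set_self hv, h]
      · rw [List.getElem?_set_ne hi]
    simp only [pinUpd, h, Option.getD_some, hset]
    by_cases hdc : d = c
    · subst hdc
      simp only [ne_eq, not_true_eq_false, decide_false, Bool.or_false]
      exact ⟨fun H => ⟨H, H.2 v d h⟩, fun H => H.1⟩
    · simp only [ne_eq, hdc, not_false_eq_true, decide_true, Bool.or_true, Bool.true_eq_false,
        false_and, false_iff]
      exact fun H => hdc ((H.1.2 v d h).symm.trans H.2)

/-- The functions of `F` and the pinning functions. -/
abbrev withPins (F : Finset (WFun q)) : Finset (WFun q) :=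
  F ∪ Finset.univ.image (fun c : Fin q => pin c)

open scoped Classical in
/-- The value to which a function outside of `F` pins its argument. -/
noncomputable def pinValue (F : Finset (WFun q)) (f : {f // f ∈ withPins F}) : Option (Fin q) :=
  if h : ∃ c, f.1 = pin c then if f.1 ∈ F then none else some h.choose else none

/-- A pinning function that already lies in `F` is treated as a member of `F`, so each constraint is
either kept or recorded as a pin, never both. -/
theorem pinValue_eq_none {f : {f // f ∈ withPins F}} : pinValue F f = none ↔ f.1 ∈ F := by
  unfold pinValue
  split_ifs with h h' <;> simp_all
  have := f.2
  simp only [Finset.mem_union, Finset.mem_image, Finset.mem_univ, true_and] at this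
  rcases this with h' | ⟨c, hc⟩
  · exact h'
  · exact absurd hc.symm (h c)

theorem pinValue_eq_some {f : {f // f ∈ withPins F}} {c : Fin q} (hc : pinValue F f = some c) :
    f.1 = pin c := by
  unfold pinValue at hc
  split_ifs at hc with h h'
  have := h.choose_spec
  rwa [Option.some.inj hc] at this

/-- The effect of a constraint on the table of pins. -/
noncomputable def pinCon {n : ℕ} (s : List (Option (Fin q)) × Bool) (C : Con (withPins F) (Fin n)) :
    List (Option (Fin q)) × Bool :=
  match pinValue F C.1 with
  | none => s
  | some c => (List.ofFn C.2).foldl (fun s (v : Fin n) => pinUpd c s v.1) s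

open scoped Classical in
/-- The constraint over `F` that a constraint of the input contributes, if any. -/
noncomputable def toF {V : Type} (C : Con (withPins F) V) : Option (Con F V) :=
  if h : C.1.1 ∈ F then some ⟨⟨C.1.1, h⟩, C.2⟩ else none

theorem length_foldl_pinUpd {n : ℕ} (c : Fin q) (s : List (Option (Fin q)) × Bool)
    (l : List (Fin n)) : (l.foldl (fun s (v : Fin n) => pinUpd c s v.1) s).1.length = s.1.length := by
  induction l generalizing s with
  | nil => rfl
  | cons v l ih => rw [List.foldl_cons, ih, length_pinUpd]

theorem length_pinCon {n : ℕ} (s : List (Option (Fin q)) × Bool) (C : Con (withPins F) (Fin n)) :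
    (pinCon s C).1.length = s.1.length := by
  unfold pinCon
  split
  · rfl
  · exact length_foldl_pinUpd _ _ _

theorem length_foldl_pinCon {n : ℕ} (s : List (Option (Fin q)) × Bool)
    (cs : List (Con (withPins F) (Fin n))) : (cs.foldl pinCon s).1.length = s.1.length := by
  induction cs generalizing s with
  | nil => rfl
  | cons C cs ih => rw [List.foldl_cons, ih, length_pinCon]

theorem foldl_pinUpd_spec {n : ℕ} (c : Fin q) {s : List (Option (Fin q)) × Bool}
    (hs : s.1.length = n) (l : List (Fin n)) (σ : Fin n → Fin q) :
    ((l.foldl (fun s (v : Fin n) => pinUpd c s v.1) s).2 = false ∧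
      Agrees (l.foldl (fun s (v : Fin n) => pinUpd c s v.1) s).1 σ) ↔
      (s.2 = false ∧ Agrees s.1 σ) ∧ ∀ v ∈ l, σ v = c := by
  induction l generalizing s with
  | nil => simp
  | cons v l ih =>
    rw [List.foldl_cons, ih ((length_pinUpd _ _ _).trans hs), pinUpd_spec c hs, and_assoc]
    simp

open scoped Classical in
-- A pin contributes an indicator factor to the weight. Reading it moves this factor from the
-- product into the condition on `σ`; a constraint over `F` stays in the product.
theorem wt_foldl_pinCon {n : ℕ} (cs : List (Con (withPins F) (Fin n)))
    {s : List (Option (Fin q)) × Bool} (hs : s.1.length = n) (σ : Fin n → Fin q) :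
    (if s.2 = false ∧ Agrees s.1 σ then wt cs σ else 0) =
      if (cs.foldl pinCon s).2 = false ∧ Agrees (cs.foldl pinCon s).1 σ
        then wt (cs.filterMap toF) σ else 0 := by
  induction cs generalizing s with
  | nil => simp [wt]
  | cons C cs ih =>
    have hcons : wt (C :: cs) σ = C.1.1.2 (fun i => σ (C.2 i)) * wt cs σ := by simp [wt]
    have ih' := ih ((length_pinCon s C).trans hs)
    rw [List.foldl_cons, hcons]
    cases hk : pinValue F C.1 with
    | none =>
      have hF := pinValue_eq_none.1 hk
      have e1 : pinCon s C = s := by simp [pinCon, hk]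
      have e2 : wt ((C :: cs).filterMap toF) σ =
          C.1.1.2 (fun i => σ (C.2 i)) * wt (cs.filterMap toF) σ := by
        simp [toF, hF, wt]
      rw [e1] at ih' ⊢
      rw [e2, ← mul_ite_zero, ← mul_ite_zero, ih']
    | some c =>
      have hF : C.1.1 ∉ F := fun h => by rw [pinValue_eq_none.2 h] at hk; simp at hk
      have e2 : (C :: cs).filterMap toF = cs.filterMap toF := by
        simp [toF, hF]
      have e3 : C.1.1.2 (fun i => σ (C.2 i)) = if ∀ v ∈ List.ofFn C.2, σ v = c then 1 else 0 := by
        obtain ⟨⟨f, hf⟩, t⟩ := C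
        have : f = pin c := pinValue_eq_some hk
        subst this
        have h1 : (∀ v ∈ List.ofFn t, σ v = c) ↔ σ (t (0 : Fin 1)) = c := by
          rw [List.forall_mem_ofFn_iff]
          exact ⟨fun h => h (0 : Fin 1), fun h (i : Fin 1) => by rw [Subsingleton.elim i 0]; exact h⟩
        exact (if_congr h1 rfl rfl).symm
      have e4 := foldl_pinUpd_spec c hs (List.ofFn C.2) σ
      have e5 : pinCon s C = (List.ofFn C.2).foldl (fun s (v : Fin n) => pinUpd c s v.1) s := by
        simp [pinCon, hk]
      rw [e2, ← ih', e5, if_congr e4 rfl rfl, e3]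
      rw [ite_mul, one_mul, zero_mul]
      simp only [ite_and]

/-- The table of pins of a list of constraints. -/
noncomputable def pinTable {n : ℕ} (cs : List (Con (withPins F) (Fin n))) :
    List (Option (Fin q)) × Bool :=
  cs.foldl pinCon (List.replicate n none, false)

theorem length_pinTable {n : ℕ} (cs : List (Con (withPins F) (Fin n))) :
    (pinTable cs).1.length = n := by
  rw [pinTable, length_foldl_pinCon, List.length_replicate]

/-- The gadget of an input instance. -/
noncomputable def inputGadget {n : ℕ} (cs : List (Con (withPins F) (Fin n))) :
    List (Con F (Fin q ⊕ Fin ((pinTable cs).1.countP Option.isNone))) :=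
  (cs.filterMap toF).map (Con.map (place (pinTable cs).1 (length_pinTable cs)))

theorem Z_eq_gz {n : ℕ} (cs : List (Con (withPins F) (Fin n))) :
    (⟨n, cs⟩ : Instance (withPins F)).Z =
      if (pinTable cs).2 then 0 else gz (inputGadget cs) id := by
  classical
  have hag : ∀ σ : Fin n → Fin q, Agrees (List.replicate n none) σ := by
    intro σ v c h
    rw [List.getElem?_replicate] at h
    split_ifs at h
    simp at h
  have h : ∀ σ : Fin n → Fin q, wt cs σ =
      if (pinTable cs).2 = false ∧ Agrees (pinTable cs).1 σ
        then wt (cs.filterMap toF) σ else 0 := by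
    intro σ
    rw [pinTable, ← wt_foldl_pinCon cs (by simp) σ, if_pos ⟨rfl, hag σ⟩]
  change ∑ σ : Fin n → Fin q, wt cs σ = _
  simp only [h]
  cases (pinTable cs).2 with
  | true => simp
  | false =>
    simp only [true_and, Bool.false_eq_true, if_false]
    rw [sum_agrees (length_pinTable cs) (wt (cs.filterMap toF)), gz]
    refine Finset.sum_congr rfl fun φ _ => ?_
    rw [inputGadget, wt_map]

end WCSP

/-! ### Word processing routines -/

namespace Prog

open WCSP

variable {q : ℕ} {F : Finset (WFun q)} {B : ℕ}
  {g : List (Bool ⊕ {f // f ∈ F}) → List (Bool ⊕ Bool)}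

/-- The alphabets for the instances over `F` and their pinned versions. -/
abbrev CspAlph (F : Finset (WFun q)) (B : ℕ) : Stk → Type :=
  Alph {f // f ∈ withPins F} {f // f ∈ F} q B

local notation "P" => Prog (CspAlph F B)
local notation "E" => Exec (Γ := CspAlph F B) (kq := Stk.qry) (ka := Stk.ans) g
local notation "R!" => Runs (Γ := CspAlph F B) (kq := Stk.qry) (ka := Stk.ans) g

/-- The stacks `S` with the given contents of the stacks `tab`, `tab2`, `body` and `cpy`. -/
def work (S : ∀ k, List (CspAlph F B k)) (T T2 : List (Option (Fin q)))
    (Y : List (Bool ⊕ {f // f ∈ F})) (c : List (Bool ⊕ {f // f ∈ withPins F})) :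
    ∀ k, List (CspAlph F B k) :=
  Function.update (Function.update (Function.update (Function.update S .tab T) .tab2 T2) .body Y)
    .cpy c

section work

variable (S : ∀ k, List (CspAlph F B k)) (T T2 : List (Option (Fin q)))
  (Y : List (Bool ⊕ {f // f ∈ F})) (c : List (Bool ⊕ {f // f ∈ withPins F}))

theorem update_inp_work (r) : Function.update (work S T T2 Y c) .inp r =
    work (Function.update S .inp r) T T2 Y c := by
  funext k; cases k <;> simp [work]

theorem exec_push_tab (a : Option (Fin q)) :
    E (.push .tab a) (work S T T2 Y c) () (work S (a :: T) T2 Y c) 1 :=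
  (Exec.push _ _ _).cast rfl (by funext k; cases k <;> simp [work]) le_rfl

theorem exec_push_tab2 (a : Option (Fin q)) :
    E (.push .tab2 a) (work S T T2 Y c) () (work S T (a :: T2) Y c) 1 :=
  (Exec.push _ _ _).cast rfl (by funext k; cases k <;> simp [work]) le_rfl

theorem exec_push_cpy (a : Bool ⊕ {f // f ∈ withPins F}) :
    E (.push .cpy a) (work S T T2 Y c) () (work S T T2 Y (a :: c)) 1 :=
  (Exec.push _ _ _).cast rfl (by funext k; cases k <;> simp [work]) le_rfl

theorem exec_push_body (a : Bool ⊕ {f // f ∈ F}) :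
    E (.push .body a) (work S T T2 Y c) () (work S T T2 (a :: Y) c) 1 :=
  (Exec.push _ _ _).cast rfl (by funext k; cases k <;> simp [work]) le_rfl

theorem exec_pushAll_body (l : List (Bool ⊕ {f // f ∈ F})) :
    E (pushAll .body l) (work S T T2 Y c) () (work S T T2 (l.reverse ++ Y) c) l.length :=
  (exec_pushAll _ _ _).cast rfl (by funext k; cases k <;> simp [work]) le_rfl

theorem exec_pop_tab (a : Option (Fin q)) :
    E (.pop .tab) (work S (a :: T) T2 Y c) (some a) (work S T T2 Y c) 1 :=
  (Exec.pop _ _).cast (by simp [work]) (by funext k; cases k <;> simp [work]) le_rfl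

theorem exec_unwalk : E (move .tab2 .tab id) (work S T T2 Y c) ()
    (work S (T2.reverse ++ T) [] Y c) (2 * T2.length + 1) :=
  (exec_move (by simp) _ _).cast rfl (by funext k; cases k <;> simp [work]) (by simp [work])

theorem exec_rewalk : E (move .tab .tab2 id) (work S T T2 Y c) ()
    (work S [] (T.reverse ++ T2) Y c) (2 * T.length + 1) :=
  (exec_move (by simp) _ _).cast rfl (by funext k; cases k <;> simp [work]) (by simp [work])

end work

/-- Step over one entry of the table. -/
def walk : P Unit := .bind (.pop .tab) fun o : Option (Option (Fin q)) => match o with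
  | none => .pure ()
  | some e => .push .tab2 e

theorem exec_walk (S : ∀ k, List (CspAlph F B k)) (T T2 : List (Option (Fin q)))
    (Y : List (Bool ⊕ {f // f ∈ F})) (c : List (Bool ⊕ {f // f ∈ withPins F})) (a : Option (Fin q)) :
    E walk (work S (a :: T) T2 Y c) () (work S T (a :: T2) Y c) 2 := by
  refine Exec.bind (t := 1) (t' := 1) (exec_pop_tab S T T2 Y c a) ?_
  exact exec_push_tab2 S T T2 Y c a

/-- The input stack is not among those that `work` prescribes, so the unread input is absorbed into
the arbitrary `S`. -/
theorem Runs.work_single {τ : Type} [Fintype τ] {body : τ → (Bool ⊕ {f // f ∈ withPins F}) → P τ}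
    {t t' : τ} {a} {T T2 T' T2' : List (Option (Fin q))} {Y Y' : List (Bool ⊕ {f // f ∈ F})}
    {c c' : List (Bool ⊕ {f // f ∈ withPins F})} {n : ℕ}
    (h : ∀ S, E (body t a) (work S T T2 Y c) t' (work S T' T2' Y' c') n) (S) :
    R! .inp body t [a] (work S T T2 Y c) t' (work S T' T2' Y' c') (n + 1) := by
  refine Runs.single fun r => ?_
  rw [update_inp_work, update_inp_work]
  exact h _

/-! #### Building the table of pins -/

/-- Process a letter of the input: in the mode `none`, the header is read; in the mode `some none`,
a scope is skipped; in the mode `some (some p)`, the variables of a scope are pinned to `p`. -/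
noncomputable def scanPins (s : Option (Option (Fin q)) × Bool) (a : Bool ⊕ {f // f ∈ withPins F}) :
    P (Option (Option (Fin q)) × Bool) :=
  seq (.push .cpy a) (match a, s.1 with
    | .inr f, _ => .pure (some (pinValue F f), s.2)
    | .inl true, none => seq (.push .tab none) (.pure s)
    | .inl false, none => .pure (some none, s.2)
    | .inl _, some none => .pure s
    | .inl true, some (some _) => seq walk (.pure s)
    | .inl false, some (some p) => .bind (.pop .tab) fun o : Option (Option (Fin q)) =>
        seq (.push .tab (some (o.join.getD p))) (seq (move .tab2 .tab id)
          (.pure (s.1, s.2 || decide (o.join.getD p ≠ p)))))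

section scanPins

variable (S : ∀ k, List (CspAlph F B k)) (Y : List (Bool ⊕ {f // f ∈ F}))

theorem scanPins_header (n : ℕ) (b : Bool) (T c) :
    R! .inp scanPins (none, b) (unaryWord _ n) (work S T [] Y c) (some none, b)
      (work S (List.replicate n none ++ T) [] Y ((unaryWord _ n).reverse ++ c)) (3 * (n + 1)) := by
  induction n generalizing T c with
  | zero =>
    exact (Runs.work_single (n := 1) (fun S => (exec_push_cpy S T [] Y c _).seq (.pure _ _)) S).cast
      rfl rfl rfl (by omega)
  | succ n ih =>
    refine ((Runs.work_single (a := .inl true) (n := 2) (fun S => (exec_push_cpy S T [] Y c _).seq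
      ((exec_push_tab S T [] Y _ none).seq (.pure _ _))) S).trans (ih _ _)).cast
      (by simp [unaryWord, List.replicate_succ]) rfl ?_ (by omega)
    congr 1
    · rw [List.append_cons, ← List.replicate_succ']
    · simp [unaryWord]
      rw [List.append_cons, ← List.replicate_succ']

theorem scanPins_skip (b : Bool) (T c) (u : List Bool) :
    R! .inp scanPins (some none, b) (u.map .inl) (work S T [] Y c) (some none, b)
      (work S T [] Y ((u.map .inl).reverse ++ c)) (2 * u.length) := by
  induction u generalizing c with
  | nil => exact (Runs.nil _ _).cast rfl rfl (by simp) (by simp)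
  | cons a u ih =>
    refine ((Runs.work_single (a := .inl a) (n := 1) (t' := (some none, b))
      (T' := T) (T2' := []) (Y' := Y) (c' := .inl a :: c) (fun S => ?_) S).trans (ih _)).cast
      (by simp) rfl (by simp) (by simp; omega)
    cases a <;> exact (exec_push_cpy S T [] Y c _).seq (.pure _ _)

theorem scanPins_ticks (p : Fin q) (b : Bool) (l T T2 c) :
    R! .inp scanPins (some (some p), b) (List.replicate l.length (.inl true)) (work S (l ++ T) T2 Y c)
      (some (some p), b) (work S T (l.reverse ++ T2) Y
        (List.replicate l.length (.inl true) ++ c)) (4 * l.length) := by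
  induction l generalizing T2 c with
  | nil => exact (Runs.nil _ _).cast rfl rfl (by simp) (by simp)
  | cons e l ih =>
    refine ((Runs.work_single (a := .inl true) (n := 3) (fun S =>
      (exec_push_cpy S _ T2 Y c _).seq ((exec_walk S (l ++ T) T2 Y _ e).seq (.pure _ _))) S).trans
      (ih _ _)).cast (by simp [List.replicate_succ]) rfl ?_ (by simp; omega)
    congr 1
    · simp
    · rw [List.append_cons, ← List.replicate_succ', List.length_cons]

theorem take_append_cons_drop {α : Type} {T : List α} {v : ℕ} {e : α} (h : T[v]? = some e) :
    T = T.take v ++ e :: T.drop (v + 1) := by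
  obtain ⟨hv, he⟩ := List.getElem?_eq_some_iff.1 h
  rw [← he, List.cons_getElem_drop_succ, List.take_append_drop]

/-- Each tick moves one table entry to `tab2`, so at the separator the entry of the variable is on
top of `tab`. It is replaced and the table is rewound. -/
theorem scanPins_var (p : Fin q) (s : List (Option (Fin q)) × Bool) {v : ℕ} (hv : v < s.1.length) (c) :
    R! .inp scanPins (some (some p), s.2) (unaryWord _ v) (work S s.1 [] Y c)
      (some (some p), (pinUpd p s v).2) (work S (pinUpd p s v).1 [] Y ((unaryWord _ v).reverse ++ c))
      (6 * (v + 1)) := by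
  obtain ⟨T, b⟩ := s
  have he : T[v]? = some (T[v]'hv) := List.getElem?_eq_getElem hv
  set e := T[v]'hv with hedef
  have hT := take_append_cons_drop he
  have hlen : (T.take v).length = v := by simpa using hv.le
  have h1 := scanPins_ticks (g := g) S Y p b (T.take v) (e :: T.drop (v + 1)) [] c
  rw [← hT, hlen] at h1
  have hset : T.set v (some (e.getD p)) = T.take v ++ some (e.getD p) :: T.drop (v + 1) :=
    List.set_eq_take_append_cons_drop .. |>.trans (by rw [if_pos hv])
  refine (h1.trans (Runs.work_single (a := .inl false) (n := 2 * v + 4)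
    (t' := (some (some p), b || decide (e.getD p ≠ p))) (fun S => Exec.cast
      ((exec_push_cpy S _ _ Y _ _).seq ((exec_pop_tab S _ _ Y _ _).bind
        ((exec_push_tab S _ _ Y _ (some (e.getD p))).seq ((exec_unwalk S _ _ Y _).seq (.pure _ _)))))
      rfl rfl (by simp; omega)) S)).cast ?_ ?_ ?_ (by omega)
  · rfl
  · simp [pinUpd, he]
  · simp [pinUpd, he, hset, unaryWord]

theorem scanPins_vars {n : ℕ} (p : Fin q) (s : List (Option (Fin q)) × Bool) (hs : s.1.length = n)
    (l : List (Fin n)) (c) :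
    R! .inp scanPins (some (some p), s.2) (l.flatMap fun v => unaryWord _ v.1) (work S s.1 [] Y c)
      (some (some p), (l.foldl (fun s (v : Fin n) => pinUpd p s v.1) s).2)
      (work S (l.foldl (fun s (v : Fin n) => pinUpd p s v.1) s).1 [] Y
        ((l.flatMap fun v => unaryWord _ v.1).reverse ++ c))
      (6 * (l.flatMap fun v => unaryWord {f // f ∈ withPins F} v.1).length) := by
  induction l generalizing s c with
  | nil => exact (Runs.nil _ _).cast rfl rfl (by simp) (by simp)
  | cons v l ih =>
    refine ((scanPins_var (g := g) S Y p s (hs ▸ v.2) c).trans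
      (ih _ ((length_pinUpd _ _ _).trans hs) _)).cast (by simp) rfl (by simp) ?_
    simp only [List.flatMap_cons, List.length_append, unaryWord, List.length_replicate,
      List.length_singleton]
    omega

theorem flatMap_unaryWord_eq_map {α : Type} {n : ℕ} (l : List (Fin n)) :
    (l.flatMap fun v => unaryWord α v.1) =
      (l.flatMap fun v => List.replicate v.1 true ++ [false]).map Sum.inl := by
  induction l with
  | nil => rfl
  | cons v l ih =>
    rw [List.flatMap_cons, List.flatMap_cons, List.map_append, ← ih]
    simp [unaryWord]

/-- The function letter alone sets the mode. The arity need not be counted, as the next function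
letter or the end of the input closes the scope. -/
theorem scanPins_con {n : ℕ} (m : Option (Fin q)) (s : List (Option (Fin q)) × Bool)
    (hs : s.1.length = n) (C : Con (withPins F) (Fin n)) (c) :
    R! .inp scanPins (some m, s.2) (constraintWord C) (work S s.1 [] Y c)
      (some (pinValue F C.1), (pinCon s C).2)
      (work S (pinCon s C).1 [] Y ((constraintWord C).reverse ++ c))
      (6 * (constraintWord C).length) := by
  have h1 := Runs.work_single (g := g) (body := scanPins) (a := .inr C.1) (n := 1)
    (t := (some m, s.2)) (t' := (some (pinValue F C.1), s.2)) (fun S => (exec_push_cpy S s.1 [] Y c _).seq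
      (.pure _ _)) S
  cases hk : pinValue F C.1 with
  | none =>
    have e1 : pinCon s C = s := by simp [pinCon, hk]
    rw [e1]
    rw [hk] at h1
    have h2 := scanPins_skip (g := g) S Y s.2 s.1 (.inr C.1 :: c)
      ((List.ofFn C.2).flatMap fun v => List.replicate v.1 true ++ [false])
    rw [← flatMap_unaryWord_eq_map] at h2
    refine (h1.trans h2).cast rfl rfl (by simp [constraintWord, scopeWord]) ?_
    rw [constraintWord, scopeWord, flatMap_unaryWord_eq_map, List.length_cons, List.length_map]
    omega
  | some p =>
    have e1 : pinCon s C = (List.ofFn C.2).foldl (fun s (v : Fin n) => pinUpd p s v.1) s := by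
      simp [pinCon, hk]
    rw [e1]
    rw [hk] at h1
    refine (h1.trans (scanPins_vars (g := g) S Y p s hs (List.ofFn C.2) _)).cast rfl rfl
      (by simp [constraintWord, scopeWord]) ?_
    rw [constraintWord, scopeWord, List.length_cons]
    omega

theorem scanPins_cons {n : ℕ} (m : Option (Fin q)) (s : List (Option (Fin q)) × Bool)
    (hs : s.1.length = n) (cs : List (Con (withPins F) (Fin n))) (c) :
    ∃ m', R! .inp scanPins (some m, s.2) (cs.flatMap constraintWord) (work S s.1 [] Y c)
      (some m', (cs.foldl pinCon s).2)
      (work S (cs.foldl pinCon s).1 [] Y ((cs.flatMap constraintWord).reverse ++ c))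
      (6 * (cs.flatMap constraintWord).length) := by
  induction cs generalizing m s c with
  | nil => exact ⟨m, (Runs.nil _ _).cast rfl rfl (by simp) (by simp)⟩
  | cons C cs ih =>
    obtain ⟨m', h⟩ := ih (pinValue F C.1) (pinCon s C) ((length_pinCon s C).trans hs)
      ((constraintWord C).reverse ++ c)
    refine ⟨m', ((scanPins_con (g := g) S Y m s hs C c).trans h).cast rfl rfl (by simp) ?_⟩
    rw [List.flatMap_cons, List.length_append]
    omega

theorem scanPins_word {n : ℕ} (cs : List (Con (withPins F) (Fin n))) (c) :
    ∃ m', R! .inp scanPins (none, false) (Instance.word ⟨n, cs⟩) (work S [] [] Y c)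
      (some m', (pinTable cs).2)
      (work S (pinTable cs).1 [] Y ((Instance.word ⟨n, cs⟩).reverse ++ c))
      (6 * (Instance.word ⟨n, cs⟩).length) := by
  obtain ⟨m', h⟩ := scanPins_cons (g := g) S Y none (List.replicate n none, false) (by simp) cs
    ((unaryWord _ n).reverse ++ c)
  have h0 := scanPins_header (g := g) S Y n false [] c
  rw [List.append_nil] at h0
  refine ⟨m', (h0.trans h).cast rfl rfl (by simp [Instance.word, pinTable]) ?_⟩
  simp only [Instance.word, List.length_append, unaryWord, List.length_replicate,
    List.length_singleton]
  omega

end scanPins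

/-! #### Writing the query -/

/-- Move back over the table, counting the free variables. -/
def unwalkCount : P Unit := .fold .tab2 () fun _ (e : Option (Fin q)) =>
  seq (.push .tab e) (match e with
    | none => .push .body (.inl true)
    | some _ => .pure ())

/-- Write the number of the free variable in front of which the table is opened. -/
def emitFree (R : ℕ) : P Unit :=
  seq (pushAll .body (List.replicate (q + R) (.inl true)))
    (seq unwalkCount (.push .body (.inl false)))

section emit

variable (S : ∀ k, List (CspAlph F B k))

theorem exec_unwalkCount (T T2 Y c) : E unwalkCount (work S T T2 Y c) ()
    (work S (T2.reverse ++ T) [] (List.replicate (T2.countP Option.isNone) (.inl true) ++ Y) c)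
    (3 * T2.length + 1) := by
  have key : ∀ (u T : List (Option (Fin q))) (T2 Y), R! .tab2 (fun _ (e : Option (Fin q)) =>
      seq (.push .tab e) (match e with
        | none => .push .body (.inl true)
        | some _ => .pure ())) () u (work S T T2 Y c) ()
      (work S (u.reverse ++ T) T2 (List.replicate (u.countP Option.isNone) (.inl true) ++ Y) c)
      (3 * u.length) := by
    have hup : ∀ T T2 Y c r, Function.update (work S T T2 Y c) .tab2 r = work S T r Y c := by
      intros; funext k; cases k <;> simp [work]
    intro u
    induction u with
    | nil => exact fun T T2 Y => (Runs.nil _ _).cast rfl rfl (by simp) (by simp)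
    | cons e u ih =>
      intro T T2 Y
      cases e with
      | none =>
        refine ((Runs.single (n := 2) (S' := work S (none :: T) T2 (.inl true :: Y) c)
          fun r => ?_).trans (ih _ _ _)).cast rfl rfl ?_ (by simp; omega)
        · rw [hup, hup]
          exact (exec_push_tab S _ _ _ _ _).seq (exec_push_body S _ _ _ _ _)
        · congr 1
          · simp
          · rw [List.append_cons, ← List.replicate_succ']
            simp
      | some p =>
        refine ((Runs.single (n := 1) (S' := work S (some p :: T) T2 Y c)
          fun r => ?_).trans (ih _ _ _)).cast rfl rfl (by simp) (by simp; omega)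
        rw [hup, hup]
        exact (exec_push_tab S _ _ _ _ _).seq (.pure _ _)
  exact ((key T2 T T2 Y).exec (by simp [work])).cast rfl
    (by funext k; cases k <;> simp [work]) le_rfl

/-- A free variable is numbered after the `q + R` distinguished and gadget variables. Applied with
the whole table on `tab2`, the same routine writes the number of variables of the query. -/
theorem exec_emitFree (R : ℕ) (T T2 Y c) : E (emitFree R) (work S T T2 Y c) ()
    (work S (T2.reverse ++ T) []
      ((unaryWord _ (q + R + T2.countP Option.isNone)).reverse ++ Y) c)
    (3 * T2.length + q + R + 2) := by
  refine Exec.cast ((exec_pushAll_body S T T2 Y c _).seq ((exec_unwalkCount S _ _ _ _).seq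
    (exec_push_body S _ _ _ _ _))) rfl ?_ (by simp; omega)
  congr 1
  simp [unaryWord, ← List.append_assoc, add_comm]

open scoped Classical in
/-- Process a letter of the input; in the mode `true`, a constraint over `F` is copied. -/
noncomputable def emit (R : ℕ) (m : Bool) (a : Bool ⊕ {f // f ∈ withPins F}) : P Bool :=
  seq (.push .cpy a) (match a, m with
    | .inr f, _ => if h : f.1 ∈ F then seq (.push .body (.inr ⟨f.1, h⟩)) (.pure true) else .pure false
    | .inl _, false => .pure false
    | .inl true, true => seq walk (.pure true)
    | .inl false, true => .bind (.pop .tab) fun o : Option (Option (Fin q)) =>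
        seq (.push .tab o.join) (seq (match o.join with
          | some p => seq (pushAll .body (unaryWord _ p.1)) (move .tab2 .tab id)
          | none => emitFree R) (.pure true)))

theorem emit_skip (R : ℕ) (T Y c) (u : List Bool) :
    R! .inp (emit R) false (u.map .inl) (work S T [] Y c) false
      (work S T [] Y ((u.map .inl).reverse ++ c)) (2 * u.length) := by
  induction u generalizing c with
  | nil => exact (Runs.nil _ _).cast rfl rfl (by simp) (by simp)
  | cons a u ih =>
    refine ((Runs.work_single (a := .inl a) (n := 1) (t' := false)
      (T' := T) (T2' := []) (Y' := Y) (c' := .inl a :: c) (fun S => ?_) S).trans (ih _)).cast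
      (by simp) rfl (by simp) (by simp; omega)
    cases a <;> exact (exec_push_cpy S T [] Y c _).seq (.pure _ _)

theorem emit_ticks (R : ℕ) (l T T2 Y c) :
    R! .inp (emit R) true (List.replicate l.length (.inl true)) (work S (l ++ T) T2 Y c)
      true (work S T (l.reverse ++ T2) Y
        (List.replicate l.length (.inl true) ++ c)) (4 * l.length) := by
  induction l generalizing T2 c with
  | nil => exact (Runs.nil _ _).cast rfl rfl (by simp) (by simp)
  | cons e l ih =>
    refine ((Runs.work_single (a := .inl true) (n := 3) (fun S =>
      (exec_push_cpy S _ T2 Y c _).seq ((exec_walk S (l ++ T) T2 Y _ e).seq (.pure _ _))) S).trans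
      (ih _ _)).cast (by simp [List.replicate_succ]) rfl ?_ (by simp; omega)
    congr 1
    · simp
    · rw [List.append_cons, ← List.replicate_succ', List.length_cons]

theorem emit_var (R : ℕ) {n : ℕ} {T : List (Option (Fin q))} (hT : T.length = n) (v : Fin n) (Y c) :
    R! .inp (emit R) true (unaryWord _ v.1) (work S T [] Y c) true
      (work S T [] ((unaryWord _ (inputVar q R _ (place T hT v)).1).reverse ++ Y)
        ((unaryWord _ v.1).reverse ++ c)) ((q + R + 8) * (v + 1)) := by
  have hv : v.1 < T.length := hT ▸ v.2
  have he : T[v.1]? = some (T[v.1]'hv) := List.getElem?_eq_getElem hv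
  set e := T[v.1]'hv with hedef
  have hTv := take_append_cons_drop he
  have hlen : (T.take v.1).length = v.1 := by simpa using hv.le
  have h1 := emit_ticks (g := g) S R (T.take v.1) (e :: T.drop (v.1 + 1)) [] Y c
  rw [← hTv, hlen] at h1
  have hR : q + R + v.1 ≤ (q + R + 1) * (v + 1) := by nlinarith
  have hring : (q + R + 8) * (v.1 + 1) = (q + R + 1) * (v + 1) + 7 * v.1 + 7 := by ring
  cases hcase : e with
  | none =>
    rw [hcase] at he hTv h1
    rw [place_of_none hT he]
    refine (h1.trans (Runs.work_single (a := .inl false) (n := 3 * v.1 + q + R + 5)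
      (t' := true) (fun S => Exec.cast
        ((exec_push_cpy S _ _ Y _ _).seq ((exec_pop_tab S _ _ Y _ _).bind
          ((exec_push_tab S _ _ Y _ none).seq ((exec_emitFree S R _ _ Y _).seq (.pure _ _)))))
        rfl rfl (by simp; omega)) S)).cast rfl rfl ?_ (by omega)
    congr 1
    · simp [← hTv]
    · simp [inputVar, freeIdx]
    · simp [unaryWord]
  | some p =>
    rw [hcase] at he hTv h1
    rw [place_of_some hT he]
    have hp := p.2
    refine (h1.trans (Runs.work_single (a := .inl false) (n := 2 * v.1 + q + 5)
      (t' := true) (fun S => Exec.cast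
        ((exec_push_cpy S _ _ Y _ _).seq ((exec_pop_tab S _ _ Y _ _).bind
          ((exec_push_tab S _ _ Y _ (some p)).seq (((exec_pushAll_body S _ _ Y _ (unaryWord _ p.1)).seq
            (exec_unwalk S _ _ _ _)).seq (.pure _ _)))))
        rfl rfl (by simp [unaryWord]; omega)) S)).cast rfl rfl ?_ (by omega)
    congr 1
    · simp [← hTv]
    · simp [unaryWord]

theorem emit_vars (R : ℕ) {n : ℕ} {T : List (Option (Fin q))} (hT : T.length = n)
    (l : List (Fin n)) (Y c) :
    R! .inp (emit R) true (l.flatMap fun v => unaryWord _ v.1) (work S T [] Y c) true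
      (work S T [] ((l.flatMap fun v => unaryWord _ (inputVar q R _ (place T hT v)).1).reverse ++ Y)
        ((l.flatMap fun v => unaryWord _ v.1).reverse ++ c))
      ((q + R + 8) * (l.flatMap fun v => unaryWord {f // f ∈ withPins F} v.1).length) := by
  induction l generalizing Y c with
  | nil => exact (Runs.nil _ _).cast rfl rfl (by simp) (by simp)
  | cons v l ih =>
    refine ((emit_var (g := g) S R hT v Y c).trans (ih _ _)).cast (by simp) rfl (by simp) ?_
    simp only [List.flatMap_cons, List.length_append, unaryWord, List.length_replicate,
      List.length_singleton, mul_add]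
    omega

/-- The constraint of a query that represents a constraint of the input. -/
noncomputable def queryCon (R : ℕ) {n : ℕ} {T : List (Option (Fin q))} (hT : T.length = n)
    (C : Con F (Fin n)) : Con F (Fin (q + R + T.countP Option.isNone)) :=
  (C.map (place T hT)).map (inputVar q R _)

theorem emit_con (R : ℕ) {n : ℕ} {T : List (Option (Fin q))} (hT : T.length = n) (m : Bool)
    (C : Con (withPins F) (Fin n)) (Y c) :
    ∃ m', R! .inp (emit R) m (constraintWord C) (work S T [] Y c) m'
      (work S T [] (((toF C).toList.flatMap fun C => constraintWord (queryCon R hT C)).reverse ++ Y)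
        ((constraintWord C).reverse ++ c)) ((q + R + 8) * (constraintWord C).length) := by
  by_cases hF : C.1.1 ∈ F
  · have hb : emit (B := B) R m (.inr C.1) =
        seq (.push .cpy (.inr C.1)) (seq (.push .body (.inr ⟨C.1.1, hF⟩)) (.pure true)) := by
      simp [emit, hF]
    have h1 := Runs.work_single (g := g) (body := emit R) (a := .inr C.1) (n := 2)
      (t := m) (t' := true) (c' := .inr C.1 :: c) (T' := T) (T2' := []) (Y' := .inr ⟨C.1.1, hF⟩ :: Y)
      (fun S => by
        rw [hb]
        exact (exec_push_cpy S T [] Y c _).seq ((exec_push_body S T [] Y _ _).seq (.pure _ _))) S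
    refine ⟨true, (h1.trans (emit_vars (g := g) S R hT (List.ofFn C.2) _ _)).cast rfl rfl ?_ ?_⟩
    · congr 1
      · simp only [toF, hF, dite_true, Option.toList_some, List.flatMap_singleton, constraintWord,
          scopeWord, queryCon, List.reverse_cons, List.append_assoc, List.singleton_append]
        congr 2
        change _ = List.flatMap _ (List.ofFn ((fun v => inputVar q R _ (place T hT v)) ∘ C.2))
        rw [← List.map_ofFn, List.flatMap_map]
      · simp [constraintWord, scopeWord]
    · rw [constraintWord, scopeWord, List.length_cons, mul_add]
      omega
  · have hb : emit (B := B) R m (.inr C.1) = seq (.push .cpy (.inr C.1)) (.pure false) := by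
      simp [emit, hF]
    have h1 := Runs.work_single (g := g) (body := emit R) (a := .inr C.1) (n := 1)
      (t := m) (t' := false) (c' := .inr C.1 :: c) (T' := T) (T2' := []) (Y' := Y)
      (fun S => by
        rw [hb]
        exact (exec_push_cpy S T [] Y c _).seq (.pure _ _)) S
    have h2 := emit_skip (g := g) S R T Y (.inr C.1 :: c)
      ((List.ofFn C.2).flatMap fun v => List.replicate v.1 true ++ [false])
    rw [← flatMap_unaryWord_eq_map] at h2
    refine ⟨false, (h1.trans h2).cast rfl rfl (by simp [constraintWord, scopeWord, toF, hF]) ?_⟩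
    rw [constraintWord, scopeWord, flatMap_unaryWord_eq_map, List.length_cons, List.length_map]
    nlinarith

theorem emit_cons (R : ℕ) {n : ℕ} {T : List (Option (Fin q))} (hT : T.length = n) (m : Bool)
    (cs : List (Con (withPins F) (Fin n))) (Y c) :
    ∃ m', R! .inp (emit R) m (cs.flatMap constraintWord) (work S T [] Y c) m'
      (work S T [] (((cs.filterMap toF).flatMap fun C => constraintWord (queryCon R hT C)).reverse ++ Y)
        ((cs.flatMap constraintWord).reverse ++ c))
      ((q + R + 8) * (cs.flatMap constraintWord).length) := by
  induction cs generalizing m Y c with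
  | nil => exact ⟨m, (Runs.nil _ _).cast rfl rfl (by simp) (by simp)⟩
  | cons C cs ih =>
    obtain ⟨m1, h1⟩ := emit_con (g := g) S R hT m C Y c
    obtain ⟨m2, h2⟩ := ih m1 _ _
    refine ⟨m2, (h1.trans h2).cast rfl rfl ?_ ?_⟩
    · congr 1
      · cases h : toF C <;> simp [h]
      · simp
    · rw [List.flatMap_cons, List.length_append, mul_add]

/-- In the initial mode `false` the header of the input is passed over like the scope of a dropped
constraint. -/
theorem emit_word (R : ℕ) {n : ℕ} {T : List (Option (Fin q))} (hT : T.length = n)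
    (cs : List (Con (withPins F) (Fin n))) (Y c) :
    ∃ m', R! .inp (emit R) false (Instance.word ⟨n, cs⟩) (work S T [] Y c) m'
      (work S T [] (((cs.filterMap toF).flatMap fun C => constraintWord (queryCon R hT C)).reverse ++ Y)
        ((Instance.word ⟨n, cs⟩).reverse ++ c))
      ((q + R + 8) * (Instance.word ⟨n, cs⟩).length) := by
  obtain ⟨m', h⟩ := emit_cons (g := g) S R hT false cs Y ((unaryWord _ n).reverse ++ c)
  have h0 := emit_skip (g := g) S R T Y c (List.replicate n true ++ [false])
  have e : (List.replicate n true ++ [false]).map Sum.inl =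
      unaryWord {f // f ∈ withPins F} n := by simp [unaryWord]
  rw [e] at h0
  refine ⟨m', (h0.trans h).cast rfl rfl (by simp [Instance.word]) ?_⟩
  simp only [Instance.word, List.length_append, unaryWord, List.length_replicate,
    List.length_singleton]
  nlinarith

end emit

end Prog

/-! ### Querying the oracle and summing the scaled answers. -/

namespace Prog

open Bin

variable {A' A : Type} {q B : ℕ} {g : List (Bool ⊕ A) → List (Bool ⊕ Bool)}

local notation "P" => Prog (Alph A' A q B)
local notation "E" => Exec (Γ := Alph A' A q B) (kq := Stk.qry) (ka := Stk.ans) g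

/-- Copy the stack `body` to the query stack, reversing it. -/
def copyBody : P Unit :=
  seq (.fold .body () fun _ a => seq (.push .qry a) (.push .body2 a)) (move .body2 .body id)

theorem exec_copyBody {S : ∀ k, List (Alph A' A q B k)} (h : S .body2 = []) :
    E copyBody S () (Function.update S .qry ((S .body).reverse ++ S .qry))
      (5 * (S .body).length + 2) := by
  have key : ∀ (u : List (Bool ⊕ A)) (S : ∀ k, List (Alph A' A q B k)),
      Runs (kq := Stk.qry) (ka := Stk.ans) g .body
        (fun _ a => seq (.push .qry a) (.push .body2 a)) () u S ()
        (Function.update (Function.update S .qry (u.reverse ++ S .qry)) .body2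
          (u.reverse ++ S .body2)) (3 * u.length) := by
    intro u
    induction u with
    | nil => exact fun S => (Runs.nil _ _).cast rfl rfl (by simp) (by simp)
    | cons a u ih =>
      intro S
      refine ((Runs.single (n := 2) (S' := Function.update (Function.update S .qry (a :: S .qry)) .body2
        (a :: S .body2)) fun r => ?_).trans (ih _)).cast rfl rfl ?_ (by simp; omega)
      · refine Exec.cast (.seq (.push _ _ _) (.push _ _ _)) rfl ?_ le_rfl
        funext k; cases k <;> simp
      · funext k; cases k <;> simp
  refine Exec.cast (((key (S .body) S).exec rfl).seq (exec_move (by simp) _ _)) rfl ?_ ?_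
  · funext k; cases k <;> simp [h]
  · simp [h]; omega

/-- Query the oracle about the instance whose word is the reverse of `body`, followed by `J`, and
add `e * D ^ L * G` times the answer to the accumulator, where `L` is the length of `cpy`. -/
noncomputable def oneQuery (D G : ℕ) (J : List (Bool ⊕ A)) (e : ℤ) : P Unit :=
  seq (pushAll .qry J.reverse) (seq copyBody (seq .query (seq readAns
    (seq (forCpy (mulNat D)) (seq (mulNat G) (accumulate e))))))

/-- The state of the machine between two queries. -/
structure Ready (S : ∀ k, List (Alph A' A q B k)) (W : List (Bool ⊕ A)) (L : ℕ) : Prop where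
  inp : S .inp = []
  out : S .out = []
  qry : S .qry = []
  ans : S .ans = []
  body : S .body = W.reverse
  body2 : S .body2 = []
  acc2 : S .acc2 = []
  reg : ∀ i, S (.reg i) = []
  cpy : (S .cpy).length = L

theorem Ready.update_acc {S : ∀ k, List (Alph A' A q B k)} {W : List (Bool ⊕ A)} {L : ℕ}
    (h : Ready S W L) (l) : Ready (Function.update S .acc l) W L := by
  constructor <;> simp [h.inp, h.out, h.qry, h.ans, h.body, h.body2, h.acc2, h.reg, h.cpy]

theorem _root_.NNRat.SizeLE.mul_pow {x : ℚ≥0} {s D : ℕ} (hs : x.SizeLE s) (hD : 0 < D) (n : ℕ) :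
    (x * D ^ n).SizeLE (s + D * n) := by
  induction n with
  | zero => simpa using hs
  | succ n ih =>
    have := ih.mul_natCast hD
    rwa [mul_assoc, ← pow_succ, add_assoc, ← Nat.mul_succ] at this

theorem _root_.NNRat.SizeLE.div_pow {x : ℚ≥0} {s D : ℕ} (hs : x.SizeLE s) (hD : 0 < D) (n : ℕ) :
    (x / D ^ n).SizeLE (s + D * n) := by
  induction n with
  | zero => simpa using hs
  | succ n ih =>
    have := ih.div_natCast hD
    rwa [div_div, ← pow_succ, add_assoc, ← Nat.mul_succ] at this

theorem exec_forCpy_mulNat {D : ℕ} (hD : 0 < D) {S : ∀ k, List (Alph A' A q B k)}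
    {W : List (Bool ⊕ A)} {L : ℕ} (h : Ready S W L) {x : ℚ≥0} {s : ℕ} (hs : x.SizeLE s) :
    E (forCpy (mulNat D)) (setQ S x) () (setQ S (x * D ^ L))
      ((12 * (s + D * L) + 3 * D + 10) * L + 2) := by
  have := exec_forCpy (g := g) (p := mulNat D) (f := fun n => x * D ^ n) (L := L)
    (T := 12 * (s + D * L) + 3 * D + 6) (fun n hn S hS => by
      have := exec_mulNat (g := g) hD hS ((hs.mul_pow hD n).mono
        (t := s + D * L) (by have := Nat.mul_le_mul_left D hn.le; omega))
      rwa [mul_assoc, ← pow_succ] at this) (h.reg 2) h.inp h.cpy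
  simpa using this

theorem exec_forCpy_divNat {D : ℕ} (hD : 0 < D) {S : ∀ k, List (Alph A' A q B k)}
    {W : List (Bool ⊕ A)} {L : ℕ} (h : Ready S W L) {x : ℚ≥0} {s : ℕ} (hs : x.SizeLE s) :
    E (forCpy (divNat D)) (setQ S x) () (setQ S (x / D ^ L))
      ((12 * (s + D * L) + 3 * D + 10) * L + 2) := by
  have := exec_forCpy (g := g) (p := divNat D) (f := fun n => x / D ^ n) (L := L)
    (T := 12 * (s + D * L) + 3 * D + 6) (fun n hn S hS => by
      have := exec_divNat (g := g) hD hS ((hs.div_pow hD n).mono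
        (t := s + D * L) (by have := Nat.mul_le_mul_left D hn.le; omega))
      rwa [div_div, ← pow_succ] at this) (h.reg 2) h.inp h.cpy
  simpa using this

/-- The constant `J` is pushed first and the reversal of `body` on top of it, so the query reads `W
++ J`, while `body` survives for the next query. By `hn` the scaled answer is an integer, so its
numerator alone is accumulated. -/
theorem exec_oneQuery {D G : ℕ} (hD : 0 < D) (hG : 0 < G) {J W : List (Bool ⊕ A)} (e : ℤ)
    {S : ∀ k, List (Alph A' A q B k)} {L : ℕ} (h : Ready S W L) {x : ℚ≥0}
    (hx : g (W ++ J) = WCSP.encodingNNRat.encode x) {s : ℕ} (hs : x.SizeLE s) {n : ℕ}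
    (hn : x * D ^ L * G = n) :
    E (oneQuery D G J e) S () (Function.update S .acc
      (addMul B e (Nat.bits n) (S .acc) ++ (S .acc).drop (Nat.bits n).length))
      (J.length + 5 * W.length + 8 * s + (12 * (s + D * L) + 3 * D + 10) * L +
        18 * (s + D * L + G) + 3 * G + 4 * (S .acc).length + 30) := by
  have e1 := exec_pushAll (kq := .qry) (ka := .ans) (g := g) .qry J.reverse S
  have e2 := exec_copyBody (g := g) (S := Function.update S .qry (J.reverse.reverse ++ S .qry))
    (by simp [h.body2])
  have e3 := Exec.query (kq := .qry) (ka := .ans) (g := g) (Function.update (Function.update S .qry (J.reverse.reverse ++ S .qry)) .qry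
    ((Function.update S .qry (J.reverse.reverse ++ S .qry) .body).reverse ++
      Function.update S .qry (J.reverse.reverse ++ S .qry) .qry))
  have hst : Function.update (Function.update (Function.update (Function.update S .qry
      (J.reverse.reverse ++ S .qry)) .qry
      ((Function.update S .qry (J.reverse.reverse ++ S .qry) .body).reverse ++
      Function.update S .qry (J.reverse.reverse ++ S .qry) .qry)) .qry []) .ans
      (g (Function.update (Function.update S .qry (J.reverse.reverse ++ S .qry)) .qry
    ((Function.update S .qry (J.reverse.reverse ++ S .qry) .body).reverse ++
      Function.update S .qry (J.reverse.reverse ++ S .qry) .qry) .qry)) =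
      Function.update S .ans (WCSP.encodingNNRat.encode x) := by
    rw [← hx]
    funext k; cases k <;> simp [h.body, h.qry]
  rw [hst] at e3
  have e4 := exec_readAns (g := g) (h.reg 0) (h.reg 1) (h.reg 2) (h.reg 3) hs
  have hans : Function.update S .ans [] = S := by rw [← h.ans, Function.update_eq_self]
  rw [hans] at e4
  have e5 := exec_forCpy_mulNat (g := g) hD h hs
  have hs' := hs.mul_pow hD L
  have e6 := exec_mulNat (g := g) hG (h.reg 2) hs'
  have hs'' := hs'.mul_natCast hG
  rw [hn] at e6 hs''
  have e7 := exec_accumulate (g := g) e (S := setQ S n) (by simp [setQ, h.acc2])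
  have hnum : (n : ℚ≥0).num = n := NNRat.num_natCast n
  have hl := length_bits_le hs''.1
  have hl' := length_bits_le hs''.2
  refine Exec.cast (e1.seq (e2.seq (e3.seq (e4.seq (e5.seq (e6.seq e7)))))) rfl ?_ ?_
  · funext k
    rcases k with _ | _ | _ | _ | _ | _ | _ | _ | _ | _ | _ | i
    iterate 11 simp [setQ]
    fin_cases i <;> simp [setQ, h.reg]
  · have hacc : setQ S (n : ℚ≥0) .acc = S .acc := by simp [setQ]
    have hbody : Function.update S .qry (J.reverse.reverse ++ S .qry) .body = W.reverse := by
      simp [h.body]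
    rw [setQ_num, setQ_den, hacc, hbody, List.length_reverse, List.length_reverse]
    omega

/-- Perform a list of queries. -/
noncomputable def queries (D G : ℕ) : List (List (Bool ⊕ A) × ℤ) → P Unit
  | [] => .pure ()
  | p :: Qs => seq (oneQuery D G p.1 p.2) (queries D G Qs)

/-- In the induction `c` bounds the digits of the accumulator and grows by `(e i).natAbs` with each
query. The number of digits does not grow beyond the common bit bound for the scaled answers. -/
theorem exec_queries {ι : Type*} {D G : ℕ} (hD : 0 < D) (hG : 0 < G) {W : List (Bool ⊕ A)}
    {L s j : ℕ} (J : ι → List (Bool ⊕ A)) (e : ι → ℤ) (x : ι → ℚ≥0) (n : ι → ℕ) (l : List ι)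
    (hl : ∀ i ∈ l, g (W ++ J i) = WCSP.encodingNNRat.encode (x i) ∧ (x i).SizeLE s ∧
      x i * D ^ L * G = n i ∧ (J i).length ≤ j)
    {S : ∀ k, List (Alph A' A q B k)} (h : Ready S W L) {c : ℕ}
    (hc : c + (l.map fun i => (e i).natAbs).sum ≤ B) (hSc : ∀ d ∈ S .acc, |(d : ℤ)| ≤ c)
    (hacc : (S .acc).length ≤ s + D * L + G) :
    ∃ a : List (Digit B), E (queries D G (l.map fun i => (J i, e i))) S () (Function.update S .acc a)
      (l.length * (j + 5 * W.length + 8 * s + (12 * (s + D * L) + 3 * D + 10) * L +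
        22 * (s + D * L + G) + 3 * G + 30)) ∧ a.length ≤ s + D * L + G ∧
      digitVal (a.map (↑)) = digitVal ((S .acc).map (↑)) + (l.map fun i => e i * (n i : ℤ)).sum := by
  induction l generalizing S c with
  | nil => exact ⟨S .acc, (Exec.pure _ _).cast rfl (by simp) (by simp), hacc, by simp⟩
  | cons i l ih =>
    obtain ⟨h1, h2, h3, h4⟩ := hl i (by simp)
    have e1 := exec_oneQuery (g := g) hD hG (e i) h h1 h2 h3
    set b := addMul B (e i) (Nat.bits (n i)) (S .acc) ++ (S .acc).drop (Nat.bits (n i)).length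
      with hb
    rw [List.map_cons, List.sum_cons] at hc
    have hlen : (Nat.bits (n i)).length ≤ s + D * L + G := by
      have := (h2.mul_pow hD L).mul_natCast hG
      rw [h3] at this
      have := length_bits_le this.1
      rwa [NNRat.num_natCast] at this
    have hblen : b.length ≤ s + D * L + G := by
      rw [hb, List.length_append, length_addMul, List.length_drop]
      omega
    obtain ⟨a, e2, h5, h6⟩ := ih (fun i hi => hl i (List.mem_cons_of_mem _ hi)) (h.update_acc b)
      (c := c + (e i).natAbs) (by omega)
      (by rw [Function.update_self]; exact addMul_abs_le (by omega) _ hSc)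
      (by rw [Function.update_self]; exact hblen)
    refine ⟨a, (e1.seq e2).cast rfl (by simp) ?_, h5, ?_⟩
    · rw [List.length_cons, Nat.succ_mul l.length]
      omega
    · rw [h6, Function.update_self, hb, digitVal_addMul (c := c) (by omega) _ hSc, val_bits,
        List.map_cons, List.sum_cons, add_assoc]

end Prog

/-! ### Bounds for partition functions -/

theorem NNRat.exists_denominator {ι : Type*} [Fintype ι] (v : ι → ℚ≥0) :
    ∃ D H : ℕ, 0 < D ∧ ∀ i, ∃ a : ℕ, a ≤ H ∧ v i * D = a := by
  classical
  refine ⟨∏ i, (v i).den, ∑ i, (v i * (∏ i, (v i).den : ℕ)).num,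
    Finset.prod_pos fun i _ => (v i).den_pos, fun i => ⟨_, Finset.single_le_sum
      (f := fun i => (v i * (∏ i, (v i).den : ℕ)).num) (fun _ _ => Nat.zero_le _)
      (Finset.mem_univ i), ?_⟩⟩
  have h : v i * (∏ i, (v i).den : ℕ) =
      ((v i).num * ∏ j ∈ Finset.univ.erase i, (v j).den : ℕ) := by
    rw [← Finset.mul_prod_erase _ _ (Finset.mem_univ i)]
    push_cast
    rw [← mul_assoc, NNRat.mul_den_eq]
  rw [h, NNRat.num_natCast]

theorem exists_integral_multiple (l : List ℚ) : ∃ N : ℕ, 0 < N ∧ ∀ x ∈ l, ∃ e : ℤ, x * N = e := by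
  induction l with
  | nil => exact ⟨1, one_pos, by simp⟩
  | cons x l ih =>
    obtain ⟨N, hN, h⟩ := ih
    refine ⟨x.den * N, Nat.mul_pos x.den_pos hN, fun y hy => ?_⟩
    rcases List.mem_cons.1 hy with rfl | hy
    · refine ⟨y.num * N, ?_⟩
      push_cast
      rw [← mul_assoc, Rat.mul_den_eq_num]
    · obtain ⟨e, he⟩ := h y hy
      refine ⟨x.den * e, ?_⟩
      push_cast
      rw [mul_left_comm, he]

namespace WCSP

variable {q : ℕ} {F : Finset (WFun q)} {D H : ℕ}

theorem exists_denominator (F : Finset (WFun q)) :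
    ∃ D H : ℕ, 0 < D ∧ ∀ f ∈ F, ∀ x, ∃ a : ℕ, a ≤ H ∧ f.2 x * D = a := by
  obtain ⟨D, H, hD, h⟩ := NNRat.exists_denominator
    fun i : (Σ f : {f // f ∈ F}, (Fin f.1.1 → Fin q)) => i.1.1.2 i.2
  exact ⟨D, H, hD, fun f hf x => h ⟨⟨f, hf⟩, x⟩⟩

theorem exists_wt_eq (hD : ∀ f ∈ F, ∀ x, ∃ a : ℕ, a ≤ H ∧ f.2 x * D = a) {V : Type}
    (cs : List (Con F V)) (σ : V → Fin q) :
    ∃ a : ℕ, a ≤ H ^ cs.length ∧ wt cs σ * D ^ cs.length = a := by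
  induction cs with
  | nil => exact ⟨1, by simp, by simp [wt]⟩
  | cons C cs ih =>
    obtain ⟨a, ha, ha'⟩ := ih
    obtain ⟨b, hb, hb'⟩ := hD C.1.1 C.1.2 fun i => σ (C.2 i)
    refine ⟨a * b, ?_, ?_⟩
    · rw [List.length_cons, pow_succ]
      exact Nat.mul_le_mul ha hb
    · have : wt (C :: cs) σ = C.1.1.2 (fun i => σ (C.2 i)) * wt cs σ := by simp [wt]
      rw [this, List.length_cons, Nat.cast_mul, ← ha', ← hb']
      ring

theorem Instance.exists_Z_eq (hD : ∀ f ∈ F, ∀ x, ∃ a : ℕ, a ≤ H ∧ f.2 x * D = a) (I : Instance F) :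
    ∃ a : ℕ, a ≤ q ^ I.numVars * H ^ I.constraints.length ∧ I.Z * D ^ I.constraints.length = a := by
  choose a ha ha' using exists_wt_eq hD I.constraints
  refine ⟨∑ σ, a σ, ?_, ?_⟩
  · refine (Finset.sum_le_card_nsmul _ _ _ fun σ _ => ha σ).trans_eq ?_
    simp
  · rw [Instance.Z, Finset.sum_mul, Nat.cast_sum]
    exact Finset.sum_congr rfl fun σ _ => ha' σ

/-- Multiplying by `D` to the number of constraints makes the partition function an integer at most
`q ^ I.numVars * H ^ I.constraints.length`. With `b ≤ 2 ^ b` this gives a bit length linear in the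
numbers of variables and constraints. -/
theorem Instance.sizeLE_Z (hD0 : 0 < D) (hD : ∀ f ∈ F, ∀ x, ∃ a : ℕ, a ≤ H ∧ f.2 x * D = a)
    (I : Instance F) {N m : ℕ} (hN : I.numVars ≤ N) (hm : I.constraints.length ≤ m) :
    I.Z.SizeLE (q * N + (H + D) * m + 1) := by
  obtain ⟨a, ha, ha'⟩ := I.exists_Z_eq hD
  obtain ⟨h1, h2⟩ := NNRat.num_le_of_mul_natCast_eq (d := D ^ I.constraints.length) (a := a)
    (by positivity) (by push_cast; exact ha')
  have key : ∀ b k : ℕ, b ^ k ≤ 2 ^ (b * k) := fun b k => by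
    rw [pow_mul]
    exact Nat.pow_le_pow_left Nat.lt_two_pow_self.le _
  have e1 : q * I.numVars ≤ q * N := Nat.mul_le_mul_left _ hN
  have e2 : H * I.constraints.length ≤ H * m := Nat.mul_le_mul_left _ hm
  have e3 : D * I.constraints.length ≤ D * m := Nat.mul_le_mul_left _ hm
  rw [add_mul]
  constructor
  · refine (h1.trans (ha.trans (Nat.mul_le_mul (key _ _) (key _ _)))).trans_lt ?_
    rw [← pow_add]
    exact Nat.pow_lt_pow_right one_lt_two (by omega)
  · exact (h2.trans (key _ _)).trans_lt (Nat.pow_lt_pow_right one_lt_two (by omega))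

/-! ### The words of the queries -/

/-- The part of the word of a query that describes the fixed gadget. -/
def gadgetWord {R : ℕ} (J : List (Con F (Fin q ⊕ Fin R))) : List (Bool ⊕ {f // f ∈ F}) :=
  (J.map (Con.map (gadgetVar q R 0))).flatMap constraintWord

/-- The part of the word of a query that describes the input. -/
noncomputable def inputWord (R : ℕ) {n : ℕ} (cs : List (Con (withPins F) (Fin n))) :
    List (Bool ⊕ {f // f ∈ F}) :=
  unaryWord _ (q + R + (pinTable cs).1.countP Option.isNone) ++
    (cs.filterMap toF).flatMap fun C => constraintWord (Prog.queryCon R (length_pinTable cs) C)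

/-- Gadget variables are numbered before the free variables of the input, so their indices do not
depend on `u`. This makes `gadgetWord` a constant of the machine. -/
theorem constraintWord_gadgetVar {R : ℕ} (u : ℕ) (C : Con F (Fin q ⊕ Fin R)) :
    constraintWord (C.map (gadgetVar q R u)) = constraintWord (C.map (gadgetVar q R 0)) := by
  simp only [constraintWord, scopeWord, Con.map]
  congr 1
  have : ∀ u, List.ofFn (fun i => gadgetVar q R u (C.2 i)) =
      (List.ofFn C.2).map (gadgetVar q R u) := fun u => by rw [List.map_ofFn]; rfl
  rw [this, this, List.flatMap_map, List.flatMap_map]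
  rfl

theorem word_queryInstance (R : ℕ) {n : ℕ} (cs : List (Con (withPins F) (Fin n)))
    (J : List (Con F (Fin q ⊕ Fin R))) :
    (queryInstance (inputGadget cs) J).word = inputWord R cs ++ gadgetWord J := by
  simp only [Instance.word, queryInstance, inputWord, gadgetWord, inputGadget, List.append_assoc,
    List.flatMap_append, List.flatMap_map]
  congr 2
  exact List.flatMap_congr fun C _ => constraintWord_gadgetVar _ C

theorem length_constraintWord_le {n : ℕ} (C : Con F (Fin n)) :
    (constraintWord C).length ≤ n * C.1.1.1 + 1 := by
  have : ∀ l : List (Fin n), (l.flatMap fun v => unaryWord {f // f ∈ F} v.1).length ≤ n * l.length := by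
    intro l
    induction l with
    | nil => simp
    | cons v l ih =>
      have := v.2
      simp only [List.flatMap_cons, List.length_append, unaryWord, List.length_replicate,
        List.length_cons, List.length_nil, mul_add] at *
      omega
  have := this (List.ofFn C.2)
  rw [List.length_ofFn] at this
  simpa [constraintWord, scopeWord] using this

theorem le_length_constraintWord {n : ℕ} (C : Con F (Fin n)) :
    C.1.1.1 + 1 ≤ (constraintWord C).length := by
  have : ∀ l : List (Fin n), l.length ≤ (l.flatMap fun v => unaryWord {f // f ∈ F} v.1).length := by
    intro l
    induction l with
    | nil => simp
    | cons v l ih =>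
      simp only [List.flatMap_cons, List.length_append, unaryWord, List.length_replicate,
        List.length_cons, List.length_nil] at *
      omega
  have := this (List.ofFn C.2)
  rw [List.length_ofFn] at this
  simpa [constraintWord, scopeWord] using this

theorem length_filterMap_toF_le {n : ℕ} (cs : List (Con (withPins F) (Fin n))) :
    (cs.filterMap toF).length ≤ (Instance.word ⟨n, cs⟩).length := by
  have : cs.length ≤ (cs.flatMap constraintWord).length := by
    induction cs with
    | nil => simp
    | cons C cs ih =>
      have := le_length_constraintWord C
      rw [List.flatMap_cons, List.length_append, List.length_cons]
      omega
  refine (List.length_filterMap_le _ _).trans (this.trans ?_)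
  simp [Instance.word]

theorem numVars_le_length_word (I : Instance F) : I.numVars ≤ I.word.length := by
  simp only [Instance.word, unaryWord, List.length_append, List.length_replicate]
  omega

theorem countP_pinTable_le {n : ℕ} (cs : List (Con (withPins F) (Fin n))) :
    (pinTable cs).1.countP Option.isNone ≤ (Instance.word ⟨n, cs⟩).length :=
  (List.countP_le_length.trans_eq (length_pinTable cs)).trans
    (numVars_le_length_word ⟨n, cs⟩)

/-- A scope entry occupies at least one letter of the input and is rewritten with at most `N`
letters, because all indices in the query are below `N`. -/
theorem length_inputWord_le (R : ℕ) {n : ℕ} (cs : List (Con (withPins F) (Fin n))) {L : ℕ}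
    (hL : (Instance.word ⟨n, cs⟩).length = L) :
    (inputWord R cs).length ≤ (q + R + L + 1) * (L + 1) := by
  have hu := countP_pinTable_le cs
  rw [hL] at hu
  set N := q + R + (pinTable cs).1.countP Option.isNone with hN
  have key : ∀ ds : List (Con (withPins F) (Fin n)), ((ds.filterMap toF).flatMap fun C =>
      constraintWord (Prog.queryCon R (length_pinTable cs) C)).length ≤
      (N + 1) * (ds.flatMap constraintWord).length := by
    intro ds
    induction ds with
    | nil => simp
    | cons C ds ih =>
      have h1 := le_length_constraintWord C
      rw [List.flatMap_cons, List.length_append, mul_add, List.filterMap_cons]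
      by_cases hF : C.1.1 ∈ F
      · have h2 := length_constraintWord_le (Prog.queryCon R (length_pinTable cs) ⟨⟨C.1.1, hF⟩, C.2⟩)
        rw [show toF C = some ⟨⟨C.1.1, hF⟩, C.2⟩ by simp [toF, hF]]
        simp only [List.flatMap_cons, List.length_append]
        refine Nat.add_le_add (h2.trans ?_) ih
        have h3 : (N + 1) * (C.1.1.1 + 1) ≤ (N + 1) * (constraintWord C).length :=
          Nat.mul_le_mul_left _ h1
        refine le_trans ?_ h3
        change N * C.1.1.1 + 1 ≤ _
        nlinarith
      · rw [show toF C = none by simp [toF, hF]]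
        exact ih.trans (Nat.le_add_left _ _)
  have h1 := key cs
  have h2 : (cs.flatMap constraintWord).length ≤ L := by
    rw [← hL]; simp [Instance.word]
  have h3 : (N + 1) * (cs.flatMap constraintWord).length ≤ (q + R + L + 1) * L :=
    Nat.mul_le_mul (by omega) h2
  simp only [inputWord, List.length_append, unaryWord, List.length_replicate, List.length_singleton]
  rw [mul_add, mul_one]
  omega

end WCSP

/-! ### The reduction -/

namespace Prog

open Bin WCSP

section evaluate

variable {A' A : Type} {q B : ℕ} {g : List (Bool ⊕ A) → List (Bool ⊕ Bool)}

local notation "P" => Prog (Alph A' A q B)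
local notation "E" => Exec (Γ := Alph A' A q B) (kq := Stk.qry) (ka := Stk.ans) g

/-- Perform a list of queries and write a linear combination of the answers. -/
noncomputable def evaluate (D G : ℕ) (Qs : List (List (Bool ⊕ A) × ℤ)) : P Unit :=
  seq (queries D G Qs) (seq readAcc (seq (forCpy (divNat D)) (seq (divNat G)
    (seq (divNat G) output))))

/-- One factor `G` in `hz` comes from clearing the denominators of the answers, the other from the
coefficients; hence the two final divisions by `G`. -/
theorem exec_evaluate {ι : Type*} {D G : ℕ} (hD : 0 < D) (hG : 0 < G) {W : List (Bool ⊕ A)}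
    {L s j w m : ℕ} (J : ι → List (Bool ⊕ A)) (e : ι → ℤ) (x : ι → ℚ≥0) (n : ι → ℕ) (l : List ι)
    (hl : ∀ i ∈ l, g (W ++ J i) = WCSP.encodingNNRat.encode (x i) ∧ (x i).SizeLE s ∧
      x i * D ^ L * G = n i ∧ (J i).length ≤ j)
    {S : ∀ k, List (Alph A' A q B k)} (h : Ready S W L) (hacc : S .acc = [])
    (hB : (l.map fun i => (e i).natAbs).sum ≤ B) (hw : W.length ≤ w) (hm : s + D * L + G ≤ m) {z : ℚ≥0}
    (hz : (l.map fun i => (e i : ℚ) * n i).sum = z * D ^ L * G * G) :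
    ∃ S', E (evaluate D G (l.map fun i => (J i, e i))) S () S'
      (l.length * (j + 5 * w + (12 * m + 3 * D + 10) * L + 33 * m + 30) +
        (12 * (m + B + 1 + D * L) + 3 * D + 10) * L + 40 * (m + B + D * L + G) + 60) ∧
      S' .out = WCSP.encodingNNRat.encode z := by
  obtain ⟨a, e1, ha, hv⟩ := exec_queries (g := g) (B := B) (c := 0) hD hG J e x n l hl h (by omega)
    (by simp [hacc]) (by simp [hacc])
  have h2 : (((l.map fun i => e i * (n i : ℤ)).sum : ℤ) : ℚ) =
      (l.map fun i => (e i : ℚ) * n i).sum := by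
    rw [Int.cast_list_sum, List.map_map]
    congr 1
    refine List.map_congr_left fun i _ => ?_
    simp
  -- Individual terms may be negative, but the total is a nonnegative multiple of `z`, so the
  -- accumulator represents a natural number.
  obtain ⟨N, hN⟩ : ∃ N : ℕ, (l.map fun i => e i * (n i : ℤ)).sum = N := by
    refine Int.eq_ofNat_of_zero_le ?_
    have : (0 : ℚ) ≤ (l.map fun i => (e i : ℚ) * n i).sum := by
      rw [hz]
      positivity
    rw [← h2] at this
    exact_mod_cast this
  have hNz : (N : ℚ≥0) = z * D ^ L * G * G := by
    rw [hN, hz] at h2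
    have h3 : ((N : ℚ≥0) : ℚ) = ((z * D ^ L * G * G : ℚ≥0) : ℚ) := by
      push_cast at h2 ⊢
      exact h2
    exact_mod_cast h3
  have hS1 := h.update_acc a
  rw [hacc, hN] at hv
  obtain ⟨e2, hs1⟩ := exec_readAcc (g := g) (hS1.reg 0) (hS1.reg 1) (hS1.reg 2) (n := N)
    (by rw [Function.update_self, hv]; simp)
  rw [Function.update_self] at e2 hs1
  have hS2 := hS1.update_acc ([] : List (Digit B))
  have hs1 := hs1.mono (t := m + B + 1) (by omega)
  have e3 := exec_forCpy_divNat (g := g) hD hS2 hs1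
  have hs2 := hs1.div_pow hD L
  have e4 := exec_divNat (g := g) hG (hS2.reg 2) hs2
  have hs3 := hs2.div_natCast hG
  have e5 := exec_divNat (g := g) hG (hS2.reg 2) hs3
  have hs4 := hs3.div_natCast hG
  have hD' : (D : ℚ≥0) ≠ 0 := by exact_mod_cast hD.ne'
  have hG' : (G : ℚ≥0) ≠ 0 := by exact_mod_cast hG.ne'
  have hz' : (N : ℚ≥0) / D ^ L / G / G = z := by
    rw [hNz]
    field_simp
  rw [hz'] at e5 hs4
  obtain ⟨S', e6, hS'⟩ := exec_output (g := g) (hS2.reg 2) hS2.out hs4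
  refine ⟨S', (e1.seq (e2.seq (e3.seq (e4.seq (e5.seq e6))))).mono ?_, hS'⟩
  have h1 : l.length * (j + 5 * W.length + 8 * s + (12 * (s + D * L) + 3 * D + 10) * L +
      22 * (s + D * L + G) + 3 * G + 30) ≤
      l.length * (j + 5 * w + (12 * m + 3 * D + 10) * L + 33 * m + 30) := by
    refine Nat.mul_le_mul_left _ ?_
    have : (12 * (s + D * L) + 3 * D + 10) * L ≤ (12 * m + 3 * D + 10) * L :=
      Nat.mul_le_mul_right _ (by omega)
    omega
  omega

end evaluate

variable {q : ℕ} {F : Finset (WFun q)} {B : ℕ}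
  {g : List (Bool ⊕ {f // f ∈ F}) → List (Bool ⊕ Bool)}

local notation "P" => Prog (CspAlph F B)
local notation "E" => Exec (Γ := CspAlph F B) (kq := Stk.qry) (ka := Stk.ans) g

/-- The reduction: the pins are collected in a table; if they contradict one another, `0` is
written; otherwise, the pinned instance is presented to the oracle in a number of contexts. -/
noncomputable def reduction (R D G : ℕ) (Qs : List (List (Bool ⊕ {f // f ∈ F}) × ℤ)) : P Unit :=
  .bind (.fold .inp (none, false) scanPins) fun s =>
    if s.2 then .push .out (.inr true)
    else seq (move .cpy .inp id) (seq (move .tab .tab2 id) (seq (emitFree R)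
      (.bind (.fold .inp false (emit R)) fun _ => evaluate D G Qs)))

theorem exec_scanPins {n : ℕ} (cs : List (Con (withPins F) (Fin n))) :
    ∃ m, E (.fold .inp (none, false) scanPins)
      (Function.update (fun _ => []) .inp (Instance.word ⟨n, cs⟩)) (m, (pinTable cs).2)
      (work (fun _ => []) (pinTable cs).1 [] [] (Instance.word ⟨n, cs⟩).reverse)
      (6 * (Instance.word ⟨n, cs⟩).length + 1) := by
  obtain ⟨m, h⟩ := scanPins_word (g := g) (B := B)
    (Function.update (fun _ => []) .inp (Instance.word ⟨n, cs⟩)) [] cs []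
  have e : work (Function.update (fun _ => []) .inp (Instance.word ⟨n, cs⟩)) [] [] [] [] =
      (Function.update (fun _ => []) .inp (Instance.word ⟨n, cs⟩) : ∀ k, List (CspAlph F B k)) := by
    funext k; cases k <;> simp [work]
  rw [e] at h
  refine ⟨_, (h.exec (by simp)).cast rfl ?_ le_rfl⟩
  funext k; cases k <;> simp [work]

theorem exec_emit (R : ℕ) {n : ℕ} (cs : List (Con (withPins F) (Fin n))) {p : P Unit} {S' t L}
    (hL : (Instance.word ⟨n, cs⟩).length = L)
    (hp : E p (work (fun _ => []) (pinTable cs).1 [] (inputWord R cs).reverse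
      (Instance.word ⟨n, cs⟩).reverse) () S' t) :
    E (seq (move .cpy .inp id) (seq (move .tab .tab2 id) (seq (emitFree R)
      (.bind (.fold .inp false (emit R)) fun _ => p))))
      (work (fun _ => []) (pinTable cs).1 [] [] (Instance.word ⟨n, cs⟩).reverse) () S'
      ((q + R + 15) * L + q + R + 5 + t) := by
  have hn : n ≤ L := hL ▸ numVars_le_length_word ⟨n, cs⟩
  have hT := length_pinTable cs
  set I : Instance (withPins F) := ⟨n, cs⟩ with hI
  have e1 : E (move .cpy .inp id) (work (fun _ => []) (pinTable cs).1 [] [] I.word.reverse) ()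
      (work (Function.update (fun _ => []) .inp I.word) (pinTable cs).1 [] [] []) (2 * L + 1) :=
    (exec_move (by simp) _ _).cast rfl (by funext k; cases k <;> simp [work]) (by simp [work, hL])
  have e2 := exec_rewalk (g := g) (B := B) (Function.update (fun _ => []) .inp I.word)
    (pinTable cs).1 [] [] []
  have e3 := exec_emitFree (g := g) (B := B) (Function.update (fun _ => []) .inp I.word) R []
    (pinTable cs).1.reverse [] []
  rw [List.append_nil, hT] at e2
  rw [List.append_nil, List.append_nil, List.reverse_reverse, List.countP_reverse,
    List.length_reverse, hT] at e3
  obtain ⟨m, h⟩ := emit_word (g := g) (B := B) (Function.update (fun _ => []) .inp I.word) R hT cs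
    ((unaryWord _ (q + R + (pinTable cs).1.countP Option.isNone)).reverse) []
  have e4 := h.exec (by simp [work, hI])
  have e5 : Function.update (work (Function.update (fun _ => []) .inp I.word) (pinTable cs).1 []
      (((cs.filterMap toF).flatMap fun C => constraintWord (queryCon R hT C)).reverse ++
      (unaryWord _ (q + R + (pinTable cs).1.countP Option.isNone)).reverse)
      (I.word.reverse ++ [])) .inp [] = (work (fun _ => []) (pinTable cs).1 []
      (inputWord R cs).reverse I.word.reverse : ∀ k, List (CspAlph F B k)) := by
    funext k; cases k <;> simp [work, inputWord]
  rw [← hI, e5, hL] at e4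
  refine (e1.seq (e2.seq (e3.seq (e4.bind hp)))).mono ?_
  have : (q + R + 15) * L = (q + R + 8) * L + 7 * L := by ring
  omega

/-- A bound for the number of steps of the reduction in terms of the length `L` of the input. -/
def stepBound {M : Type*} [Semiring M] (q R D H G B k c j : ℕ) (L : M) : M :=
  let m := q * (q + R + L) + (H + D) * (L + c) + 1 + D * L + G
  (q + R + 21) * L + q + R + 7 +
    (k * (j + 5 * ((q + R + L + 1) * (L + 1)) + (12 * m + 3 * D + 10) * L + 33 * m + 30) +
      (12 * (m + B + 1 + D * L) + 3 * D + 10) * L + 40 * (m + B + D * L + G) + 60)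

/-- Writing the bound over any semiring lets one formula serve as a number in the estimates and as
the polynomial in the reduction. -/
theorem eval_stepBound (q R D H G B k c j L : ℕ) :
    (stepBound q R D H G B k c j (Polynomial.X : Polynomial ℕ)).eval L =
      stepBound q R D H G B k c j L := by
  simp [stepBound]

theorem exec_reduction {R D H G c j : ℕ} (l : List (List (Con F (Fin q ⊕ Fin R)) × ℚ))
    (hl : ∀ (r : ℕ) (cs : List (Con F (Fin q ⊕ Fin r))),
      (gz cs id : ℚ) = (l.map fun p => p.2 * ((∑ τ, gz p.1 τ * gz cs τ : ℚ≥0) : ℚ)).sum)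
    (hD0 : 0 < D) (hD : ∀ f ∈ F, ∀ x, ∃ a : ℕ, a ≤ H ∧ f.2 x * D = a) (hG0 : 0 < G)
    (hG : D ^ c ∣ G) (hc : ∀ p ∈ l, p.1.length ≤ c) (hj : ∀ p ∈ l, (gadgetWord p.1).length ≤ j)
    (e : List (Con F (Fin q ⊕ Fin R)) × ℚ → ℤ) (he : ∀ p ∈ l, p.2 * G = e p)
    (hB : (l.map fun p => (e p).natAbs).sum ≤ B) (I : Instance (withPins F)) :
    ∃ S', Exec (Γ := CspAlph F B) (kq := Stk.qry) (ka := Stk.ans) (sharpCSP F).oracle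
      (reduction R D G (l.map fun p => (gadgetWord p.1, e p)))
      (Function.update (fun _ => []) .inp I.word) () S'
      (stepBound q R D H G B l.length c j I.word.length) ∧
      S' .out = encodingNNRat.encode I.Z := by
  obtain ⟨n, cs⟩ := I
  obtain ⟨m, e1⟩ := exec_scanPins (g := (sharpCSP F).oracle) (B := B) cs
  rw [Z_eq_gz]
  obtain ⟨L, hL⟩ : ∃ L, (Instance.word ⟨n, cs⟩).length = L := ⟨_, rfl⟩
  rw [hL] at e1 ⊢
  cases hconf : (pinTable cs).2 with
  | true =>
    rw [hconf] at e1
    -- The fraction `0 / 1` has an empty numerator word, so its encoding is the single denominator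
    -- bit `1`.
    refine ⟨_, (e1.bind (Exec.push (Γ := CspAlph F B) (kq := Stk.qry) (ka := Stk.ans)
      (g := (sharpCSP F).oracle) .out (.inr true) _)).mono ?_, ?_⟩
    · simp only [stepBound]
      have : (q + R + 21) * L = 6 * L + (q + R + 15) * L := by ring
      simp only [Nat.cast_id]
      omega
    · simp [work, encodingNNRat, encodingProd, encodingNatBool, encodeNat_eq_bits]
  | false =>
    rw [hconf] at e1
    have hready : Ready (work (fun _ => []) (pinTable cs).1 [] (inputWord R cs).reverse
        (Instance.word ⟨n, cs⟩).reverse : ∀ k, List (CspAlph F B k)) (inputWord R cs) L := by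
      constructor <;> simp [work, hL]
    set x : List (Con F (Fin q ⊕ Fin R)) × ℚ → ℚ≥0 :=
      fun p => (queryInstance (inputGadget cs) p.1).Z with hx
    have hlen : ∀ p ∈ l, (queryInstance (inputGadget cs) p.1).constraints.length ≤ L + c := by
      intro p hp
      have h1 := length_filterMap_toF_le cs
      have h2 := hc p hp
      simp only [queryInstance, inputGadget, List.length_append, List.length_map]
      omega
    -- A query has at most `L + c` constraints, of which `c` allow for the gadget. So `D ^ L`
    -- together with `D ^ c ∣ G` clears every denominator, and `d` is the slack.
    have hnat : ∀ p ∈ l, ∃ N : ℕ, x p * D ^ L * G = N := by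
      intro p hp
      obtain ⟨a, -, ha⟩ := (queryInstance (inputGadget cs) p.1).exists_Z_eq hD
      obtain ⟨d, hd⟩ := Nat.exists_eq_add_of_le (hlen p hp)
      obtain ⟨G', rfl⟩ := hG
      refine ⟨a * D ^ d * G', ?_⟩
      push_cast
      rw [← ha, ← mul_assoc, mul_assoc (x p), ← pow_add, hd, pow_add, ← mul_assoc]
    have hn : ∀ p ∈ l, x p * D ^ L * G = ((x p * D ^ L * G).num : ℕ) := by
      intro p hp
      obtain ⟨N, hN⟩ := hnat p hp
      rw [hN, NNRat.num_natCast]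
    have hquery : ∀ p ∈ l, (sharpCSP F).oracle (inputWord R cs ++ gadgetWord p.1) =
        encodingNNRat.encode (x p) ∧ (x p).SizeLE (q * (q + R + L) + (H + D) * (L + c) + 1) ∧
        x p * D ^ L * G = ((x p * D ^ L * G).num : ℕ) ∧ (gadgetWord p.1).length ≤ j := by
      refine fun p hp => ⟨?_, Instance.sizeLE_Z hD0 hD _ ?_ (hlen p hp), hn p hp, hj p hp⟩
      · rw [← word_queryInstance]
        exact (sharpCSP F).oracle_encode (queryInstance (inputGadget cs) p.1)
      · have := countP_pinTable_le cs
        simp only [queryInstance]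
        omega
    have hsum : (l.map fun p => (e p : ℚ) * ((x p * D ^ L * G).num : ℕ)).sum =
        gz (inputGadget cs) id * D ^ L * G * G := by
      rw [hl, ← List.sum_map_mul_right, ← List.sum_map_mul_right, ← List.sum_map_mul_right]
      congr 1
      refine List.map_congr_left fun p hp => ?_
      have h1 : ((x p * D ^ L * G : ℚ≥0) : ℚ) = ((x p * D ^ L * G).num : ℕ) := by
        exact_mod_cast congrArg (NNRat.cast (K := ℚ)) (hn p hp)
      rw [← he p hp, ← h1, ← Z_queryInstance]
      push_cast
      ring
    obtain ⟨S', e2, hS'⟩ := exec_evaluate (g := (sharpCSP F).oracle) (B := B) hD0 hG0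
      (fun p => gadgetWord p.1) e x _ l hquery hready (by simp [work]) hB
      (length_inputWord_le R cs hL) le_rfl hsum
    refine ⟨S', (e1.bind (exec_emit R cs hL e2)).mono ?_, hS'⟩
    simp only [stepBound, Nat.cast_id]
    have : (q + R + 21) * L = 6 * L + (q + R + 15) * L := by ring
    omega

end Prog

theorem lemma7 (q : ℕ) (hq : 0 < q) (F : Finset (WCSP.WFun q)) :
    PolyTimeTuringReducible
      (WCSP.sharpCSP (F ∪ Finset.univ.image (fun c : Fin q => WCSP.pin c)))
      (WCSP.sharpCSP F) := by
  obtain ⟨R, l, hl⟩ := WCSP.exists_gadget_list hq F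
  obtain ⟨D, H, hD0, hD⟩ := WCSP.exists_denominator F
  obtain ⟨N, hN0, hN⟩ := exists_integral_multiple (l.map Prod.snd)
  obtain ⟨c, hc⟩ : ∃ c, ∀ p ∈ l, p.1.length ≤ c :=
    ⟨(l.map fun p => p.1.length).sum, fun p hp => List.single_le_sum (by simp) _
      (List.mem_map.2 ⟨p, hp, rfl⟩)⟩
  obtain ⟨j, hj⟩ : ∃ j, ∀ p ∈ l, (WCSP.gadgetWord p.1).length ≤ j :=
    ⟨(l.map fun p => (WCSP.gadgetWord p.1).length).sum, fun p hp => List.single_le_sum (by simp) _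
      (List.mem_map.2 ⟨p, hp, rfl⟩)⟩
  -- The choice `G = D ^ c * N` serves twice: `D ^ c` pays for the gadget constraints and `N` makes
  -- the coefficients integral.
  have he : ∀ p ∈ l, ∃ e : ℤ, p.2 * (D ^ c * N : ℕ) = e := by
    intro p hp
    obtain ⟨e, he⟩ := hN p.2 (List.mem_map.2 ⟨p, hp, rfl⟩)
    refine ⟨D ^ c * e, ?_⟩
    push_cast
    rw [← he]
    ring
  choose! e he using he
  -- The digit bound is the sum of the absolute values of the integer coefficients, since each query
  -- changes a digit by at most the absolute value of its coefficient.
  refine ⟨Prog.toMachine (Γ := Prog.CspAlph F (l.map fun p => (e p).natAbs).sum) .inp .out .qry .ans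
    (Equiv.refl _) (Equiv.refl _) (Equiv.refl _) (Equiv.refl _)
    (Prog.reduction R D (D ^ c * N) (l.map fun p => (WCSP.gadgetWord p.1, e p))),
    Prog.stepBound q R D H (D ^ c * N) (l.map fun p => (e p).natAbs).sum l.length c j
      Polynomial.X + 1, fun I => ?_⟩
  obtain ⟨S', h, hS'⟩ := Prog.exec_reduction l hl hD0 hD (by positivity) (Dvd.intro _ rfl) hc hj e he
    le_rfl I
  have := Prog.Exec.outputsInTime (S := S') (t := Prog.stepBound q R D H (D ^ c * N)
      (l.map fun p => (e p).natAbs).sum l.length c j I.word.length) (p := Prog.reduction R D (D ^ c * N)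
      (l.map fun p => (WCSP.gadgetWord p.1, e p))) (kIn := Stk.inp) (kOut := Stk.out) (kQry := Stk.qry)
    (kAns := Stk.ans) (eI := Equiv.refl _) (eO := Equiv.refl _) (eQ := Equiv.refl _)
    (eR := Equiv.refl _) (g := (WCSP.sharpCSP F).oracle) (w := I.word)
    (u := WCSP.encodingNNRat.encode I.Z) (by simpa using! h) (by simpa using! hS')
  rw [Polynomial.eval_add, Polynomial.eval_one, Prog.eval_stepBound]
  exact this
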